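/- Let $n\ge 1$ and let $P_n$ be the set of perfect matchings of $[2n]=\{1,\dots,2n\}$, viewed as fixed-point-free involutions $\tau$. **Uncrossing order.** Place the points $1,\dots,2n$ in order around the boundary of a disk. A *medial graph* is a drawing (up to isotopy) of finitely many curves in the disk, with exactly the $2n$ marked points as ends on the boundary, whose only singularities are transverse double points (crossings) in the interior; the curves, followed straight through crossings, are its strands. It is *lensless* if it has no closed strand, no strand crosses itself, and any two strands cross at most once. The medial pairing $\tau(G)\in P_n$ of a lensless medial graph $G$ matches the two ends of each strand. If $G$ is lensless and $G'$ is obtained from $G$ by replacing one crossing by either of its two smoothings, and $G'$ is lensless too, write $\tau(G')\lessdot\tau(G)$. The uncrossing order $\le$ on $P_n$ is the reflexive transitive closure of $\lessdot$. **Affine permutations.** An affine permutation of type $(k,N)$ is a bijection $f:\mathbb Z\to\mathbb Z$ with $f(i+N)=f(i)+N$ for all $i$ and $\sum_{i=1}^{N}(f(i)-i)=kN$; it is bounded if $i\le f(i)\le i+N$ for all $i$. Its length $\ell(f)$ is the number of pairs $(i,j)\in\mathbb Z^2$ with $1\le i\le N$, $i<j$ and $f(i)>f(j)$. Bruhat order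 on affine permutations of type $(k,N)$ is the reflexive transitive closure of the relation: $f\to f\circ t$ whenever $t$ is a bijection of $\mathbb Z$ that, for some $a\not\equiv b \pmod N$, swaps $a+rN$ and $b+rN$ for every $r\in\mathbb Z$ and fixes all other integers, and $\ell(f)<\ell(f\circ t)$. For $\tau\in P_n$ let $f_\tau$ be the bounded affine permutation of type $(n-1,2n)$ with $f_\tau(i)=\tau(i)-1$ if $i<\tau(i)$ and $f_\tau(i)=\tau(i)+2n-1$ if $i>\tau(i)$, for $i\in[2n]$. **Grassmann necklaces.** For a bounded affine permutation $f$ of type $(k,N)$ let $\mathcal I(f)=(I_1,\dots,I_N)$, where $I_a\subset[N]$ is the ($k$-element) set of representatives in $[N]$, modulo $N$, of the numbers $f(b)$ with $b<a\le f(b)$. Let $\le_a$ be the order $a<_a a+1<_a\cdots<_a N<_a 1<_a\cdots<_a a-1$ on $[N]$. For $k$-element subsets $I,J$ of $[N]$ write $I\le_a J$ if, when the elements of $I$ and of $J$ are listed in increasing order for $\le_a$, each element of $I$ is $\le_a$ the corresponding element of $J$. Write $(I_1,\dots,I_N)\le(I_1',\dots,I_N')$ if $I_a\le_a I'_a$ for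 every $a\in[N]$. **Statement.** For all $\tau,\tau'\in P_n$ the following are equivalent: 1. $\tau'\le\tau$ in the uncrossing order; 2. $f_\tau\le f_{\tau'}$ in Bruhat order; 3. $\mathcal I(f_\tau)\le\mathcal I(f_{\tau'})$. -/

import Mathlib

/-! ### Matchings -/

/-- A (perfect) matching on `2n` points, as a fixed-point-free involution.
The element `r : Fin (2 * n)` stands for the label `r + 1` of `{1, …, 2n}`. -/
structure Matching (n : ℕ) where
  partner : Fin (2 * n) → Fin (2 * n)
  involutive : Function.Involutive partner
  fixedPointFree : ∀ r, partner r ≠ r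

/-! ### Medial graphs and the uncrossing order

A medial graph is a planar drawing in a disk of finitely many curves, with `2n` ends on the
boundary circle, whose only singular points are transverse double points. Up to isotopy, cut the
circle open between the points `2n` and `1`, pull the `2n` ends down to a horizontal line (in the
order `1, …, 2n` from left to right) and put the drawing in general position with respect to the
height. Reading it from the top down it is then a finite sequence of elementary slices, each with
one local extremum or one double point, which starts with no strand and ends with `2n` strands.
Conversely every such sequence is a drawing. Positions in a horizontal row are `0, 1, 2, …`. -/

/-- An elementary horizontal slice of a drawing, read from the top down. -/
inductive Slice : Type
  /-- A local maximum: a new arc with ends in the positions `i`, `i + 1` of the row below. -/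
  | birth (i : ℕ)
  /-- A local minimum: the positions `i`, `i + 1` of the row above are joined by an arc. -/
  | death (i : ℕ)
  /-- The curves in the positions `i` and `i + 1` cross. -/
  | cross (i : ℕ)

namespace Slice

/-- The slice can be placed below a row of `m` points. -/
def Fits : Slice → ℕ → Prop
  | birth i, m => i ≤ m
  | death i, m => i + 2 ≤ m
  | cross i, m => i + 2 ≤ m

/-- The number of points in the row below the slice, if there are `m` points in the row above. -/
def width : Slice → ℕ → ℕ
  | birth _, m => m + 2
  | death _, m => m - 2
  | cross _, m => m

/-- The slice has an arc from position `p` in the row above to position `q` in the row below. -/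
def Through : Slice → ℕ → ℕ → Prop
  | birth i, p, q => (p < i ∧ q = p) ∨ (i ≤ p ∧ q = p + 2)
  | death i, p, q => (q < i ∧ p = q) ∨ (i ≤ q ∧ p = q + 2)
  | cross i, p, q => q = Equiv.swap i (i + 1) p

end Slice

/-- The number of points in the bottom row of a sequence of slices with an empty top row. -/
def bottomWidth (w : List Slice) : ℕ :=
  w.foldl (fun m s => s.width m) 0

/-- A medial graph with `2n` boundary points, as a sequence of elementary slices. -/
structure MedialGraph (n : ℕ) where
  slices : List Slice
  fits : ∀ (t : ℕ) (s : Slice), slices[t]? = some s → s.Fits (bottomWidth (slices.take t))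
  bottomWidth_eq : bottomWidth slices = 2 * n

namespace MedialGraph

variable {n : ℕ}

/-- The point `(t, p)` is position `p` of the row just below the first `t` slices. -/
def IsPoint (G : MedialGraph n) (x : ℕ × ℕ) : Prop :=
  x.1 ≤ G.slices.length ∧ x.2 < bottomWidth (G.slices.take x.1)

/-- The boundary point with label `r + 1`: position `r` of the bottom row. -/
def boundaryPoint (G : MedialGraph n) (r : Fin (2 * n)) : ℕ × ℕ :=
  (G.slices.length, r)

/-- Two points of the drawing are joined by an arc inside one slice (a curve goes straight
through a crossing). -/
inductive Adj (G : MedialGraph n) : ℕ × ℕ → ℕ × ℕ → Prop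
  | through {t p q : ℕ} {s : Slice} (hs : G.slices[t]? = some s) (hpq : s.Through p q) :
      Adj G (t, p) (t + 1, q)
  | birth {t i : ℕ} (hs : G.slices[t]? = some (Slice.birth i)) :
      Adj G (t + 1, i) (t + 1, i + 1)
  | death {t i : ℕ} (hs : G.slices[t]? = some (Slice.death i)) :
      Adj G (t, i) (t, i + 1)

/-- Two points of the drawing lie on the same strand (wire). -/
def SameStrand (G : MedialGraph n) : ℕ × ℕ → ℕ × ℕ → Prop :=
  Relation.EqvGen G.Adj

/-- The slice number `t` is a crossing of the curves which enter it in the positions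
`i` and `i + 1`. -/
def IsCrossing (G : MedialGraph n) (t i : ℕ) : Prop :=
  G.slices[t]? = some (Slice.cross i)

/-- A medial graph is lensless if it has no closed strand, no strand crosses itself, and no two
strands cross each other more than once. -/
structure Lensless (G : MedialGraph n) : Prop where
  /-- Every strand begins and ends on the boundary. -/
  no_closed : ∀ x, G.IsPoint x → ∃ r, G.SameStrand x (G.boundaryPoint r)
  no_self_crossing : ∀ t i, G.IsCrossing t i → ¬ G.SameStrand (t, i) (t, i + 1)
  no_lens : ∀ t i t' i', G.IsCrossing t i → G.IsCrossing t' i' → t ≠ t' →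
    ¬ ((G.SameStrand (t, i) (t', i') ∧ G.SameStrand (t, i + 1) (t', i' + 1)) ∨
       (G.SameStrand (t, i) (t', i' + 1) ∧ G.SameStrand (t, i + 1) (t', i')))

/-- The medial pairing of `G` is `τ`: the strands join each boundary point to its partner. -/
def HasPairing (G : MedialGraph n) (τ : Matching n) : Prop :=
  ∀ r s, G.SameStrand (G.boundaryPoint r) (G.boundaryPoint s) ↔ s = r ∨ s = τ.partner r

/-- `G'` is obtained from `G` by uncrossing one crossing, in one of the two ways: `)(`, where the
two curves run down side by side, or a local minimum followed by a local maximum. -/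
def Uncrosses (G G' : MedialGraph n) : Prop :=
  ∃ (u v : List Slice) (i : ℕ), G.slices = u ++ Slice.cross i :: v ∧
    (G'.slices = u ++ v ∨ G'.slices = u ++ Slice.death i :: Slice.birth i :: v)

end MedialGraph

/-- `τ' ⋖ τ`: some lensless medial graph with pairing `τ` has an uncrossing which is lensless and
has pairing `τ'`. -/
def UncrossingCover {n : ℕ} (τ' τ : Matching n) : Prop :=
  ∃ G G' : MedialGraph n, G.Lensless ∧ G.HasPairing τ ∧ G.Uncrosses G' ∧
    G'.Lensless ∧ G'.HasPairing τ'

/-- The uncrossing order `τ' ≤ τ` on matchings. -/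
def UncrossingLE {n : ℕ} (τ' τ : Matching n) : Prop :=
  Relation.ReflTransGen UncrossingCover τ' τ

/-! ### Affine permutations and Bruhat order -/

/-- An affine permutation of type `(k, N)`. -/
structure AffinePerm (k N : ℕ) where
  toPerm : Equiv.Perm ℤ
  periodic : ∀ i, toPerm (i + N) = toPerm i + N
  sum_eq : ∑ i ∈ Finset.Icc (1 : ℤ) N, (toPerm i - i) = k * N

namespace AffinePerm

variable {k N : ℕ}

/-- The length of an affine permutation: the number of inversions, up to simultaneous
translation by `N`. -/
noncomputable def length (f : AffinePerm k N) : ℕ :=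
  Set.ncard {p : ℤ × ℤ | 1 ≤ p.1 ∧ p.1 ≤ N ∧ p.1 < p.2 ∧ f.toPerm p.2 < f.toPerm p.1}

/-- The affine transposition which swaps `a + r N` and `b + r N` for all `r`, for `a`, `b`
incongruent modulo `N`. These are the reflections of the affine symmetric group. -/
def transposition (N : ℕ) (a b x : ℤ) : ℤ :=
  if x ≡ a [ZMOD N] then x + (b - a) else if x ≡ b [ZMOD N] then x + (a - b) else x

/-- `f' = f t` for a reflection `t`, and `f'` is longer than `f`. -/
def BruhatStep (f f' : AffinePerm k N) : Prop :=
  ∃ a b : ℤ, ¬ a ≡ b [ZMOD N] ∧ (∀ x, f'.toPerm x = f.toPerm (transposition N a b x)) ∧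
    f.length < f'.length

/-- Bruhat order on affine permutations of type `(k, N)`. -/
def BruhatLE (f f' : AffinePerm k N) : Prop :=
  Relation.ReflTransGen BruhatStep f f'

end AffinePerm

/-- A bounded affine permutation of type `(k, N)`. -/
structure BoundedAffinePerm (k N : ℕ) extends AffinePerm k N where
  le_apply : ∀ i, i ≤ toPerm i
  apply_le : ∀ i, toPerm i ≤ i + N

/-! ### Grassmann necklaces -/

/-- The residue of `x` modulo `N` with representatives in `{1, …, N}`, where `r : Fin N` stands
for the representative `r + 1`. -/
def residue (N : ℕ) [NeZero N] (x : ℤ) : Fin N :=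
  ⟨((x - 1) % N).toNat, by
    have hN : (0 : ℤ) < N := by exact_mod_cast Nat.pos_of_ne_zero (NeZero.ne N)
    have h1 := Int.emod_nonneg (x - 1) hN.ne'
    have h2 := Int.emod_lt_of_pos (x - 1) hN
    omega⟩

open Classical in
/-- The Grassmann necklace of a bounded affine permutation: the set with index `a ∈ {1, …, N}`
consists of the residues modulo `N` of the numbers `f b`, for the integers `b < a` with
`f b ≥ a`. (As everywhere, `r : Fin N` stands for `r + 1`.) -/
noncomputable def grassmannNecklace {k N : ℕ} [NeZero N] (f : BoundedAffinePerm k N)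
    (a : Fin N) : Finset (Fin N) :=
  Finset.univ.filter fun c =>
    ∃ b : ℤ, b < (a : ℤ) + 1 ∧ (a : ℤ) + 1 ≤ f.toPerm b ∧ residue N (f.toPerm b) = c

/-- Dominance order: `{i₁ < ⋯ < i_k} ≤ {j₁ < ⋯ < j_k}` if `i_r ≤ j_r` for all `r`; sets of
different cardinalities are not comparable. -/
def DominanceLE {N : ℕ} (I J : Finset (Fin N)) : Prop :=
  List.Forall₂ (· ≤ ·) (I.sort (· ≤ ·)) (J.sort (· ≤ ·))

/-- Dominance order for the rotated order `a < a + 1 < ⋯ < N < 1 < ⋯ < a - 1`; the (cyclic)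
subtraction of `a` is the order isomorphism from the rotated order to the usual one. -/
def RotatedDominanceLE {N : ℕ} (a : Fin N) (I J : Finset (Fin N)) : Prop :=
  DominanceLE (I.image (· - a)) (J.image (· - a))

/-- The order on Grassmann necklaces. -/
def NecklaceLE {N : ℕ} (I J : Fin N → Finset (Fin N)) : Prop :=
  ∀ a, RotatedDominanceLE a (I a) (J a)

/-! ### The bounded affine permutations of a matching -/

theorem residue_eq_iff (N : ℕ) [NeZero N] (x : ℤ) (r : Fin N) :
    residue N x = r ↔ ∃ q : ℤ, x = (r : ℤ) + 1 + q * N := by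
  have hN : (0 : ℤ) < N := by exact_mod_cast Nat.pos_of_ne_zero (NeZero.ne N)
  have h1 := Int.emod_nonneg (x - 1) hN.ne'
  have hr : ((r : ℕ) : ℤ) < N := by exact_mod_cast r.isLt
  rw [Fin.ext_iff]
  constructor
  · intro h
    refine ⟨(x - 1) / N, ?_⟩
    have h3 : (((x - 1) % N).toNat : ℤ) = (r : ℕ) := by exact_mod_cast h
    rw [Int.toNat_of_nonneg h1] at h3
    have h4 := Int.emod_add_mul_ediv (x - 1) N
    rw [h3] at h4
    linarith [mul_comm ((x - 1) / (N : ℤ)) (N : ℤ)]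
  · rintro ⟨q, rfl⟩
    have h5 : ((r : ℕ) : ℤ) + 1 + q * N - 1 = (r : ℕ) + q * N := by ring
    change ((((r : ℕ) : ℤ) + 1 + q * N - 1) % N).toNat = (r : ℕ)
    rw [h5, Int.add_mul_emod_self_right, Int.emod_eq_of_lt (by positivity) hr]
    simp

namespace Matching

variable {n : ℕ}

/-- `g_τ(i) - i` for `i` of residue `r`: here `g_τ(i) = τ(i)` if `i < τ(i)` and
`g_τ(i) = τ(i) + 2n` if `i > τ(i)`, for `i ∈ {1, …, 2n}`. -/
def jump (τ : Matching n) (r : Fin (2 * n)) : ℤ :=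
  if r < τ.partner r then (τ.partner r : ℤ) - r else (τ.partner r : ℤ) + (2 * n : ℕ) - r

theorem jump_pos (τ : Matching n) (r : Fin (2 * n)) : 0 < τ.jump r := by
  have h := r.isLt
  unfold jump
  split_ifs with h1
  · rw [Fin.lt_def] at h1
    omega
  · omega

theorem jump_lt (τ : Matching n) (r : Fin (2 * n)) : τ.jump r < (2 * n : ℕ) := by
  have h := (τ.partner r).isLt
  have h2 : (τ.partner r : ℕ) ≠ r := fun h => τ.fixedPointFree r (Fin.ext h)
  unfold jump
  split_ifs with h1
  · omega
  · rw [Fin.lt_def] at h1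
    omega

theorem jump_add_jump (τ : Matching n) (r : Fin (2 * n)) :
    τ.jump r + τ.jump (τ.partner r) = (2 * n : ℕ) := by
  have h2 : (τ.partner r : ℕ) ≠ r := fun h => τ.fixedPointFree r (Fin.ext h)
  unfold jump
  rw [τ.involutive r]
  simp only [Fin.lt_def]
  split_ifs <;> omega

theorem sum_jump (τ : Matching n) : ∑ r, τ.jump r = n * (2 * n : ℕ) := by
  have h1 : ∑ r, τ.jump (τ.partner r) = ∑ r, τ.jump r :=
    Equiv.sum_comp (τ.involutive.toPerm τ.partner) τ.jump
  have h2 : ∑ r, (τ.jump r + τ.jump (τ.partner r)) = (2 * n : ℕ) * (2 * n : ℕ) := by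
    simp [jump_add_jump]
  rw [Finset.sum_add_distrib, h1] at h2
  push_cast at h2 ⊢
  linarith

theorem sum_Icc_eq (N : ℕ) (F : ℤ → ℤ) :
    ∑ i ∈ Finset.Icc (1 : ℤ) N, F i = ∑ r : Fin N, F ((r : ℤ) + 1) := by
  symm
  refine Finset.sum_bij (fun r _ => ((r : ℕ) : ℤ) + 1) ?_ ?_ ?_ ?_
  · intro r _
    have := r.isLt
    rw [Finset.mem_Icc]
    omega
  · intro r _ s _ h
    apply Fin.ext
    omega
  · intro i hi
    rw [Finset.mem_Icc] at hi
    exact ⟨⟨(i - 1).toNat, by omega⟩, Finset.mem_univ _, by dsimp only; omega⟩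
  · intro r _
    rfl

variable [NeZero n]

instance instNeZeroTwoMul : NeZero (2 * n) := ⟨mul_ne_zero two_ne_zero (NeZero.ne n)⟩

/-- `g_τ` as a function on `ℤ`, extended from `{1, …, 2n}` by `g_τ(i + 2n) = g_τ(i) + 2n`. -/
def gFun (τ : Matching n) (x : ℤ) : ℤ := x + τ.jump (residue (2 * n) x)

theorem residue_gFun (τ : Matching n) (x : ℤ) :
    residue (2 * n) (τ.gFun x) = τ.partner (residue (2 * n) x) := by
  obtain ⟨q, hq⟩ := (residue_eq_iff (2 * n) x _).1 rfl
  rw [residue_eq_iff]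
  unfold gFun jump
  split_ifs
  · exact ⟨q, by linarith⟩
  · exact ⟨q + 1, by linarith⟩

theorem gFun_gFun (τ : Matching n) (x : ℤ) : τ.gFun (τ.gFun x) = x + (2 * n : ℕ) := by
  have h : τ.gFun (τ.gFun x) = τ.gFun x + τ.jump (residue (2 * n) (τ.gFun x)) := rfl
  rw [h, residue_gFun, ← τ.jump_add_jump (residue (2 * n) x)]
  simp only [gFun]
  ring

theorem gFun_add (τ : Matching n) (x : ℤ) :
    τ.gFun (x + (2 * n : ℕ)) = τ.gFun x + (2 * n : ℕ) := by
  rw [← τ.gFun_gFun (τ.gFun x), τ.gFun_gFun x]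

/-- `g_τ`, a permutation of `ℤ`. -/
def gPerm (τ : Matching n) : Equiv.Perm ℤ where
  toFun := τ.gFun
  invFun x := τ.gFun x - (2 * n : ℕ)
  left_inv x := by simp only [gFun_gFun]; ring
  right_inv x := by
    have h := τ.gFun_add (τ.gFun x - (2 * n : ℕ))
    rw [sub_add_cancel, gFun_gFun] at h
    linarith

/-- The bounded affine permutation `f_τ`, given by `f_τ(i) = g_τ(i) - 1`, of type
`(n - 1, 2n)`. -/
def fPerm (τ : Matching n) : BoundedAffinePerm (n - 1) (2 * n) where
  toPerm := τ.gPerm.trans (Equiv.subRight 1)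
  periodic i := by
    change τ.gFun (i + (2 * n : ℕ)) - 1 = τ.gFun i - 1 + (2 * n : ℕ)
    rw [gFun_add]
    ring
  sum_eq := by
    change ∑ i ∈ Finset.Icc (1 : ℤ) (2 * n : ℕ), (τ.gFun i - 1 - i) = _
    have hn : 1 ≤ n := Nat.one_le_iff_ne_zero.2 (NeZero.ne n)
    have h : ∀ r : Fin (2 * n), residue (2 * n) ((r : ℤ) + 1) = r := fun r =>
      (residue_eq_iff _ _ _).2 ⟨0, by ring⟩
    rw [sum_Icc_eq (2 * n) fun i => τ.gFun i - 1 - i]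
    have h2 : ∀ r : Fin (2 * n),
        τ.gFun ((r : ℤ) + 1) - 1 - ((r : ℤ) + 1) = τ.jump r - 1 := by
      intro r
      simp only [gFun, h]
      ring
    simp only [h2]
    rw [Finset.sum_sub_distrib, sum_jump]
    push_cast [Nat.cast_sub hn]
    simp
    ring
  le_apply i := by
    change i ≤ i + τ.jump _ - 1
    linarith [Int.add_one_le_iff.2 (τ.jump_pos (residue (2 * n) i))]
  apply_le i := by
    change i + τ.jump _ - 1 ≤ i + (2 * n : ℕ)
    linarith [τ.jump_lt (residue (2 * n) i)]

end Matching

/-! ### Dominance order through counting -/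

/-! The mediating object is the family of numbers `arcCount g i j`: lift a matching to `g = τ.gFun`
on the integers and count the arcs `x < g x` inside `[i, j]`. Since `f_τ = g - 1`, these are the
values of the rank function of `f_τ` (`rank_fPerm`). The necklace records the same numbers by
complementary counting, so condition 3 says exactly that no interval contains fewer arcs of `τ'`
than of `τ` (`necklaceLE_iff`). The equivalence is proved as a cycle.

1 ⇒ 2. Two curves in a disk cross an odd number of times iff their ends interlace; here this is a
count of inversions modulo two, followed row by row through the drawing
(`inversionParity_eq_sum_crossParity`). So in a lensless graph every crossing belongs to two
interlacing chords, and smoothing it re-pairs only their four ends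
(`UncrossingCover.eq_or_isSmoothing`). On lifts, arcs `x₁ < y₁`, `x₂ < y₂` become `x₁ < y₂`, `x₂ <
y₁`, which multiplies `f_τ` by the reflections in `x₁, x₂` and in `y₁, y₂`; each increases the
length (`bruhatLE_of_isUncrossing`).

2 ⇒ 3. A reflection that increases the length can only increase the rank function
(`rank_le_rank_of_bruhatLE`).

3 ⇒ 1. Induction on the number of crossings of `τ`. If `τ ≠ τ'`, a shortest interval with strictly
more arcs of `τ'` leads to two crossing arcs of `τ` such that every interval able to gain an arc by
uncrossing them has an arc to spare (`IsMatchingLift.exists_uncrossing`); the inequality thus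
survives the uncrossing (`IsUncrossing.arcCount_le`). The pair is also chosen so that no third chord
crosses both old chords and neither new one, hence exactly one crossing disappears.

It remains to draw this as a cover. Every matching has a drawing without local minima and with as
few crossings as its pairing permits (`exists_slices`), and a drawing that is minimal in this sense
and has no closed strand is lensless (`lensless_of_crossingSum`). The two chosen chords meet
somewhere in it; the appropriate smoothing there has one crossing fewer (`exists_uncrosses`), so it
is again minimal, hence lensless.

Strands are handled through colourings, the predicates on points that are constant along arcs: two
points lie on one strand iff no colouring tells them apart (`sameStrand_iff`). -/

theorem List.Forall₂.countP_le {α : Type*} [LinearOrder α] {l l' : List α}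
    (h : List.Forall₂ (· ≤ ·) l l') (c : α) :
    l'.countP (· ≤ c) ≤ l.countP (· ≤ c) := by
  induction h with
  | nil => simp
  | cons hab _ ih =>
    rw [List.countP_cons, List.countP_cons]
    refine Nat.add_le_add ih ?_
    split_ifs with h1 h2
    · simp
    · simp only [decide_eq_true_eq] at h1 h2
      exact absurd (hab.trans h1) h2
    · simp
    · simp

/-- If `y < x`, then no entry of the sorted list `x :: l` is at most `y`, against the count at `y`.
For the tails, a threshold `c ≥ y` counts both heads, which cancel, while a threshold `c < y` counts
nothing in `l'`. -/
theorem List.forall₂_le_of_countP_le {α : Type*} [LinearOrder α] :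
    ∀ {l l' : List α}, l.Pairwise (· ≤ ·) → l'.Pairwise (· ≤ ·) → l.length = l'.length →
      (∀ c, l'.countP (· ≤ c) ≤ l.countP (· ≤ c)) → List.Forall₂ (· ≤ ·) l l'
  | [], [], _, _, _, _ => List.Forall₂.nil
  | [], _ :: _, _, _, h, _ => by simp at h
  | _ :: _, [], _, _, h, _ => by simp at h
  | x :: l, y :: l', hl, hl', h, hc => by
    rw [List.pairwise_cons] at hl hl'
    have hxy : x ≤ y := by
      have h1 := hc y
      rw [List.countP_cons, List.countP_cons] at h1
      by_contra hlt
      rw [not_le] at hlt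
      have h2 : l.countP (· ≤ y) = 0 := by
        rw [List.countP_eq_zero]
        intro z hz
        simp only [decide_eq_true_eq, not_le]
        exact hlt.trans_le (hl.1 z hz)
      simp [h2, hlt.not_ge] at h1
    refine List.Forall₂.cons hxy (List.forall₂_le_of_countP_le hl.2 hl'.2 (by simpa using h) ?_)
    intro c
    have h1 := hc c
    rw [List.countP_cons, List.countP_cons] at h1
    by_cases hyc : y ≤ c
    · simpa [hyc, hxy.trans hyc] using h1
    · have h2 : l'.countP (· ≤ c) = 0 := by
        rw [List.countP_eq_zero]
        intro z hz
        simp only [decide_eq_true_eq, not_le]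
        exact (not_le.1 hyc).trans_le (hl'.1 z hz)
      omega

theorem Finset.countP_sort {α : Type*} [LinearOrder α] (I : Finset α) (p : α → Prop)
    [DecidablePred p] : (I.sort (· ≤ ·)).countP (fun x => decide (p x)) = (I.filter p).card := by
  rw [← Multiset.coe_countP, Finset.sort_eq, Finset.card_def, Finset.filter_val,
    Multiset.countP_eq_card_filter]

theorem dominanceLE_iff {N : ℕ} (I J : Finset (Fin N)) :
    DominanceLE I J ↔
      I.card = J.card ∧ ∀ c, (J.filter (· ≤ c)).card ≤ (I.filter (· ≤ c)).card := by
  constructor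
  · intro h
    refine ⟨?_, fun c => ?_⟩
    · simpa using h.length_eq
    · simpa only [Finset.countP_sort] using h.countP_le c
  · rintro ⟨h1, h2⟩
    refine List.forall₂_le_of_countP_le (Finset.pairwise_sort _ _) (Finset.pairwise_sort _ _)
      (by simpa using h1) fun c => ?_
    simpa only [Finset.countP_sort] using h2 c

/-! ### Length and rank of affine permutations -/

namespace AffinePerm

variable {k N : ℕ}

theorem apply_add_mul (f : AffinePerm k N) (x r : ℤ) :
    f.toPerm (x + N * r) = f.toPerm x + N * r := by
  induction r using Int.induction_on with
  | zero => simp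
  | succ r ih =>
    have h := f.periodic (x + N * r)
    rw [ih] at h
    rw [show x + N * ((r : ℤ) + 1) = x + N * r + N by ring, h]
    ring
  | pred r ih =>
    have h := f.periodic (x + N * (-(r : ℤ) - 1))
    rw [show x + N * (-(r : ℤ) - 1) + N = x + N * (-(r : ℤ)) by ring, ih] at h
    linarith

theorem apply_add_of_modEq (f : AffinePerm k N) {x a : ℤ} (h : x ≡ a [ZMOD N]) (d : ℤ) :
    f.toPerm (x + d) - f.toPerm x = f.toPerm (a + d) - f.toPerm a := by
  obtain ⟨r, hr⟩ := h.symm.dvd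
  obtain rfl : x = a + N * r := by linarith
  rw [show a + N * r + d = a + d + N * r by ring, apply_add_mul, apply_add_mul]
  ring

theorem exists_bound (f : AffinePerm k N) [NeZero N] :
    ∃ M : ℤ, ∀ x, |f.toPerm x - x| ≤ M := by
  have hN : (0 : ℤ) < N := by exact_mod_cast Nat.pos_of_ne_zero (NeZero.ne N)
  refine ⟨∑ r ∈ Finset.Ico (0 : ℤ) N, |f.toPerm r - r|, fun x => ?_⟩
  have h : f.toPerm x - x = f.toPerm (x % N) - x % N := by
    conv_lhs => rw [← Int.emod_add_mul_ediv x N, apply_add_mul]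
    ring
  rw [h]
  exact Finset.single_le_sum (f := fun r => |f.toPerm r - r|) (fun _ _ => abs_nonneg _)
    (Finset.mem_Ico.2 ⟨Int.emod_nonneg _ hN.ne', Int.emod_lt_of_pos _ hN⟩)

theorem transposition_add_mul (a b x r : ℤ) :
    transposition N a b (x + N * r) = transposition N a b x + N * r := by
  have h : ∀ c, x + N * r ≡ c [ZMOD N] ↔ x ≡ c [ZMOD N] := fun c => by
    simp [Int.ModEq]
  simp only [transposition, h]
  split_ifs <;> ring

theorem transposition_transposition {a b : ℤ} (hab : ¬ a ≡ b [ZMOD N]) (x : ℤ) :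
    transposition N a b (transposition N a b x) = x := by
  by_cases h1 : x ≡ a [ZMOD N]
  · have h2 : x + (b - a) ≡ b [ZMOD N] := by simpa using h1.add_right (b - a)
    have h3 : ¬ x + (b - a) ≡ a [ZMOD N] := fun h => hab (h.symm.trans h2)
    simp only [transposition, h1, h2, h3, if_true, if_false]
    ring
  · by_cases h2 : x ≡ b [ZMOD N]
    · have h3 : x + (a - b) ≡ a [ZMOD N] := by simpa using h2.add_right (a - b)
      simp only [transposition, h1, h2, h3, if_true, if_false]
      ring
    · simp only [transposition, h1, h2, if_false]

theorem transposition_comm {a b : ℤ} (hab : ¬ a ≡ b [ZMOD N]) (x : ℤ) :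
    transposition N a b x = transposition N b a x := by
  unfold transposition
  split_ifs with h1 h2
  · exact absurd (h1.symm.trans h2) hab
  all_goals rfl

/-- By periodicity the reflection moves `x` by plus or minus `b - a` and the value of `f` by the
same sign times `f b - f a`. Comparisons after a reflection thereby become linear arithmetic in
these two differences. -/
theorem transposition_cases (f : AffinePerm k N) (a b x : ℤ) :
    (transposition N a b x = x + (b - a) ∧
      f.toPerm (transposition N a b x) = f.toPerm x + (f.toPerm b - f.toPerm a)) ∨
    (transposition N a b x = x - (b - a) ∧
      f.toPerm (transposition N a b x) = f.toPerm x - (f.toPerm b - f.toPerm a)) ∨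
    transposition N a b x = x := by
  unfold transposition
  split_ifs with h1 h2
  · left
    have h := f.apply_add_of_modEq h1 (b - a)
    rw [add_sub_cancel] at h
    exact ⟨rfl, by linarith⟩
  · right; left
    have h := f.apply_add_of_modEq h2 (a - b)
    rw [add_sub_cancel] at h
    exact ⟨by ring, by linarith⟩
  · right; right; rfl

theorem finite_inversions (f : AffinePerm k N) [NeZero N] :
    {p : ℤ × ℤ | 1 ≤ p.1 ∧ p.1 ≤ N ∧ p.1 < p.2 ∧ f.toPerm p.2 < f.toPerm p.1}.Finite := by
  obtain ⟨M, hM⟩ := f.exists_bound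
  refine ((Set.finite_Icc (1 : ℤ) N).prod (Set.finite_Icc (1 : ℤ) (N + 2 * M))).subset ?_
  rintro ⟨x, y⟩ ⟨h1, h2, h3, h4⟩
  have h5 := abs_le.1 (hM x)
  have h6 := abs_le.1 (hM y)
  simp only at h1 h2 h3 h4
  simp only [Set.mem_prod, Set.mem_Icc]
  omega

/-- Inversions of `f` inject into those of `f'`: apply the reflection `t` to both entries if this
keeps their order, and otherwise keep the pair. The map commutes with translation by `N`, and it
misses the inversion `(a, b)` of `f'`: a preimage would be `(b, a)`, which is in the wrong order, or
`(a, b)`, which is no inversion of `f`. -/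
theorem length_lt_length [NeZero N] {f f' : AffinePerm k N} {a b : ℤ}
    (hab : ¬ a ≡ b [ZMOD N]) (hf : ∀ x, f'.toPerm x = f.toPerm (transposition N a b x))
    (hlt : a < b) (hflt : f.toPerm a < f.toPerm b) : f.length < f'.length := by
  have hN : (0 : ℤ) < N := by exact_mod_cast Nat.pos_of_ne_zero (NeZero.ne N)
  set t := transposition N a b with ht
  have htt : ∀ x, t (t x) = x := transposition_transposition hab
  have hadd : ∀ x r, t (x + N * r) = t x + N * r := transposition_add_mul a b
  -- The representative of a pair, up to simultaneous translation, with first entry in `{1, …, N}`;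
  -- the length counts these.
  set norm : ℤ × ℤ → ℤ × ℤ := fun q =>
    (q.1 + N * (-((q.1 - 1) / N)), q.2 + N * (-((q.1 - 1) / N))) with hnorm
  set φ : ℤ × ℤ → ℤ × ℤ := fun p => if t p.1 < t p.2 then (t p.1, t p.2) else p with hφ
  have hφadd : ∀ (p : ℤ × ℤ) (r : ℤ),
      φ (p.1 + N * r, p.2 + N * r) = ((φ p).1 + N * r, (φ p).2 + N * r) := by
    intro p r
    simp only [hφ, hadd, add_lt_add_iff_right]
    split_ifs <;> rfl
  have hφinj : ∀ p q : ℤ × ℤ, p.1 < p.2 → q.1 < q.2 → φ p = φ q → p = q := by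
    rintro ⟨p1, p2⟩ ⟨q1, q2⟩ hp hq h
    simp only [hφ] at h hp hq
    have e1 := htt p1
    have e2 := htt p2
    have e3 := htt q1
    have e4 := htt q2
    split_ifs at h with h1 h2 h2 <;> rw [Prod.mk.injEq] at h ⊢
    · rw [← e1, ← e2, h.1, h.2]
      exact ⟨e3, e4⟩
    · rw [h.1] at e1
      rw [h.2] at e2
      omega
    · rw [← h.1] at e3
      rw [← h.2] at e4
      omega
    · exact h
  have hba : ¬ b ≡ a [ZMOD N] := fun h => hab h.symm
  have hbase : (f'.toPerm a = f.toPerm b ∧ f'.toPerm b = f.toPerm a) := by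
    rw [hf, hf, ht]
    constructor
    · simp [transposition]
    · simp [transposition, hba]
  have hnot : ∀ p : ℤ × ℤ, p.1 < p.2 → f.toPerm p.2 < f.toPerm p.1 → φ p ≠ (a, b) := by
    rintro ⟨p1, p2⟩ hp hp' h
    simp only [hφ] at h hp hp'
    have hta : t a = b := by simp [ht, transposition]
    have htb : t b = a := by rw [← hta, htt]
    split_ifs at h with h1 <;> rw [Prod.mk.injEq] at h
    · have e1 := htt p1
      have e2 := htt p2
      rw [h.1, hta] at e1
      rw [h.2, htb] at e2
      omega
    · rw [h.1, h.2] at hp'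
      omega
  have hmem : ∀ p : ℤ × ℤ, p.1 < p.2 → f.toPerm p.2 < f.toPerm p.1 →
      (φ p).1 < (φ p).2 ∧ f'.toPerm (φ p).2 < f'.toPerm (φ p).1 := by
    rintro ⟨p1, p2⟩ hp hp'
    simp only [hφ] at hp hp' ⊢
    split_ifs with h1
    · refine ⟨h1, ?_⟩
      rw [hf, hf, htt, htt]
      exact hp'
    · refine ⟨hp, ?_⟩
      simp only [hf]
      have c1 := f.transposition_cases a b p1
      have c2 := f.transposition_cases a b p2
      rw [← ht] at c1 c2
      rcases c1 with c1 | c1 | c1 <;> rcases c2 with c2 | c2 | c2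
      all_goals first | omega | (rw [c1]; omega) | (rw [c2]; omega)
  have hnorm1 : ∀ q : ℤ × ℤ, 1 ≤ (norm q).1 ∧ (norm q).1 ≤ N := by
    intro q
    have h1 := Int.emod_add_mul_ediv (q.1 - 1) N
    have h2 := Int.emod_nonneg (q.1 - 1) hN.ne'
    have h3 := Int.emod_lt_of_pos (q.1 - 1) hN
    simp only [hnorm, mul_neg]
    omega
  have hnorm2 : ∀ q : ℤ × ℤ, q.1 < q.2 → f'.toPerm q.2 < f'.toPerm q.1 →
      (norm q).1 < (norm q).2 ∧ f'.toPerm (norm q).2 < f'.toPerm (norm q).1 := by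
    intro q h1 h2
    simp only [hnorm, apply_add_mul]
    omega
  have huniq : ∀ x r : ℤ, 1 ≤ x → x ≤ N → 1 ≤ x + N * r → x + N * r ≤ N → r = 0 := by
    intro x r h1 h2 h3 h4
    have h5 : (N : ℤ) * r < N * 1 := by linarith
    have h6 : (N : ℤ) * (-1) < N * r := by linarith
    have h7 := lt_of_mul_lt_mul_left h5 hN.le
    have h8 := lt_of_mul_lt_mul_left h6 hN.le
    omega
  have hshift : ∀ p q : ℤ × ℤ, norm p = norm q → ∃ r, p = (q.1 + N * r, q.2 + N * r) := by
    rintro ⟨p1, p2⟩ ⟨q1, q2⟩ h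
    simp only [hnorm, Prod.mk.injEq] at h
    refine ⟨(p1 - 1) / N - (q1 - 1) / N, ?_⟩
    rw [Prod.mk.injEq]
    constructor <;> linarith [h.1, h.2]
  set S := {p : ℤ × ℤ | 1 ≤ p.1 ∧ p.1 ≤ N ∧ p.1 < p.2 ∧ f.toPerm p.2 < f.toPerm p.1} with hS
  set S' := {p : ℤ × ℤ | 1 ≤ p.1 ∧ p.1 ≤ N ∧ p.1 < p.2 ∧ f'.toPerm p.2 < f'.toPerm p.1} with hS'
  have hinj : Set.InjOn (fun p => norm (φ p)) S := by
    rintro p ⟨p1, p2, p3, p4⟩ q ⟨q1, q2, q3, q4⟩ h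
    obtain ⟨r, hr⟩ := hshift _ _ h
    rw [← hφadd] at hr
    have h1 := hφinj p _ p3 (by simpa using q3) hr
    have h2 : r = 0 := by
      refine huniq q.1 r q1 q2 ?_ ?_
      · rw [h1] at p1; exact p1
      · rw [h1] at p2; exact p2
    rw [h1, h2]
    simp
  have hsub : (fun p => norm (φ p)) '' S ⊂ S' := by
    rw [Set.ssubset_iff_of_subset]
    · refine ⟨norm (a, b), ⟨(hnorm1 _).1, (hnorm1 _).2, ?_⟩, ?_⟩
      · exact hnorm2 (a, b) hlt (by simp only [hbase]; exact hflt)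
      · rintro ⟨p, ⟨p1, p2, p3, p4⟩, h⟩
        obtain ⟨r, hr⟩ := hshift _ _ h.symm
        rw [← hφadd] at hr
        exact hnot (p.1 + N * r, p.2 + N * r) (by simpa using p3)
          (by simp only [apply_add_mul]; omega) hr.symm
    · rintro _ ⟨p, ⟨p1, p2, p3, p4⟩, rfl⟩
      have h1 := hmem p p3 p4
      exact ⟨(hnorm1 _).1, (hnorm1 _).2, hnorm2 _ h1.1 h1.2⟩
  have h1 := Set.ncard_lt_ncard hsub f'.finite_inversions
  rwa [hinj.ncard_image] at h1

/-- The number of integers `x ≥ i` with `f x ≤ j`. -/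
noncomputable def rank (f : AffinePerm k N) (i j : ℤ) : ℕ :=
  Set.ncard {x : ℤ | i ≤ x ∧ f.toPerm x ≤ j}

theorem finite_rank (f : AffinePerm k N) [NeZero N] (i j : ℤ) :
    {x : ℤ | i ≤ x ∧ f.toPerm x ≤ j}.Finite := by
  obtain ⟨M, hM⟩ := f.exists_bound
  refine (Set.finite_Icc i (j + M)).subset ?_
  rintro x ⟨h1, h2⟩
  have h5 := abs_le.1 (hM x)
  rw [Set.mem_Icc]
  omega

/-- Send a counted `x` to itself if `f' x ≤ j` and to `t x` otherwise. In the second case `f (t x) >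
j ≥ f x`; as `b - a` and `f b - f a` are both positive, `t` moved `x` to the right, so `t x ≥ i`,
and `f' (t x) = f x ≤ j`. -/
theorem rank_le_rank_of_transposition [NeZero N] {f f' : AffinePerm k N} {a b : ℤ}
    (hab : ¬ a ≡ b [ZMOD N]) (hf : ∀ x, f'.toPerm x = f.toPerm (transposition N a b x))
    (hlt : a < b) (hflt : f.toPerm a < f.toPerm b) (i j : ℤ) : f.rank i j ≤ f'.rank i j := by
  set t := transposition N a b with ht
  have htt : ∀ x, t (t x) = x := transposition_transposition hab
  refine Set.ncard_le_ncard_of_injOn (fun x => if f'.toPerm x ≤ j then x else t x) ?_ ?_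
    (f'.finite_rank i j)
  · rintro x ⟨h1, h2⟩
    split_ifs with h
    · exact ⟨h1, h⟩
    · have c := f.transposition_cases a b x
      rw [← ht] at c
      refine ⟨?_, ?_⟩
      · rw [hf] at h
        rcases c with c | c | c
        · omega
        · omega
        · rw [c] at h; omega
      · rw [hf, htt]; exact h2
  · rintro x ⟨h1, h2⟩ y ⟨h3, h4⟩ h
    dsimp only at h
    split_ifs at h with h5 h6 h6
    · exact h
    · rw [h, hf, htt] at h5
      rw [hf, ← h] at h6
      have c := f.transposition_cases a b y
      rw [← ht] at c
      rcases c with c | c | c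
      · omega
      · omega
      · exact h.trans c
    · rw [← h, hf, htt] at h6
      rw [hf, h] at h5
      have c := f.transposition_cases a b x
      rw [← ht] at c
      rcases c with c | c | c
      · omega
      · omega
      · exact (h.symm.trans c).symm
    · rw [← htt x, h, htt]

theorem rank_le_rank_of_bruhatStep [NeZero N] {f f' : AffinePerm k N} (h : BruhatStep f f')
    (i j : ℤ) : f.rank i j ≤ f'.rank i j := by
  obtain ⟨a, b, hab, hf, hlen⟩ := h
  wlog hlt : a < b generalizing a b
  · refine this b a (fun h => hab h.symm) (fun x => ?_) ?_
    · rw [hf, transposition_comm hab]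
    · have : a ≠ b := fun h => hab (h ▸ Int.ModEq.refl _)
      omega
  refine rank_le_rank_of_transposition hab hf hlt ?_ i j
  by_contra hge
  have hne : f.toPerm a ≠ f.toPerm b := fun h => hlt.ne (f.toPerm.injective h)
  -- With `f b < f a` the roles of `f` and `f'` are exchanged: the same reflection takes `f'` to `f`
  -- and makes it longer.
  have hlt' : f.length > f'.length := by
    refine length_lt_length (f := f') (f' := f) hab (fun x => ?_) hlt ?_
    · rw [hf, transposition_transposition hab]
    · rw [hf, hf]
      simp only [transposition, Int.ModEq.refl, if_true,
        if_neg (fun h : b ≡ a [ZMOD N] => hab h.symm), add_sub_cancel]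
      omega
  omega

theorem rank_le_rank_of_bruhatLE [NeZero N] {f f' : AffinePerm k N} (h : BruhatLE f f')
    (i j : ℤ) : f.rank i j ≤ f'.rank i j := by
  induction h with
  | refl => exact le_rfl
  | tail _ h ih => exact ih.trans (rank_le_rank_of_bruhatStep h i j)

end AffinePerm

/-! ### Lifts of matchings to the integers -/

/-- The lifts to `ℤ` of matchings on the cyclically ordered set `ℤ / N`. -/
structure IsMatchingLift (N : ℤ) (g : ℤ → ℤ) : Prop where
  lt_apply : ∀ x, x < g x
  apply_lt : ∀ x, g x < x + N
  apply_apply : ∀ x, g (g x) = x + N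

/-- The number of arcs `x < g x` inside the interval `[i, j]`. -/
noncomputable def arcCount (g : ℤ → ℤ) (i j : ℤ) : ℕ :=
  ((Finset.Icc i j).filter fun x => g x ≤ j).card

theorem arcCount_of_le {g : ℤ → ℤ} (hg : ∀ x, x < g x) {i j : ℤ} (h : j ≤ i) :
    arcCount g i j = 0 := by
  rw [arcCount, Finset.card_eq_zero, Finset.filter_eq_empty_iff]
  intro x hx
  rw [Finset.mem_Icc] at hx
  have := hg x
  omega

theorem arcCount_succ_left {g : ℤ → ℤ} (hg : ∀ x, x < g x) (i j : ℤ) :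
    arcCount g i j = arcCount g (i + 1) j + if g i ≤ j then 1 else 0 := by
  unfold arcCount
  have hi := hg i
  split_ifs with h
  · rw [← Finset.card_insert_of_notMem (a := i)]
    · congr 1
      ext x
      simp only [Finset.mem_filter, Finset.mem_Icc, Finset.mem_insert]
      have h2 : x = i → g x = g i := fun h => by rw [h]
      constructor
      · intro h1; omega
      · intro h1; omega
    · simp
  · rw [add_zero]
    congr 1
    ext x
    simp only [Finset.mem_filter, Finset.mem_Icc]
    have h2 : x = i → g x = g i := fun h => by rw [h]
    omega

/-- The number of `x ≥ i` with `v ≤ g x ≤ y`. -/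
noncomputable def bandCount (g : ℤ → ℤ) (i v y : ℤ) : ℕ :=
  ((Finset.Icc i y).filter fun x => v ≤ g x ∧ g x ≤ y).card

theorem arcCount_eq_add_bandCount {g : ℤ → ℤ} (hg : ∀ x, x < g x) (i : ℤ) {v y : ℤ}
    (h : v ≤ y + 1) : arcCount g i y = arcCount g i (v - 1) + bandCount g i v y := by
  unfold arcCount bandCount
  rw [← Finset.card_union_of_disjoint]
  · congr 1
    ext x
    simp only [Finset.mem_filter, Finset.mem_Icc, Finset.mem_union]
    have := hg x
    omega
  · rw [Finset.disjoint_left]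
    intro x
    simp only [Finset.mem_filter, Finset.mem_Icc]
    omega

namespace IsMatchingLift

variable {N : ℤ} {g : ℤ → ℤ}

theorem apply_add (hg : IsMatchingLift N g) (x : ℤ) : g (x + N) = g x + N := by
  rw [← hg.apply_apply x, hg.apply_apply (g x)]

theorem apply_sub (hg : IsMatchingLift N g) (x : ℤ) : g (x - N) = g x - N := by
  have h := hg.apply_add (x - N)
  rw [sub_add_cancel] at h
  omega

theorem injective (hg : IsMatchingLift N g) : Function.Injective g := by
  intro x y h
  have h1 := hg.apply_apply x
  rw [h, hg.apply_apply] at h1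
  omega

theorem eq_iff (hg : IsMatchingLift N g) (x y : ℤ) : g x = y ↔ x = g y - N := by
  constructor
  · rintro rfl
    rw [hg.apply_apply]
    ring
  · rintro rfl
    rw [hg.apply_sub, hg.apply_apply]
    ring

/-- The only arc that can be new is the one ending in `j + 1`, and it starts in `g (j + 1) - N`. -/
theorem arcCount_succ_right (hg : IsMatchingLift N g) (i j : ℤ) :
    arcCount g i (j + 1) = arcCount g i j + if i ≤ g (j + 1) - N then 1 else 0 := by
  rw [arcCount_eq_add_bandCount hg.lt_apply i (v := j + 1) (by omega), add_sub_cancel_right]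
  congr 1
  unfold bandCount
  have h1 : g (g (j + 1) - N) = j + 1 := (hg.eq_iff _ _).2 rfl
  have h2 := hg.apply_lt (j + 1)
  split_ifs with h
  · rw [Finset.card_eq_one]
    refine ⟨g (j + 1) - N, ?_⟩
    ext x
    have h3 := hg.eq_iff x (j + 1)
    simp only [Finset.mem_filter, Finset.mem_Icc, Finset.mem_singleton]
    omega
  · rw [Finset.card_eq_zero, Finset.filter_eq_empty_iff]
    intro x hx
    have h3 := hg.eq_iff x (j + 1)
    rw [Finset.mem_Icc] at hx
    omega

/-- When `i + m` passes from the right-hand interval to the left-hand one, either the left one gains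
the arc ending there, namely if `g (i + m) ≥ i + N`, or the right one loses the arc starting there,
namely if `g (i + m) < i + N`. Exactly one of these happens. -/
theorem arcCount_sub_aux (hg : IsMatchingLift N g) (i : ℤ) (m : ℕ) :
    (arcCount g i (i - 1 + m) : ℤ) + arcCount g i (i + N - 1) =
      m + arcCount g (i + m) (i + N - 1) := by
  induction m with
  | zero =>
    simp [arcCount_of_le hg.lt_apply (show i - 1 ≤ i by omega)]
  | succ m ih =>
    have h1 := hg.arcCount_succ_right i (i - 1 + m)
    have h2 := arcCount_succ_left hg.lt_apply (i + m) (i + N - 1)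
    rw [show i - 1 + (m : ℤ) + 1 = i + m by ring] at h1
    push_cast
    rw [show i - 1 + ((m : ℤ) + 1) = i + m by ring, ← add_assoc]
    split_ifs at h1 h2 <;> omega

theorem two_mul_arcCount_period (hg : IsMatchingLift N g) (hN : 0 ≤ N) (i : ℤ) :
    2 * (arcCount g i (i + N - 1) : ℤ) = N := by
  have h := hg.arcCount_sub_aux i N.toNat
  rw [Int.toNat_of_nonneg hN, arcCount_of_le hg.lt_apply (show i + N - 1 ≤ i + N by omega),
    show i - 1 + N = i + N - 1 by ring] at h
  push_cast at h
  omega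

/-- Complementary intervals contain the same number of arcs, up to a constant. -/
theorem arcCount_compl (hg : IsMatchingLift N g) (hN : 0 ≤ N) {i j : ℤ} (hij : i ≤ j + 1) :
    2 * (arcCount g i j : ℤ) + N = 2 * (j + 1 - i) + 2 * arcCount g (j + 1) (i + N - 1) := by
  have h := hg.arcCount_sub_aux i (j + 1 - i).toNat
  have h2 := hg.two_mul_arcCount_period hN i
  rw [Int.toNat_of_nonneg (by omega), show i - 1 + (j + 1 - i) = j by ring,
    show i + (j + 1 - i) = j + 1 by ring] at h
  omega

/-- For an interval at least a period long the complementary interval is too short to contain an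
arc. The count is therefore the same for all matchings, which settles long intervals and yields
contradictions to strict inequalities. -/
theorem arcCount_of_add_le (hg : IsMatchingLift N g) (hN : 0 ≤ N) {i j : ℤ}
    (hij : i + N ≤ j + 1) : 2 * (arcCount g i j : ℤ) + N = 2 * (j + 1 - i) := by
  rw [hg.arcCount_compl hN (by omega), arcCount_of_le hg.lt_apply (by omega)]
  simp

theorem arcCount_add (hg : IsMatchingLift N g) (hN : 0 ≤ N) (i j : ℤ) :
    arcCount g (i + N) (j + N) = arcCount g i j := by
  rcases le_or_gt i (j + 1) with h | h
  · rcases le_or_gt (i + N) (j + 1) with h' | h'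
    · have h1 := hg.arcCount_of_add_le hN h'
      have h2 := hg.arcCount_of_add_le hN (i := i + N) (j := j + N) (by omega)
      omega
    · have h1 := hg.arcCount_compl hN h
      have h2 := hg.arcCount_compl hN (i := j + 1) (j := i + N - 1) (by omega)
      rw [show i + N - 1 + 1 = i + N by ring, show j + 1 + N - 1 = j + N by ring] at h2
      omega
  · rw [arcCount_of_le hg.lt_apply (by omega), arcCount_of_le hg.lt_apply (by omega)]

/-- If every interval contains at least as many arcs of `g'` as of `g`, then there are two arcs
of `g` such that all intervals that could get a new arc by uncrossing these two arcs
contain strictly more arcs of `g'`. -/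
theorem exists_uncrossing {g' : ℤ → ℤ} (hN : 0 ≤ N) (hg : IsMatchingLift N g)
    (hg' : IsMatchingLift N g') (hle : ∀ i j, arcCount g i j ≤ arcCount g' i j) (hne : g ≠ g') :
    ∃ x₁ x₂, x₁ < x₂ ∧ g x₁ < g x₂ ∧
      (∀ x, x₁ < x → x < x₂ → ¬ (g x₁ ≤ g x ∧ g x ≤ g x₂)) ∧
      ∀ i j, x₁ < i → i ≤ x₂ → g x₁ ≤ j → j < g x₂ → arcCount g i j < arcCount g' i j := by
  have hlt := hg.lt_apply
  have hlt' := hg'.lt_apply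
  have hex : ∃ m : ℕ, ∃ i j : ℤ, (j - i).toNat = m ∧ arcCount g i j < arcCount g' i j := by
    by_contra hcon
    push Not at hcon
    have heq : ∀ i j, arcCount g i j = arcCount g' i j := fun i j =>
      le_antisymm (hle i j) (hcon _ i j rfl)
    refine hne (funext fun x => ?_)
    have h1 := arcCount_succ_left hlt x (g x)
    have h2 := arcCount_succ_left hlt' x (g x)
    have h3 := arcCount_succ_left hlt x (g' x)
    have h4 := arcCount_succ_left hlt' x (g' x)
    have e1 := heq x (g x)
    have e2 := heq (x + 1) (g x)
    have e3 := heq x (g' x)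
    have e4 := heq (x + 1) (g' x)
    simp only [le_refl, if_true] at h1 h4
    split_ifs at h2 h3 <;> omega
  classical
  -- `[x₂, v]` is a shortest interval with strictly more arcs of `g'` than of `g`; the counts agree
  -- on all shorter intervals.
  obtain ⟨x₂, v, hm, hpos⟩ := Nat.find_spec hex
  have hmin : ∀ i j, (j - i).toNat < (v - x₂).toNat → arcCount g i j = arcCount g' i j := by
    intro i j hij
    refine le_antisymm (hle i j) ?_
    by_contra hcon
    rw [hm] at hij
    exact Nat.find_min hex hij ⟨i, j, rfl, by omega⟩
  have hxv : x₂ < v := by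
    by_contra hcon
    rw [arcCount_of_le hlt' (by omega)] at hpos
    omega
  have e1 := hmin (x₂ + 1) v (by omega)
  have e2 : arcCount g x₂ (v - 1) = arcCount g' x₂ (v - 1) := hmin _ _ (by omega)
  have e3 : arcCount g (x₂ + 1) (v - 1) = arcCount g' (x₂ + 1) (v - 1) := by
    rcases eq_or_ne (x₂ + 1) v with h | h
    · rw [arcCount_of_le hlt (by omega), arcCount_of_le hlt' (by omega)]
    · exact hmin _ _ (by omega)
  -- The surplus disappears as soon as either end of the interval is dropped, so it is the single
  -- arc of `g'` from `x₂` to `v`, while the arc of `g` at `x₂` leaves the interval.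
  have hv : g' x₂ = v ∧ v < g x₂ := by
    have h1 := arcCount_succ_left hlt x₂ v
    have h2 := arcCount_succ_left hlt' x₂ v
    have h3 := arcCount_succ_left hlt x₂ (v - 1)
    have h4 := arcCount_succ_left hlt' x₂ (v - 1)
    split_ifs at h1 h2 h3 h4 <;> omega
  -- The surplus spreads to larger intervals `[i, y]`. Sort arcs by whether they end before `v`.
  -- Those ending in `[v, y]` and starting after `x₂` are at least as many for `g'`, because the
  -- counts agree on `[x₂ + 1, v - 1]`. Starting the band at `i` instead adds the arc at `x₂` for
  -- `g'`, but nothing for `g`.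
  have key : ∀ i y, i ≤ x₂ → v ≤ y → y < g x₂ →
      (∀ x, i ≤ x → x < x₂ → ¬ (v ≤ g x ∧ g x ≤ y)) → arcCount g i y < arcCount g' i y := by
    intro i y hi hvy hy hno
    have h1 := arcCount_eq_add_bandCount hlt i (v := v) (y := y) (by omega)
    have h2 := arcCount_eq_add_bandCount hlt' i (v := v) (y := y) (by omega)
    have h3 := arcCount_eq_add_bandCount hlt (x₂ + 1) (v := v) (y := y) (by omega)
    have h4 := arcCount_eq_add_bandCount hlt' (x₂ + 1) (v := v) (y := y) (by omega)
    have h5 : bandCount g i v y = bandCount g (x₂ + 1) v y := by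
      unfold bandCount
      congr 1
      ext x
      simp only [Finset.mem_filter, Finset.mem_Icc]
      have h6 := hno x
      have h7 : x = x₂ → g x = g x₂ := fun h => by rw [h]
      constructor
      · intro h8
        by_cases h9 : x < x₂
        · exact absurd h8.2 (h6 h8.1.1 h9)
        · omega
      · intro h8
        omega
    have h6 : bandCount g' (x₂ + 1) v y + 1 ≤ bandCount g' i v y := by
      unfold bandCount
      rw [← Finset.card_insert_of_notMem (a := x₂)]
      · refine Finset.card_le_card fun x => ?_
        simp only [Finset.mem_insert, Finset.mem_filter, Finset.mem_Icc]
        have h7 : x = x₂ → g' x = g' x₂ := fun h => by rw [h]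
        omega
      · simp
    have h7 := hle i (v - 1)
    have h8 := hle (x₂ + 1) y
    omega
  -- Otherwise `key` gives a strict inequality on `[v - N + 1, v]`, a full period, where all
  -- matchings have equally many arcs.
  have hcand : ∃ x, v - N + 1 ≤ x ∧ x < x₂ ∧ v ≤ g x ∧ g x < g x₂ := by
    by_contra hcon
    push Not at hcon
    have h0 := hg'.apply_lt x₂
    have h1 := key (v - N + 1) v (by omega) le_rfl hv.2 fun x hx hx2 h => by
      have := hcon x hx hx2 h.1
      omega
    have h2 := hg.arcCount_of_add_le hN (i := v - N + 1) (j := v) (by omega)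
    have h3 := hg'.arcCount_of_add_le hN (i := v - N + 1) (j := v) (by omega)
    omega
  -- Taking `x₁` as far right as possible excludes arcs that start between `x₁` and `x₂` and end
  -- between `g x₁` and `g x₂`, and makes `key` applicable to every left end in `(x₁, x₂]`.
  obtain ⟨x₁, ⟨h1, h2, h3⟩, hmax⟩ := Int.exists_greatest_of_bdd
    (P := fun x => x < x₂ ∧ v ≤ g x ∧ g x < g x₂) ⟨x₂, fun z hz => hz.1.le⟩
    (by obtain ⟨x, _, h⟩ := hcand; exact ⟨x, h⟩)
  refine ⟨x₁, x₂, h1, h3, ?_, ?_⟩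
  · rintro x hx hx2 ⟨h4, h5⟩
    have h6 : g x ≠ g x₂ := fun h => hx2.ne (hg.injective h)
    have := hmax x ⟨hx2, by omega, by omega⟩
    omega
  · intro i j hi hi2 hj hj2
    refine key i j hi2 (by omega) hj2 fun x hx hx2 h => ?_
    have := hmax x ⟨hx2, h.1, by omega⟩
    omega

end IsMatchingLift

/-! ### The effect of uncrossing two arcs on the arc counts -/

/-- The matching with lift `h` is obtained from the one with lift `g` by uncrossing the arcs
`x₁ < y₁` and `x₂ < y₂` of `g`. -/
structure IsUncrossing (N : ℤ) (g h : ℤ → ℤ) (x₁ x₂ y₁ y₂ : ℤ) : Prop where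
  lt₁ : x₁ < x₂
  lt₂ : x₂ < y₁
  lt₃ : y₁ < y₂
  lt₄ : y₂ < x₁ + N
  left₁ : g x₁ = y₁
  left₂ : g x₂ = y₂
  right₁ : h x₁ = y₂
  right₂ : h x₂ = y₁
  eq_of_ne : ∀ x, ¬ x ≡ x₁ [ZMOD N] → ¬ x ≡ x₂ [ZMOD N] → ¬ x ≡ y₁ [ZMOD N] →
    ¬ x ≡ y₂ [ZMOD N] → h x = g x

theorem Int.ModEq.eq_of_mem_Ico {N i x y : ℤ} (h : x ≡ y [ZMOD N]) (hx : i ≤ x)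
    (hx' : x < i + N) (hy : i ≤ y) (hy' : y < i + N) : x = y := by
  have h1 := Int.eq_zero_of_abs_lt_dvd h.dvd (abs_lt.2 ⟨by omega, by omega⟩)
  omega

namespace IsUncrossing

variable {N : ℤ} {g h : ℤ → ℤ} {x₁ x₂ y₁ y₂ : ℤ}

/-- The same two chords, read from their other ends. This halves the number of positions of an
interval relative to the four ends. -/
theorem symm (hu : IsUncrossing N g h x₁ x₂ y₁ y₂) (hg : IsMatchingLift N g)
    (hh : IsMatchingLift N h) : IsUncrossing N g h y₁ y₂ (x₁ + N) (x₂ + N) where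
  lt₁ := hu.lt₃
  lt₂ := hu.lt₄
  lt₃ := by have := hu.lt₁; omega
  lt₄ := by have := hu.lt₂; omega
  left₁ := by rw [← hu.left₁, hg.apply_apply]
  left₂ := by rw [← hu.left₂, hg.apply_apply]
  right₁ := by rw [← hu.right₂, hh.apply_apply]
  right₂ := by rw [← hu.right₁, hh.apply_apply]
  eq_of_ne x h1 h2 h3 h4 := by
    refine hu.eq_of_ne x ?_ ?_ h1 h2
    · simpa [Int.ModEq] using h3
    · simpa [Int.ModEq] using h4

theorem add (hu : IsUncrossing N g h x₁ x₂ y₁ y₂) (hg : IsMatchingLift N g)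
    (hh : IsMatchingLift N h) :
    IsUncrossing N g h (x₁ + N) (x₂ + N) (y₁ + N) (y₂ + N) :=
  (hu.symm hg hh).symm hg hh

theorem eq_of_mem_Ico (hu : IsUncrossing N g h x₁ x₂ y₁ y₂) {i x : ℤ} (hx : i ≤ x)
    (hx' : x < i + N) (h1 : i ≤ x₁) (h2 : y₂ < i + N) :
    x = x₁ ∨ x = x₂ ∨ x = y₁ ∨ x = y₂ ∨ h x = g x := by
  have l1 := hu.lt₁
  have l2 := hu.lt₂
  have l3 := hu.lt₃
  by_cases m1 : x ≡ x₁ [ZMOD N]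
  · exact Or.inl (m1.eq_of_mem_Ico hx hx' h1 (by omega))
  by_cases m2 : x ≡ x₂ [ZMOD N]
  · exact Or.inr (Or.inl (m2.eq_of_mem_Ico hx hx' (by omega) (by omega)))
  by_cases m3 : x ≡ y₁ [ZMOD N]
  · exact Or.inr (Or.inr (Or.inl (m3.eq_of_mem_Ico hx hx' (by omega) (by omega))))
  by_cases m4 : x ≡ y₂ [ZMOD N]
  · exact Or.inr (Or.inr (Or.inr (Or.inl (m4.eq_of_mem_Ico hx hx' (by omega) (by omega)))))
  exact Or.inr (Or.inr (Or.inr (Or.inr (hu.eq_of_ne x m1 m2 m3 m4))))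

/-- If the window starting at `i` sees the four ends in the order `x₁, x₂, y₁, y₂`, match arcs by
right ends: the new arc `x₁ < y₂` goes to the old `x₂ < y₂`, and `x₂ < y₁` to `x₁ < y₁`. Nothing is
gained. -/
theorem arcCount_le_of_le (hu : IsUncrossing N g h x₁ x₂ y₁ y₂) (hg : IsMatchingLift N g)
    (hh : IsMatchingLift N h) {i j : ℤ} (hj : j < i + N) (h1 : i ≤ x₁) (h2 : y₂ < i + N) :
    arcCount h i j ≤ arcCount g i j := by
  have l1 := hu.lt₁
  have l2 := hu.lt₂
  have l3 := hu.lt₃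
  have l4 := hu.lt₄
  have hs := hu.symm hg hh
  unfold arcCount
  refine Finset.card_le_card_of_injOn (Equiv.swap x₁ x₂) ?_ (Equiv.injective _).injOn
  intro x hx
  simp only [Finset.coe_filter, Finset.mem_Icc, Set.mem_ofPred_eq] at hx ⊢
  have hc := hu.eq_of_mem_Ico (i := i) (x := x) (by omega) (by omega) h1 h2
  rcases eq_or_ne x x₁ with rfl | n1
  · rw [Equiv.swap_apply_left, hu.left₂]
    rw [hu.right₁] at hx
    omega
  rcases eq_or_ne x x₂ with rfl | n2
  · rw [Equiv.swap_apply_right, hu.left₁]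
    rw [hu.right₂] at hx
    omega
  rw [Equiv.swap_apply_of_ne_of_ne n1 n2]
  rcases hc with hc | hc | hc | hc | hc
  · exact absurd hc n1
  · exact absurd hc n2
  · rw [hc, hs.right₁] at hx
    omega
  · rw [hc, hs.right₂] at hx
    omega
  · rw [← hc]
    exact hx

/-- Here the window sees the ends in the order `x₂, y₁, y₂, x₁ + N`. The new arc `y₂ < x₁ + N` is
matched with the old `y₁ < x₁ + N`, and `x₂ < y₁` with `x₂ < y₂`. The second match fails only if `j`
lies between `y₁` and `y₂`. -/
theorem arcCount_le_of_lt_of_le (hu : IsUncrossing N g h x₁ x₂ y₁ y₂) (hg : IsMatchingLift N g)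
    (hh : IsMatchingLift N h) {i j : ℤ} (hj : j < i + N) (h1 : x₁ < i) (h2 : i ≤ x₂) :
    arcCount h i j ≤ arcCount g i j + if y₁ ≤ j ∧ j < y₂ then 1 else 0 := by
  have l1 := hu.lt₁
  have l2 := hu.lt₂
  have l3 := hu.lt₃
  have l4 := hu.lt₄
  have hs := hu.symm hg hh
  have ha := hu.add hg hh
  have hc : ∀ x, i ≤ x → x < i + N →
      x = x₁ + N ∨ x = x₂ ∨ x = y₁ ∨ x = y₂ ∨ h x = g x := by
    intro x hx hx'
    by_cases m1 : x ≡ x₁ [ZMOD N]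
    · have m1' : x ≡ x₁ + N [ZMOD N] := by simpa [Int.ModEq] using m1
      exact Or.inl (m1'.eq_of_mem_Ico hx hx' (by omega) (by omega))
    by_cases m2 : x ≡ x₂ [ZMOD N]
    · exact Or.inr (Or.inl (m2.eq_of_mem_Ico hx hx' (by omega) (by omega)))
    by_cases m3 : x ≡ y₁ [ZMOD N]
    · exact Or.inr (Or.inr (Or.inl (m3.eq_of_mem_Ico hx hx' (by omega) (by omega))))
    by_cases m4 : x ≡ y₂ [ZMOD N]
    · exact Or.inr (Or.inr (Or.inr (Or.inl (m4.eq_of_mem_Ico hx hx' (by omega) (by omega)))))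
    exact Or.inr (Or.inr (Or.inr (Or.inr (hu.eq_of_ne x m1 m2 m3 m4))))
  have hmap : ∀ x, i ≤ x → x ≤ j → h x ≤ j → (x = x₂ → y₂ ≤ j) →
      i ≤ Equiv.swap y₁ y₂ x ∧ Equiv.swap y₁ y₂ x ≤ j ∧ g (Equiv.swap y₁ y₂ x) ≤ j := by
    intro x hx hxj hhx hx2
    rcases eq_or_ne x y₁ with rfl | n1
    · rw [hs.right₁] at hhx
      omega
    rcases eq_or_ne x y₂ with rfl | n2
    · rw [Equiv.swap_apply_right, hs.left₁]
      rw [hs.right₂] at hhx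
      omega
    rw [Equiv.swap_apply_of_ne_of_ne n1 n2]
    rcases hc x hx (by omega) with hc | hc | hc | hc | hc
    · rw [hc, ha.right₁] at hhx
      omega
    · refine ⟨hx, hxj, ?_⟩
      rw [hc, hu.left₂]
      exact hx2 hc
    · exact absurd hc n1
    · exact absurd hc n2
    · rw [← hc]
      exact ⟨hx, hxj, hhx⟩
  unfold arcCount
  by_cases hy : y₁ ≤ j ∧ j < y₂
  · rw [if_pos hy]
    refine le_trans (Finset.card_le_card_sdiff_add_card (t := {x₂})) ?_
    rw [Finset.card_singleton]
    refine Nat.add_le_add_right ?_ 1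
    refine Finset.card_le_card_of_injOn (Equiv.swap y₁ y₂) ?_ (Equiv.injective _).injOn
    intro x hx
    simp only [Finset.coe_sdiff, Finset.coe_filter, Finset.mem_Icc, Set.mem_ofPred_eq,
      Set.mem_sdiff, Finset.coe_singleton, Set.mem_singleton_iff] at hx ⊢
    have := hmap x hx.1.1.1 hx.1.1.2 hx.1.2 fun h => absurd h hx.2
    tauto
  · rw [if_neg hy, add_zero]
    refine Finset.card_le_card_of_injOn (Equiv.swap y₁ y₂) ?_ (Equiv.injective _).injOn
    intro x hx
    simp only [Finset.coe_filter, Finset.mem_Icc, Set.mem_ofPred_eq] at hx ⊢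
    have := hmap x hx.1.1 hx.1.2 hx.2 fun h => by
      rw [h, hu.right₂] at hx
      omega
    tauto

/-- Uncrossing two arcs keeps the arc counts below those of `g'`, if these are strictly larger
where an arc is gained. -/
theorem arcCount_le {g' : ℤ → ℤ} (hN : 0 < N) (hu : IsUncrossing N g h x₁ x₂ y₁ y₂)
    (hg : IsMatchingLift N g) (hh : IsMatchingLift N h) (hg' : IsMatchingLift N g')
    (hle : ∀ i j, arcCount g i j ≤ arcCount g' i j)
    (hlt : ∀ i j, x₁ < i → i ≤ x₂ → y₁ ≤ j → j < y₂ → arcCount g i j < arcCount g' i j)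
    (i j : ℤ) : arcCount h i j ≤ arcCount g' i j := by
  rcases le_or_gt j i with hji | hij
  · rw [arcCount_of_le hh.lt_apply hji]
    exact Nat.zero_le _
  rcases le_or_gt (i + N) (j + 1) with hbig | hsmall
  · have h1 := hh.arcCount_of_add_le hN.le hbig
    have h2 := hg'.arcCount_of_add_le hN.le hbig
    omega
  -- Descent by periods to `x₁ < i ≤ x₁ + N`, where `i` falls into one of the four gaps between
  -- consecutive ends.
  have reduce : ∀ r : ℕ, ∀ i j, x₁ < i → i ≤ x₁ + N * r → i < j → j + 1 < i + N →
      arcCount h i j ≤ arcCount g' i j := by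
    intro r
    induction r with
    | zero => intro i j h1 h2; push_cast at h2; omega
    | succ r ih =>
      intro i j h1 h2 hij hsmall
      have l1 := hu.lt₁
      have l2 := hu.lt₂
      have l3 := hu.lt₃
      have l4 := hu.lt₄
      have hs := hu.symm hg hh
      have ha := hu.add hg hh
      by_cases hi : x₁ + N < i
      · rw [← sub_add_cancel i N, ← sub_add_cancel j N, hh.arcCount_add hN.le,
          hg'.arcCount_add hN.le]
        refine ih _ _ (by omega) ?_ (by omega) (by omega)
        push_cast at h2
        linarith
      · rcases le_or_gt i x₂ with c1 | c1
        · have h3 := hu.arcCount_le_of_lt_of_le hg hh (i := i) (j := j) (by omega) h1 c1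
          have h4 := hle i j
          have h5 := hlt i j h1 c1
          split_ifs at h3 with hy
          · have := h5 hy.1 hy.2
            omega
          · omega
        rcases le_or_gt i y₁ with c2 | c2
        · exact (hs.arcCount_le_of_le hg hh (by omega) c2 (by omega)).trans (hle i j)
        rcases le_or_gt i y₂ with c3 | c3
        · have h3 := hs.arcCount_le_of_lt_of_le hg hh (i := i) (j := j) (by omega) c2 c3
          have h4 := hle i j
          split_ifs at h3 with hy
          · have h5 := hlt (j + 1 - N) (i - 1) (by omega) (by omega) (by omega) (by omega)
            have h6 := hg.arcCount_compl hN.le (i := j + 1 - N) (j := i - 1) (by omega)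
            have h7 := hg'.arcCount_compl hN.le (i := j + 1 - N) (j := i - 1) (by omega)
            rw [sub_add_cancel, show j + 1 - N + N - 1 = j by ring] at h6 h7
            omega
          · omega
        · exact (ha.arcCount_le_of_le hg hh (by omega) (by omega) (by omega)).trans (hle i j)
  have shift : ∀ r : ℕ, arcCount h (i + N * r) (j + N * r) = arcCount h i j ∧
      arcCount g' (i + N * r) (j + N * r) = arcCount g' i j := by
    intro r
    induction r with
    | zero => simp
    | succ r ih =>
      push_cast
      rw [show i + N * ((r : ℤ) + 1) = i + N * r + N by ring,
        show j + N * ((r : ℤ) + 1) = j + N * r + N by ring, hh.arcCount_add hN.le,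
        hg'.arcCount_add hN.le]
      exact ih
  obtain ⟨r, hr⟩ : ∃ r : ℕ, x₁ < i + N * r := by
    refine ⟨(x₁ - i + 1).toNat, ?_⟩
    have h1 := Int.self_le_toNat (x₁ - i + 1)
    have h2 : (0 : ℤ) ≤ (x₁ - i + 1).toNat := by positivity
    nlinarith
  obtain ⟨m, hm⟩ : ∃ m : ℕ, i + N * r ≤ x₁ + N * m := by
    refine ⟨(i + N * r - x₁).toNat, ?_⟩
    rw [Int.toNat_of_nonneg (by omega)]
    nlinarith
  rw [← (shift r).1, ← (shift r).2]
  exact reduce m _ _ hr hm (by omega) (by omega)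

end IsUncrossing

/-! ### Necklaces and arc counts -/

theorem residue_sub_eq {N : ℕ} [NeZero N] (a : Fin N) {y : ℤ} (h1 : (a : ℤ) + 1 ≤ y)
    (h2 : y < (a : ℤ) + 1 + N) :
    (((residue N y - a : Fin N) : ℕ) : ℤ) = y - ((a : ℤ) + 1) := by
  obtain ⟨d, hd⟩ : ∃ d : Fin N, ((d : ℕ) : ℤ) = y - ((a : ℤ) + 1) :=
    ⟨⟨(y - ((a : ℤ) + 1)).toNat, by omega⟩, by dsimp only; omega⟩
  have h3 : residue N y = d + a := by
    rw [residue_eq_iff]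
    refine ⟨((d : ℕ) + (a : ℕ) : ℤ) / N, ?_⟩
    rw [Fin.val_add]
    push_cast
    have := Int.emod_add_mul_ediv ((d : ℕ) + (a : ℕ) : ℤ) N
    linarith [mul_comm (((d : ℕ) + (a : ℕ) : ℤ) / N) (N : ℤ)]
  rw [h3, add_sub_cancel_right, hd]

namespace BoundedAffinePerm

variable {k N : ℕ} [NeZero N]

/-- Split the `c + 1` values in `[a + 1, a + 1 + c]` according to their preimages: those below `a +
1` give the initial elements of the necklace set, the others are what the rank counts. Boundedness
keeps the values counted on either side inside one window of length `N`, where residues are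
injective. -/
theorem card_filter_grassmannNecklace (f : BoundedAffinePerm k N) (a c : Fin N) :
    (((grassmannNecklace f a).image (· - a)).filter (· ≤ c)).card +
      f.rank ((a : ℤ) + 1) ((a : ℤ) + 1 + c) = c + 1 := by
  classical
  set I := Finset.Icc ((a : ℤ) + 1) ((a : ℤ) + 1 + c) with hI
  have hc := c.isLt
  have h1 : ((grassmannNecklace f a).image (· - a)).filter (· ≤ c) =
      (I.filter fun y => f.toPerm.symm y < (a : ℤ) + 1).image fun y => residue N y - a := by
    ext d
    simp only [grassmannNecklace, Finset.mem_filter, Finset.mem_image, Finset.mem_univ, true_and,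
      hI, Finset.mem_Icc]
    constructor
    · rintro ⟨⟨e, ⟨b, hb, hb', rfl⟩, rfl⟩, hd⟩
      have h := f.apply_le b
      have h3 := residue_sub_eq a hb' (by omega)
      rw [Fin.le_def] at hd
      exact ⟨f.toPerm b, ⟨⟨hb', by omega⟩, by simpa using hb⟩, rfl⟩
    · rintro ⟨y, ⟨⟨hy, hy'⟩, hb⟩, rfl⟩
      refine ⟨⟨residue N y, ⟨f.toPerm.symm y, hb, ?_, ?_⟩, rfl⟩, ?_⟩
      · simpa using hy
      · simp
      · have h3 := residue_sub_eq a hy (by omega)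
        rw [Fin.le_def]
        omega
  have h2 : f.rank ((a : ℤ) + 1) ((a : ℤ) + 1 + c) =
      (I.filter fun y => ¬ f.toPerm.symm y < (a : ℤ) + 1).card := by
    have h3 : {x : ℤ | (a : ℤ) + 1 ≤ x ∧ f.toPerm x ≤ (a : ℤ) + 1 + c} =
        f.toPerm.symm '' (I.filter fun y => ¬ f.toPerm.symm y < (a : ℤ) + 1) := by
      ext x
      simp only [Set.mem_ofPred_eq, Set.mem_image, Finset.coe_filter, hI, Finset.mem_Icc, not_lt]
      constructor
      · intro h
        have := f.le_apply x
        exact ⟨f.toPerm x, ⟨⟨by omega, h.2⟩, by simpa using h.1⟩, by simp⟩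
      · rintro ⟨y, ⟨⟨hy, hy'⟩, hb⟩, rfl⟩
        exact ⟨hb, by simpa using hy'⟩
    rw [AffinePerm.rank, h3, Set.ncard_image_of_injective _ (Equiv.injective _),
      Set.ncard_coe_finset]
  rw [h1, h2, Finset.card_image_of_injOn, Finset.card_filter_add_card_filter_not, hI,
    Int.card_Icc]
  · omega
  · intro x hx y hy hxy
    simp only [hI, Finset.coe_filter, Finset.mem_Icc, Set.mem_ofPred_eq] at hx hy
    have h3 := residue_sub_eq a hx.1.1 (by omega)
    have h4 := residue_sub_eq a hy.1.1 (by omega)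
    dsimp only at hxy
    rw [hxy] at h3
    omega

end BoundedAffinePerm

namespace Matching

variable {n : ℕ} [NeZero n]

theorem isMatchingLift (τ : Matching n) : IsMatchingLift ((2 * n : ℕ) : ℤ) τ.gFun where
  lt_apply x := by
    have := τ.jump_pos (residue (2 * n) x)
    unfold gFun
    omega
  apply_lt x := by
    have := τ.jump_lt (residue (2 * n) x)
    unfold gFun
    omega
  apply_apply := τ.gFun_gFun

theorem two_mul_pos : (0 : ℤ) < ((2 * n : ℕ) : ℤ) := by
  have := Nat.pos_of_ne_zero (NeZero.ne n)
  omega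

theorem fPerm_apply (τ : Matching n) (x : ℤ) : τ.fPerm.toPerm x = τ.gFun x - 1 := rfl

/-- The shift from `j` to `j + 1` is the shift in `f_τ = g_τ - 1`. -/
theorem rank_fPerm (τ : Matching n) (i j : ℤ) :
    τ.fPerm.rank i j = arcCount τ.gFun i (j + 1) := by
  rw [AffinePerm.rank, arcCount, ← Set.ncard_coe_finset]
  congr 1
  ext x
  have := τ.isMatchingLift.lt_apply x
  simp only [Set.mem_ofPred_eq, Finset.coe_filter, Finset.mem_Icc, fPerm_apply]
  omega

/-- Dominance compares how many elements lie below each threshold, and these numbers are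
complementary to arc counts; this reverses the inequality once more. The thresholds reach all
intervals up to translation by a period, except very short and very long ones, on which all
matchings agree. -/
theorem necklaceLE_iff (τ τ' : Matching n) :
    NecklaceLE (grassmannNecklace τ.fPerm) (grassmannNecklace τ'.fPerm) ↔
      ∀ i j, arcCount τ.gFun i j ≤ arcCount τ'.gFun i j := by
  have hN := two_mul_pos (n := n)
  have hcard : ∀ (τ : Matching n) (a c : Fin (2 * n)), _ := fun τ a c =>
    τ.fPerm.card_filter_grassmannNecklace a c
  simp only [rank_fPerm] at hcard
  constructor
  · intro h i j
    obtain ⟨q, hq⟩ := (residue_eq_iff (2 * n) i _).1 rfl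
    set a := residue (2 * n) i
    have hshift : ∀ τ : Matching n, arcCount τ.gFun i j =
        arcCount τ.gFun ((a : ℤ) + 1) (j - q * (2 * n : ℕ)) := by
      have hs : ∀ (τ : Matching n) (r : ℕ) (i j : ℤ),
          arcCount τ.gFun (i + r * (2 * n : ℕ)) (j + r * (2 * n : ℕ)) = arcCount τ.gFun i j := by
        intro τ r
        induction r with
        | zero => simp
        | succ r ih =>
          intro i j
          have := τ.isMatchingLift.arcCount_add hN.le (i + r * (2 * n : ℕ)) (j + r * (2 * n : ℕ))
          rw [← ih i j, ← this]
          congr 1 <;> (push_cast; ring)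
      intro τ
      rcases le_total 0 q with h0 | h0
      · have := hs τ q.toNat ((a : ℤ) + 1) (j - q * (2 * n : ℕ))
        rw [Int.toNat_of_nonneg h0] at this
        rw [← this, hq]
        congr 1
        ring
      · have := hs τ (-q).toNat i j
        rw [Int.toNat_of_nonneg (by omega)] at this
        rw [← this]
        congr 1
        · rw [hq]; ring
        · ring
    rw [hshift, hshift]
    set j' := j - q * (2 * n : ℕ)
    rcases le_or_gt j' ((a : ℤ) + 1) with h1 | h1
    · rw [arcCount_of_le τ.isMatchingLift.lt_apply h1]
      exact Nat.zero_le _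
    rcases le_or_gt ((a : ℤ) + 1 + (2 * n : ℕ)) (j' + 1) with h2 | h2
    · have e1 := τ.isMatchingLift.arcCount_of_add_le hN.le h2
      have e2 := τ'.isMatchingLift.arcCount_of_add_le hN.le h2
      omega
    obtain ⟨c, hc⟩ : ∃ c : Fin (2 * n), (a : ℤ) + 1 + (c : ℕ) + 1 = j' :=
      ⟨⟨(j' - (a : ℤ) - 2).toNat, by omega⟩, by dsimp only; omega⟩
    have h3 := ((dominanceLE_iff _ _).1 (h a)).2 c
    have h4 := hcard τ a c
    have h5 := hcard τ' a c
    rw [hc] at h4 h5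
    omega
  · intro h a
    rw [RotatedDominanceLE, dominanceLE_iff]
    constructor
    -- The largest threshold counts the whole set, and the corresponding interval exceeds a period,
    -- so the cardinalities agree.
    · obtain ⟨c, hc⟩ : ∃ c : Fin (2 * n), (c : ℕ) + 1 = 2 * n :=
        ⟨⟨2 * n - 1, by omega⟩, by dsimp only; omega⟩
      have h4 := hcard τ a c
      have h5 := hcard τ' a c
      have hall : ∀ s : Finset (Fin (2 * n)), s.filter (· ≤ c) = s := fun s =>
        Finset.filter_true_of_mem fun x _ => by
          rw [Fin.le_def]
          omega
      rw [hall] at h4 h5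
      have e1 := τ.isMatchingLift.arcCount_of_add_le hN.le
        (i := (a : ℤ) + 1) (j := (a : ℤ) + 1 + c + 1) (by omega)
      have e2 := τ'.isMatchingLift.arcCount_of_add_le hN.le
        (i := (a : ℤ) + 1) (j := (a : ℤ) + 1 + c + 1) (by omega)
      omega
    · intro c
      have h3 := h ((a : ℤ) + 1) ((a : ℤ) + 1 + c + 1)
      have h4 := hcard τ a c
      have h5 := hcard τ' a c
      omega

theorem necklaceLE_of_bruhatLE {τ τ' : Matching n}
    (h : AffinePerm.BruhatLE τ.fPerm.toAffinePerm τ'.fPerm.toAffinePerm) :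
    NecklaceLE (grassmannNecklace τ.fPerm) (grassmannNecklace τ'.fPerm) := by
  rw [necklaceLE_iff]
  intro i j
  have h1 := AffinePerm.rank_le_rank_of_bruhatLE h i (j - 1)
  rw [rank_fPerm, rank_fPerm, sub_add_cancel] at h1
  exact h1

end Matching

/-! ### Uncrossings in Bruhat order -/

theorem residue_add_one {N : ℕ} [NeZero N] (r : Fin N) : residue N ((r : ℤ) + 1) = r :=
  (residue_eq_iff _ _ _).2 ⟨0, by ring⟩

theorem residue_eq_residue_iff {N : ℕ} [NeZero N] (x y : ℤ) :
    residue N x = residue N y ↔ x ≡ y [ZMOD N] := by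
  obtain ⟨q, hq⟩ := (residue_eq_iff N y _).1 rfl
  rw [residue_eq_iff]
  constructor
  · rintro ⟨p, hp⟩
    refine (Int.modEq_iff_dvd.2 ⟨p - q, ?_⟩).symm
    linear_combination hp - hq
  · intro h
    obtain ⟨r, hr⟩ := h.symm.dvd
    exact ⟨r + q, by linear_combination hr + hq⟩

theorem residue_sub_residue {N : ℕ} [NeZero N] {x y : ℤ} (h1 : x ≤ y) (h2 : y < x + N) :
    (((residue N y : ℕ) : ℤ) - (residue N x : ℕ) = y - x ∧
      ((residue N x : ℕ) : ℤ) ≤ (residue N y : ℕ)) ∨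
    (((residue N y : ℕ) : ℤ) - (residue N x : ℕ) = y - x - N ∧
      ((residue N y : ℕ) : ℤ) < (residue N x : ℕ)) := by
  obtain ⟨p, hp⟩ := (residue_eq_iff N x _).1 rfl
  obtain ⟨q, hq⟩ := (residue_eq_iff N y _).1 rfl
  have hx := (residue N x).isLt
  have hy := (residue N y).isLt
  have h3 : y - x = (residue N y : ℕ) - (residue N x : ℕ) + (q - p) * N := by
    linear_combination hq - hp
  have h4 : (q - p) * (N : ℤ) < 2 * N := by omega
  have h5 : (-1) * (N : ℤ) < (q - p) * N := by omega
  have h6 := lt_of_mul_lt_mul_right h4 (by omega)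
  have h7 := lt_of_mul_lt_mul_right h5 (by omega)
  have h8 : q - p = 0 ∨ q - p = 1 := by omega
  rcases h8 with h8 | h8 <;> rw [h8] at h3 <;> omega

namespace AffinePerm

variable {k N : ℕ}

/-- The product of an affine permutation with a reflection. -/
def mulTransposition [NeZero N] (f : AffinePerm k N) {a b : ℤ} (hab : ¬ a ≡ b [ZMOD N]) :
    AffinePerm k N where
  toPerm := (Function.Involutive.toPerm _ (transposition_transposition hab)).trans f.toPerm
  periodic i := by
    change f.toPerm (transposition N a b (i + N)) = f.toPerm (transposition N a b i) + N
    have h := transposition_add_mul (N := N) a b i 1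
    rw [mul_one] at h
    rw [h, f.periodic]
  sum_eq := by
    change ∑ i ∈ Finset.Icc (1 : ℤ) N, (f.toPerm (transposition N a b i) - i) = _
    rw [← f.sum_eq, ← sub_eq_zero, ← Finset.sum_sub_distrib,
      Matching.sum_Icc_eq N fun i => f.toPerm (transposition N a b i) - i - (f.toPerm i - i)]
    have hne : residue N a ≠ residue N b := fun h => hab ((residue_eq_residue_iff _ _).1 h)
    -- The displacement changes by `f b - f a` at the residue of `a` and by the opposite amount at
    -- that of `b`, so its sum over a period is unchanged.
    have h : ∀ r : Fin N, f.toPerm (transposition N a b ((r : ℤ) + 1)) - ((r : ℤ) + 1) -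
        (f.toPerm ((r : ℤ) + 1) - ((r : ℤ) + 1)) =
        (if r = residue N a then f.toPerm b - f.toPerm a else 0) -
        (if r = residue N b then f.toPerm b - f.toPerm a else 0) := by
      intro r
      have ha : r = residue N a ↔ (r : ℤ) + 1 ≡ a [ZMOD N] := by
        rw [← residue_eq_residue_iff, residue_add_one]
      have hb : r = residue N b ↔ (r : ℤ) + 1 ≡ b [ZMOD N] := by
        rw [← residue_eq_residue_iff, residue_add_one]
      unfold transposition
      by_cases h1 : r = residue N a
      · have h2 : r ≠ residue N b := fun h => hne (h1.symm.trans h)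
        rw [if_pos (ha.1 h1), if_pos h1, if_neg h2]
        have h3 := f.apply_add_of_modEq (ha.1 h1) (b - a)
        rw [add_sub_cancel] at h3
        linarith
      · rw [if_neg (mt ha.2 h1), if_neg h1]
        by_cases h2 : r = residue N b
        · rw [if_pos (hb.1 h2), if_pos h2]
          have h3 := f.apply_add_of_modEq (hb.1 h2) (a - b)
          rw [add_sub_cancel] at h3
          linarith
        · rw [if_neg (mt hb.2 h2), if_neg h2]
          ring
    simp only [h, Finset.sum_sub_distrib, Finset.sum_ite_eq', Finset.mem_univ, if_true, sub_self]

theorem mulTransposition_apply [NeZero N] (f : AffinePerm k N) {a b : ℤ}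
    (hab : ¬ a ≡ b [ZMOD N]) (x : ℤ) :
    (f.mulTransposition hab).toPerm x = f.toPerm (transposition N a b x) := rfl

end AffinePerm

namespace IsMatchingLift

theorem apply_add_mul {N : ℤ} {g : ℤ → ℤ} (hg : IsMatchingLift N g) (x r : ℤ) :
    g (x + N * r) = g x + N * r := by
  induction r using Int.induction_on with
  | zero => simp
  | succ r ih =>
    rw [show x + N * ((r : ℤ) + 1) = x + N * r + N by ring, hg.apply_add, ih]
    ring
  | pred r ih =>
    rw [show x + N * (-(r : ℤ) - 1) = x + N * (-r) - N by ring, hg.apply_sub, ih]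
    ring

end IsMatchingLift

namespace Matching

variable {n : ℕ} [NeZero n]

/-- Exchanging the values at `x₁, x₂` turns the two arcs into the uncrossed ones, and exchanging
those at `y₁, y₂` does the same for the arcs that lead on to `x₁ + 2n` and `x₂ + 2n`. The values
exchanged are increasing in both cases, the first reflection not affecting those at `y₁, y₂`. -/
theorem bruhatLE_of_isUncrossing {τ τ' : Matching n} {x₁ x₂ y₁ y₂ : ℤ}
    (hu : IsUncrossing ((2 * n : ℕ) : ℤ) τ.gFun τ'.gFun x₁ x₂ y₁ y₂) :
    AffinePerm.BruhatLE τ.fPerm.toAffinePerm τ'.fPerm.toAffinePerm := by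
  have hg := τ.isMatchingLift
  have hh := τ'.isMatchingLift
  have l1 := hu.lt₁
  have l2 := hu.lt₂
  have l3 := hu.lt₃
  have l4 := hu.lt₄
  have hs := hu.symm hg hh
  have hne : ∀ x y : ℤ, x₁ ≤ x → x < x₁ + (2 * n : ℕ) → x₁ ≤ y → y < x₁ + (2 * n : ℕ) → x ≠ y →
      ¬ x ≡ y [ZMOD (2 * n : ℕ)] := fun x y h1 h2 h3 h4 h5 h6 =>
    h5 (h6.eq_of_mem_Ico h1 h2 h3 h4)
  have hx := hne x₁ x₂ (by omega) (by omega) (by omega) (by omega) (by omega)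
  have hy := hne y₁ y₂ (by omega) (by omega) (by omega) (by omega) (by omega)
  have hx1y1 := hne x₁ y₁ (by omega) (by omega) (by omega) (by omega) (by omega)
  have hx1y2 := hne x₁ y₂ (by omega) (by omega) (by omega) (by omega) (by omega)
  have hx2y1 := hne x₂ y₁ (by omega) (by omega) (by omega) (by omega) (by omega)
  have hx2y2 := hne x₂ y₂ (by omega) (by omega) (by omega) (by omega) (by omega)
  set f := τ.fPerm.toAffinePerm
  set f₁ := f.mulTransposition hx with hf₁
  have hcongr : ∀ {x c : ℤ} (d : ℤ), x ≡ c [ZMOD (2 * n : ℕ)] →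
      (x ≡ d [ZMOD (2 * n : ℕ)] ↔ c ≡ d [ZMOD (2 * n : ℕ)]) := fun d h =>
    ⟨fun h' => h.symm.trans h', fun h' => h.trans h'⟩
  have hval : ∀ {x c : ℤ}, x ≡ c [ZMOD (2 * n : ℕ)] → ∀ g : ℤ → ℤ,
      IsMatchingLift ((2 * n : ℕ) : ℤ) g → ∀ d, g (x + d) = g (c + d) + (x - c) := by
    intro x c h g hg d
    obtain ⟨r, hr⟩ := h.symm.dvd
    obtain rfl : x = c + (2 * n : ℕ) * r := by linarith
    rw [show c + (2 * n : ℕ) * r + d = c + d + (2 * n : ℕ) * r by ring, hg.apply_add_mul]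
    ring
  have step₁ : AffinePerm.BruhatStep f f₁ := by
    refine ⟨x₁, x₂, hx, fun x => rfl, ?_⟩
    refine AffinePerm.length_lt_length hx (fun x => rfl) l1 ?_
    change τ.gFun x₁ - 1 < τ.gFun x₂ - 1
    rw [hu.left₁, hu.left₂]
    omega
  have step₂ : AffinePerm.BruhatStep f₁ τ'.fPerm.toAffinePerm := by
    have happ : ∀ x, τ'.fPerm.toAffinePerm.toPerm x =
        f₁.toPerm (AffinePerm.transposition (2 * n) y₁ y₂ x) := by
      intro x
      rw [hf₁, AffinePerm.mulTransposition_apply]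
      change τ'.gFun x - 1 = τ.gFun _ - 1
      congr 1
      unfold AffinePerm.transposition
      by_cases m1 : x ≡ x₁ [ZMOD (2 * n : ℕ)]
      · have e1 := hval m1 _ hh 0
        have e2 := hval m1 _ hg (x₂ - x₁)
        rw [if_neg (mt (hcongr _ m1).1 hx1y1), if_neg (mt (hcongr _ m1).1 hx1y2), if_pos m1, e2]
        rw [add_zero, add_zero] at e1
        rw [e1, hu.right₁, add_sub_cancel, hu.left₂]
      by_cases m2 : x ≡ x₂ [ZMOD (2 * n : ℕ)]
      · have e1 := hval m2 _ hh 0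
        have e2 := hval m2 _ hg (x₁ - x₂)
        rw [if_neg (mt (hcongr _ m2).1 hx2y1), if_neg (mt (hcongr _ m2).1 hx2y2), if_neg m1,
          if_pos m2, e2]
        rw [add_zero, add_zero] at e1
        rw [e1, hu.right₂, add_sub_cancel, hu.left₁]
      by_cases m3 : x ≡ y₁ [ZMOD (2 * n : ℕ)]
      · have m3' : x + (y₂ - y₁) ≡ y₂ [ZMOD (2 * n : ℕ)] := by
          simpa using m3.add_right (y₂ - y₁)
        have e1 := hval m3 _ hh 0
        have e2 := hval m3 _ hg (y₂ - y₁)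
        rw [if_pos m3, if_neg (fun h => hx1y2 (h.symm.trans m3')),
          if_neg (fun h => hx2y2 (h.symm.trans m3')), e2]
        rw [add_zero, add_zero] at e1
        rw [e1, hs.right₁, add_sub_cancel, hs.left₂]
      by_cases m4 : x ≡ y₂ [ZMOD (2 * n : ℕ)]
      · have m4' : x + (y₁ - y₂) ≡ y₁ [ZMOD (2 * n : ℕ)] := by
          simpa using m4.add_right (y₁ - y₂)
        have e1 := hval m4 _ hh 0
        have e2 := hval m4 _ hg (y₁ - y₂)
        rw [if_neg m3, if_pos m4, if_neg (fun h => hx1y1 (h.symm.trans m4')),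
          if_neg (fun h => hx2y1 (h.symm.trans m4')), e2]
        rw [add_zero, add_zero] at e1
        rw [e1, hs.right₂, add_sub_cancel, hs.left₁]
      rw [if_neg m3, if_neg m4, if_neg m1, if_neg m2]
      exact hu.eq_of_ne x m1 m2 m3 m4
    refine ⟨y₁, y₂, hy, happ, ?_⟩
    refine AffinePerm.length_lt_length hy happ l3 ?_
    rw [hf₁, AffinePerm.mulTransposition_apply, AffinePerm.mulTransposition_apply]
    unfold AffinePerm.transposition
    rw [if_neg fun h => hx1y1 h.symm, if_neg fun h => hx2y1 h.symm, if_neg fun h => hx1y2 h.symm,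
      if_neg fun h => hx2y2 h.symm]
    change τ.gFun y₁ - 1 < τ.gFun y₂ - 1
    rw [hs.left₁, hs.left₂]
    omega
  exact (Relation.ReflTransGen.single step₁).tail step₂

theorem gFun_eq (τ : Matching n) {x y : ℤ} (h1 : x < y) (h2 : y < x + (2 * n : ℕ))
    (h : residue (2 * n) y = τ.partner (residue (2 * n) x)) : τ.gFun x = y := by
  rw [← residue_gFun, residue_eq_residue_iff] at h
  have h3 := τ.isMatchingLift.lt_apply x
  have h4 := τ.isMatchingLift.apply_lt x
  exact (h.eq_of_mem_Ico h1.le h2 h3.le h4).symm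

end Matching

/-! ### Crossing chords and smoothings of matchings -/

/-- The chords `{a, b}` and `{c, d}` of a circle with points labelled in order cross. -/
def Crosses (a b c d : ℕ) : Prop :=
  (a < c ∧ c < b ∧ (d < a ∨ b < d)) ∨ (b < c ∧ c < a ∧ (d < b ∨ a < d)) ∨
    (a < d ∧ d < b ∧ (c < a ∨ b < c)) ∨ (b < d ∧ d < a ∧ (c < b ∨ a < c))

instance (a b c d : ℕ) : Decidable (Crosses a b c d) := by
  unfold Crosses
  infer_instance

/-- Crossing is invariant under rotation. -/
theorem Crosses.rotate {m s a b c d a' b' c' d' : ℕ} (h : Crosses a b c d)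
    (ha' : a' < m) (hb' : b' < m) (hc' : c' < m) (hd' : d' < m)
    (ha : a' + s = a ∨ a' + s = a + m) (hb : b' + s = b ∨ b' + s = b + m)
    (hc : c' + s = c ∨ c' + s = c + m) (hd : d' + s = d ∨ d' + s = d + m)
    (ham : a < m) (hbm : b < m) (hcm : c < m) (hdm : d < m) : Crosses a' b' c' d' := by
  unfold Crosses at h ⊢
  rcases h with ⟨h1, h2, h3 | h3⟩ | ⟨h1, h2, h3 | h3⟩ | ⟨h1, h2, h3 | h3⟩ | ⟨h1, h2, h3 | h3⟩ <;>
    rcases ha with ha | ha <;> rcases hb with hb | hb <;> rcases hc with hc | hc <;>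
    rcases hd with hd | hd <;> omega

/-- `τ'` is obtained from `τ` by replacing the crossing chords `{A, D}` and `{B, C}` by
`{A, C}` and `{B, D}`. -/
structure IsSmoothing {n : ℕ} (τ τ' : Matching n) (A B C D : Fin (2 * n)) : Prop where
  left₁ : τ.partner A = D
  left₂ : τ.partner B = C
  right₁ : τ'.partner A = C
  right₂ : τ'.partner B = D
  eq_of_ne : ∀ x, x ≠ A → x ≠ B → x ≠ C → x ≠ D → τ'.partner x = τ.partner x
  crosses : Crosses A D B C

namespace IsSmoothing

variable {n : ℕ} {τ τ' : Matching n} {A B C D : Fin (2 * n)}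

theorem symm (h : IsSmoothing τ τ' A B C D) : IsSmoothing τ τ' B A D C where
  left₁ := h.left₂
  left₂ := h.left₁
  right₁ := h.right₂
  right₂ := h.right₁
  eq_of_ne x h1 h2 h3 h4 := h.eq_of_ne x h2 h1 h4 h3
  crosses := by
    have := h.crosses
    unfold Crosses at this ⊢
    omega

/-- Interlacing leaves eight linear orders of the four ends. Up to exchanging the two chords, the
cyclic order is always `A, B, D, C`, and the points that come after the cut are lifted one period
higher. -/
theorem exists_isUncrossing [NeZero n] (h : IsSmoothing τ τ' A B C D) :
    ∃ x₁ x₂ y₁ y₂ : ℤ, IsUncrossing ((2 * n : ℕ) : ℤ) τ.gFun τ'.gFun x₁ x₂ y₁ y₂ := by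
  have key : ∀ {A B C D : Fin (2 * n)}, IsSmoothing τ τ' A B C D → ∀ x₁ x₂ y₁ y₂ : ℤ,
      residue (2 * n) x₁ = A → residue (2 * n) x₂ = B → residue (2 * n) y₁ = D →
      residue (2 * n) y₂ = C → x₁ < x₂ → x₂ < y₁ → y₁ < y₂ → y₂ < x₁ + (2 * n : ℕ) →
      IsUncrossing ((2 * n : ℕ) : ℤ) τ.gFun τ'.gFun x₁ x₂ y₁ y₂ := by
    intro A B C D h x₁ x₂ y₁ y₂ hA hB hD hC l1 l2 l3 l4
    refine ⟨l1, l2, l3, l4, ?_, ?_, ?_, ?_, ?_⟩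
    · exact τ.gFun_eq (by omega) (by omega) (by rw [hD, hA, h.left₁])
    · exact τ.gFun_eq (by omega) (by omega) (by rw [hB, hC, h.left₂])
    · exact τ'.gFun_eq (by omega) (by omega) (by rw [hC, hA, h.right₁])
    · exact τ'.gFun_eq (by omega) (by omega) (by rw [hD, hB, h.right₂])
    · intro x m1 m2 m3 m4
      rw [← residue_eq_residue_iff] at m1 m2 m3 m4
      have h1 := τ.isMatchingLift.lt_apply x
      have h2 := τ.isMatchingLift.apply_lt x
      refine τ'.gFun_eq h1 h2 ?_
      rw [Matching.residue_gFun, h.eq_of_ne]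
      · rwa [hA] at m1
      · rwa [hB] at m2
      · rwa [hC] at m4
      · rwa [hD] at m3
  have hres : ∀ r : Fin (2 * n), residue (2 * n) ((r : ℤ) + 1) = r := residue_add_one
  have hres' : ∀ r : Fin (2 * n), residue (2 * n) ((r : ℤ) + 1 + (2 * n : ℕ)) = r := fun r =>
    (residue_eq_iff _ _ _).2 ⟨1, by ring⟩
  have hc := h.crosses
  unfold Crosses at hc
  have hA := A.isLt
  have hB := B.isLt
  have hC := C.isLt
  have hD := D.isLt
  rcases hc with ⟨c1, c2, c3 | c3⟩ | ⟨c1, c2, c3 | c3⟩ | ⟨c1, c2, c3 | c3⟩ | ⟨c1, c2, c3 | c3⟩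
  · exact ⟨_, _, _, _, key h _ _ _ _ (hres A) (hres B) (hres D) (hres' C)
      (by omega) (by omega) (by omega) (by omega)⟩
  · exact ⟨_, _, _, _, key h _ _ _ _ (hres A) (hres B) (hres D) (hres C)
      (by omega) (by omega) (by omega) (by omega)⟩
  · exact ⟨_, _, _, _, key h.symm _ _ _ _ (hres B) (hres A) (hres' C) (hres' D)
      (by omega) (by omega) (by omega) (by omega)⟩
  · exact ⟨_, _, _, _, key h.symm _ _ _ _ (hres B) (hres A) (hres C) (hres' D)
      (by omega) (by omega) (by omega) (by omega)⟩
  · exact ⟨_, _, _, _, key h.symm _ _ _ _ (hres B) (hres A) (hres C) (hres D)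
      (by omega) (by omega) (by omega) (by omega)⟩
  · exact ⟨_, _, _, _, key h.symm _ _ _ _ (hres B) (hres' A) (hres' C) (hres' D)
      (by omega) (by omega) (by omega) (by omega)⟩
  · exact ⟨_, _, _, _, key h _ _ _ _ (hres A) (hres' B) (hres' D) (hres' C)
      (by omega) (by omega) (by omega) (by omega)⟩
  · exact ⟨_, _, _, _, key h _ _ _ _ (hres A) (hres B) (hres' D) (hres' C)
      (by omega) (by omega) (by omega) (by omega)⟩

theorem bruhatLE [NeZero n] (h : IsSmoothing τ τ' A B C D) :
    AffinePerm.BruhatLE τ.fPerm.toAffinePerm τ'.fPerm.toAffinePerm := by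
  obtain ⟨x₁, x₂, y₁, y₂, hu⟩ := h.exists_isUncrossing
  exact Matching.bruhatLE_of_isUncrossing hu

end IsSmoothing

namespace Matching

variable {n : ℕ}

/-- The matching obtained from `τ` by exchanging the points `A` and `B`. -/
def swapEnds (τ : Matching n) (A B : Fin (2 * n)) : Matching n where
  partner x := Equiv.swap A B (τ.partner (Equiv.swap A B x))
  involutive x := by simp [τ.involutive _]
  fixedPointFree x h := by
    apply τ.fixedPointFree (Equiv.swap A B x)
    conv_rhs => rw [← h, Equiv.swap_apply_self]

/-- If all intervals contain at most as many chords of `τ` as of `τ'`, then some crossing of `τ`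
can be smoothed such that this remains true and no other crossing is lost. -/
theorem exists_isSmoothing [NeZero n] {τ τ' : Matching n}
    (hle : ∀ i j, arcCount τ.gFun i j ≤ arcCount τ'.gFun i j) (hne : τ ≠ τ') :
    ∃ (τ'' : Matching n) (A B C D : Fin (2 * n)), IsSmoothing τ τ'' A B C D ∧
      (∀ y : Fin (2 * n), ¬ (Crosses A D y (τ.partner y) ∧ Crosses B C y (τ.partner y) ∧
        ¬ Crosses A C y (τ.partner y))) ∧
      ∀ i j, arcCount τ''.gFun i j ≤ arcCount τ'.gFun i j := by
  have hN := two_mul_pos (n := n)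
  have hg := τ.isMatchingLift
  have hg' := τ'.isMatchingLift
  have hgne : τ.gFun ≠ τ'.gFun := by
    intro h
    apply hne
    have hp : τ.partner = τ'.partner := by
      funext r
      have h1 := τ.residue_gFun ((r : ℤ) + 1)
      rw [h, residue_gFun, residue_add_one] at h1
      exact h1.symm
    cases τ
    cases τ'
    congr
  obtain ⟨x₁, x₂, l1, l3, hgap, hlt⟩ := hg.exists_uncrossing hN.le hg' hle hgne
  obtain ⟨y₁, hy₁⟩ : ∃ y, τ.gFun x₁ = y := ⟨_, rfl⟩
  obtain ⟨y₂, hy₂⟩ : ∃ y, τ.gFun x₂ = y := ⟨_, rfl⟩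
  rw [hy₁, hy₂] at l3 hgap hlt
  -- Otherwise `[x₂, y₁]` has at most one point, too few for the surplus arc that `hlt` provides.
  have l2 : x₂ < y₁ := by
    by_contra hcon
    have := hlt x₂ y₁ l1 le_rfl le_rfl l3
    rw [arcCount_of_le hg'.lt_apply (by omega)] at this
    omega
  -- Otherwise `[x₁ + 1, y₂ - 1]` contains a full period, where the counts agree, against `hlt`.
  have l4 : y₂ < x₁ + (2 * n : ℕ) := by
    have h1 : y₂ ≠ x₁ + (2 * n : ℕ) := by
      intro h
      have h2 := hg.apply_apply x₁
      rw [hy₁, ← h, ← hy₂] at h2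
      have := hg.injective h2
      omega
    by_contra hcon
    have h2 := hlt (x₁ + 1) (y₂ - 1) (by omega) (by omega) (by omega) (by omega)
    have h3 := hg.arcCount_of_add_le hN.le (i := x₁ + 1) (j := y₂ - 1) (by omega)
    have h4 := hg'.arcCount_of_add_le hN.le (i := x₁ + 1) (j := y₂ - 1) (by omega)
    omega
  obtain ⟨A, hA⟩ : ∃ A, residue (2 * n) x₁ = A := ⟨_, rfl⟩
  obtain ⟨B, hB⟩ : ∃ B, residue (2 * n) x₂ = B := ⟨_, rfl⟩
  obtain ⟨C, hC⟩ : ∃ C, residue (2 * n) y₂ = C := ⟨_, rfl⟩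
  obtain ⟨D, hD⟩ : ∃ D, residue (2 * n) y₁ = D := ⟨_, rfl⟩
  have hAD : τ.partner A = D := by rw [← hA, ← residue_gFun, hy₁, hD]
  have hBC : τ.partner B = C := by rw [← hB, ← residue_gFun, hy₂, hC]
  have rB := residue_sub_residue (N := 2 * n) l1.le (by omega)
  have rD := residue_sub_residue (N := 2 * n) (x := x₁) (y := y₁) (by omega) (by omega)
  have rC := residue_sub_residue (N := 2 * n) (x := x₁) (y := y₂) (by omega) (by omega)
  rw [hA] at rB rC rD
  rw [hB] at rB
  rw [hC] at rC
  rw [hD] at rD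
  have hA' := A.isLt
  have hB' := B.isLt
  have hC' := C.isLt
  have hD' := D.isLt
  have nAB : A ≠ B := fun h => by rw [h] at rB; omega
  have nAC : A ≠ C := fun h => by rw [h] at rC; omega
  have nAD : A ≠ D := fun h => by rw [h] at rD; omega
  have nBC : B ≠ C := fun h => by rw [h] at rB; omega
  have nBD : B ≠ D := fun h => by rw [h] at rB; omega
  have hsm : IsSmoothing τ (τ.swapEnds A B) A B C D := by
    refine ⟨hAD, hBC, ?_, ?_, ?_, ?_⟩
    · simp [swapEnds, hBC, Equiv.swap_apply_of_ne_of_ne nAC.symm nBC.symm]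
    · simp [swapEnds, hAD, Equiv.swap_apply_of_ne_of_ne nAD.symm nBD.symm]
    · intro x h1 h2 h3 h4
      simp only [swapEnds]
      rw [Equiv.swap_apply_of_ne_of_ne h1 h2, Equiv.swap_apply_of_ne_of_ne]
      · intro h
        rw [← h, τ.involutive] at hAD
        exact h4 hAD
      · intro h
        rw [← h, τ.involutive] at hBC
        exact h3 hBC
    · unfold Crosses
      omega
  refine ⟨τ.swapEnds A B, A, B, C, D, hsm, ?_, ?_⟩
  · rintro y ⟨c1, c2, c3⟩
    have hlift : ∀ r : Fin (2 * n), ∃ x : ℤ, residue (2 * n) x = r ∧ x₁ ≤ x ∧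
        x < x₁ + (2 * n : ℕ) := by
      intro r
      refine ⟨x₁ + ((r : ℤ) + 1 - x₁) % (2 * n : ℕ), ?_, ?_, ?_⟩
      · conv_rhs => rw [← residue_add_one r]
        rw [residue_eq_residue_iff]
        have := (Int.mod_modEq ((r : ℤ) + 1 - x₁) (2 * n : ℕ)).add_left x₁
        simpa using this
      · have := Int.emod_nonneg ((r : ℤ) + 1 - x₁) hN.ne'
        omega
      · have := Int.emod_lt_of_pos ((r : ℤ) + 1 - x₁) hN
        omega
    obtain ⟨u, hu, hu1, hu2⟩ := hlift y
    obtain ⟨v, hv, hv1, hv2⟩ := hlift (τ.partner y)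
    have ru := residue_sub_residue (N := 2 * n) hu1 hu2
    have rv := residue_sub_residue (N := 2 * n) hv1 hv2
    rw [hu, hA] at ru
    rw [hv, hA] at rv
    -- In the cyclic order `A, B, D, C`, a chord crossing `AD` and `BC` but not `AC` joins the gap
    -- between `A` and `B` to the gap between `D` and `C`. To see this, rotate `A` to `0`. Such a
    -- chord lifts to an arc excluded by `hgap`.
    have hpos : (x₁ < u ∧ u < x₂ ∧ y₁ < v ∧ v < y₂) ∨ (x₁ < v ∧ v < x₂ ∧ y₁ < u ∧ u < y₂) := by
      have hy := y.isLt
      have hty := (τ.partner y).isLt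
      have hoff : ∀ x r : ℤ, x₁ ≤ x → x < x₁ + (2 * n : ℕ) → 0 ≤ r →
          (r - A = x - x₁ ∧ (A : ℤ) ≤ r) ∨ (r - A = x - x₁ - (2 * n : ℕ) ∧ r < A) →
          (x - x₁).toNat + (A : ℕ) = r.toNat ∨
            (x - x₁).toNat + (A : ℕ) = r.toNat + 2 * n := by
        intro x r
        omega
      have oA : 0 + (A : ℕ) = A ∨ 0 + (A : ℕ) = A + 2 * n := by omega
      have oB := hoff x₂ B (by omega) (by omega) (by omega) rB
      have oC := hoff y₂ C (by omega) (by omega) (by omega) rC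
      have oD := hoff y₁ D (by omega) (by omega) (by omega) rD
      have ou := hoff u y (by omega) (by omega) (by omega) ru
      have ov := hoff v (τ.partner y) (by omega) (by omega) (by omega) rv
      simp only [Int.toNat_natCast] at oB oC oD ou ov
      obtain ⟨B', hB''⟩ : ∃ b, (x₂ - x₁).toNat = b := ⟨_, rfl⟩
      obtain ⟨C', hC''⟩ : ∃ b, (y₂ - x₁).toNat = b := ⟨_, rfl⟩
      obtain ⟨D', hD''⟩ : ∃ b, (y₁ - x₁).toNat = b := ⟨_, rfl⟩
      obtain ⟨u', hu''⟩ : ∃ b, (u - x₁).toNat = b := ⟨_, rfl⟩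
      obtain ⟨v', hv''⟩ : ∃ b, (v - x₁).toNat = b := ⟨_, rfl⟩
      rw [hB''] at oB
      rw [hC''] at oC
      rw [hD''] at oD
      rw [hu''] at ou
      rw [hv''] at ov
      have kA : 0 < 2 * n := by omega
      have kB : B' < 2 * n := by omega
      have kC : C' < 2 * n := by omega
      have kD : D' < 2 * n := by omega
      have ku : u' < 2 * n := by omega
      have kv : v' < 2 * n := by omega
      have c1' := c1.rotate kA kD ku kv oA oD ou ov hA' hD' hy hty
      have c2' := c2.rotate kB kC ku kv oB oC ou ov hB' hC' hy hty
      have c3' : ¬ Crosses 0 C' u' v' := fun h => c3 <| by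
        have back : ∀ p' p : ℕ, p < 2 * n → p' < 2 * n →
            (p' + (A : ℕ) = p ∨ p' + (A : ℕ) = p + 2 * n) →
            (p + (2 * n - A) = p' ∨ p + (2 * n - A) = p' + 2 * n) := by
          intro p' p
          omega
        exact h.rotate hA' hC' hy hty (back _ _ hA' kA oA) (back _ _ hC' kC oC)
          (back _ _ hy ku ou) (back _ _ hty kv ov) kA kC ku kv
      have c4 : 0 < B' ∧ B' < D' ∧ D' < C' := by omega
      have c5 : (0 < u' ∧ u' < B' ∧ D' < v' ∧ v' < C') ∨
          (0 < v' ∧ v' < B' ∧ D' < u' ∧ u' < C') := by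
        clear * - c1' c2' c3' c4
        unfold Crosses at c1' c2' c3'
        omega
      clear * - c5 hB'' hC'' hD'' hu'' hv'' hu1 hv1 l1 l2 l3
      omega
    rcases hpos with ⟨p1, p2, p3, p4⟩ | ⟨p1, p2, p3, p4⟩
    · have e : τ.gFun u = v := τ.gFun_eq (by omega) (by omega) (by rw [hu, hv])
      exact hgap u p1 p2 ⟨by omega, by omega⟩
    · have e : τ.gFun v = u := τ.gFun_eq (by omega) (by omega) (by rw [hu, hv, τ.involutive])
      exact hgap v p1 p2 ⟨by omega, by omega⟩
  · have hu : IsUncrossing ((2 * n : ℕ) : ℤ) τ.gFun (τ.swapEnds A B).gFun x₁ x₂ y₁ y₂ := by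
      refine ⟨l1, l2, l3, l4, hy₁, hy₂, ?_, ?_, ?_⟩
      · exact gFun_eq _ (by omega) (by omega) (by rw [hC, hA, hsm.right₁])
      · exact gFun_eq _ (by omega) (by omega) (by rw [hD, hB, hsm.right₂])
      · intro x m1 m2 m3 m4
        rw [← residue_eq_residue_iff] at m1 m2 m3 m4
        refine gFun_eq _ (hg.lt_apply x) (hg.apply_lt x) ?_
        rw [residue_gFun, hsm.eq_of_ne]
        · rwa [hA] at m1
        · rwa [hB] at m2
        · rwa [hC] at m4
        · rwa [hD] at m3
    exact hu.arcCount_le hN hg (Matching.isMatchingLift _) hg' hle hlt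

end Matching

/-! ### Counting crossings -/

theorem not_crosses_self (a b : ℕ) : ¬ Crosses a b a b := by
  unfold Crosses
  omega

theorem crosses_comm (a b c d : ℕ) : Crosses a b c d ↔ Crosses c d a b := by
  unfold Crosses
  omega

theorem crosses_swap_left (a b c d : ℕ) : Crosses b a c d ↔ Crosses a b c d := by
  unfold Crosses
  omega

theorem crosses_swap_right (a b c d : ℕ) : Crosses a b d c ↔ Crosses a b c d := by
  unfold Crosses
  omega

theorem crosses_iff_of_lt {a b y z : ℕ} (hyz : y < z) (h1 : a ≠ y) (h2 : a ≠ z) (h3 : b ≠ y)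
    (h4 : b ≠ z) : Crosses a b y z ↔ ¬ ((y < a ∧ a < z) ↔ (y < b ∧ b < z)) := by
  unfold Crosses
  omega

theorem Crosses.not_crosses {A B C D : ℕ} (h : Crosses A D B C) : ¬ Crosses A C B D := by
  unfold Crosses at *
  omega

theorem Crosses.ne {A B C D : ℕ} (h : Crosses A D B C) :
    A ≠ B ∧ A ≠ C ∧ A ≠ D ∧ B ≠ C ∧ B ≠ D ∧ C ≠ D := by
  unfold Crosses at h
  omega

/-- A chord cannot have `A, D` on one side and `B, C` on the other, since the chords `AD` and `BC`
meet. -/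
theorem Crosses.not_separated {A B C D : ℕ} (h : Crosses A D B C) (y z : ℕ) :
    ((y < A ∧ A < z) ↔ (y < D ∧ D < z)) → ((y < B ∧ B < z) ↔ (y < C ∧ C < z)) →
      ((y < A ∧ A < z) ↔ (y < B ∧ B < z)) := by
  unfold Crosses at h
  omega

theorem indicator_add_of_separated (a b c d : Prop) [Decidable a] [Decidable b] [Decidable c]
    [Decidable d] (h1 : (a ↔ d) → (b ↔ c) → (a ↔ b))
    (h2 : ¬ (¬ (a ↔ d) ∧ ¬ (b ↔ c) ∧ ¬ ¬ (a ↔ c))) :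
    ((if ¬ (a ↔ d) then 1 else 0) + if ¬ (b ↔ c) then 1 else 0 : ℕ) =
      (if ¬ (a ↔ c) then 1 else 0) + if ¬ (b ↔ d) then 1 else 0 := by
  by_cases a <;> by_cases b <;> by_cases c <;> by_cases d <;> simp_all

/-- Crossing `yz` means having ends on both sides of it. For the possible distributions of `A, B, C,
D` over the two sides, old and new chords have equally many crossings with `yz`, except if `A, C`
face `B, D`, which `hno` forbids, or `A, D` face `B, C`, which interlacing forbids. -/
theorem crossing_indicator_add {A B C D y z : ℕ} (h : Crosses A D B C) (hyz : y ≠ z)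
    (hA : A ≠ y ∧ A ≠ z) (hB : B ≠ y ∧ B ≠ z) (hC : C ≠ y ∧ C ≠ z) (hD : D ≠ y ∧ D ≠ z)
    (hno : ¬ (Crosses A D y z ∧ Crosses B C y z ∧ ¬ Crosses A C y z)) :
    ((if Crosses A D y z then 1 else 0) + if Crosses B C y z then 1 else 0 : ℕ) =
      (if Crosses A C y z then 1 else 0) + if Crosses B D y z then 1 else 0 := by
  wlog hlt : y < z generalizing y z
  · have := this (y := z) (z := y) hyz.symm hA.symm hB.symm hC.symm hD.symm
      (by simpa only [crosses_swap_right _ _ z y] using hno) (by omega)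
    simpa only [crosses_swap_right _ _ z y] using this
  have hsep := h.not_separated y z
  rw [crosses_iff_of_lt hlt hA.1 hA.2 hD.1 hD.2, crosses_iff_of_lt hlt hB.1 hB.2 hC.1 hC.2,
    crosses_iff_of_lt hlt hA.1 hA.2 hC.1 hC.2] at hno
  simp only [crosses_iff_of_lt hlt hA.1 hA.2 hD.1 hD.2, crosses_iff_of_lt hlt hB.1 hB.2 hC.1 hC.2,
    crosses_iff_of_lt hlt hA.1 hA.2 hC.1 hC.2, crosses_iff_of_lt hlt hB.1 hB.2 hD.1 hD.2]
  exact indicator_add_of_separated _ _ _ _ hsep hno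

/-- `π` restricts to a fixed point free involution of `{0, …, m - 1}`. -/
def IsPairing (m : ℕ) (π : ℕ → ℕ) : Prop :=
  ∀ x < m, π x < m ∧ π x ≠ x ∧ π (π x) = x

/-- The number of pairs of points which lie on crossing chords; this is eight times the number
of crossings. -/
def crossingSum (m : ℕ) (π : ℕ → ℕ) : ℕ :=
  ∑ x ∈ Finset.range m, ∑ y ∈ Finset.range m, if Crosses x (π x) y (π y) then 1 else 0

theorem crossingSum_congr {m : ℕ} {π π' : ℕ → ℕ} (h : ∀ x < m, π x = π' x) :
    crossingSum m π = crossingSum m π' := by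
  refine Finset.sum_congr rfl fun x hx => Finset.sum_congr rfl fun y hy => ?_
  rw [h x (Finset.mem_range.1 hx), h y (Finset.mem_range.1 hy)]

theorem sum_range_eq_sum_sdiff_add {m A B C D : ℕ} (hA : A < m) (hB : B < m) (hC : C < m)
    (hD : D < m) (hne : A ≠ B ∧ A ≠ C ∧ A ≠ D ∧ B ≠ C ∧ B ≠ D ∧ C ≠ D) (f : ℕ → ℕ) :
    ∑ x ∈ Finset.range m, f x =
      ∑ x ∈ Finset.range m \ {A, B, C, D}, f x + (f A + f B + f C + f D) := by
  obtain ⟨h1, h2, h3, h4, h5, h6⟩ := hne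
  rw [← Finset.sum_sdiff (s₁ := {A, B, C, D}) (s₂ := Finset.range m)]
  · rw [Finset.sum_insert, Finset.sum_insert, Finset.sum_insert, Finset.sum_singleton]
    · ring
    all_goals simp [*]
  · intro x
    simp only [Finset.mem_insert, Finset.mem_singleton, Finset.mem_range]
    omega

/-- Split the points into the four ends and the rest. Pairs within the rest are untouched, the mixed
pairs balance for each remaining point, and among the four ends the one crossing that disappears was
counted eight times: two choices of end on each chord, in two orders. -/
theorem crossingSum_eq_add_eight {m A B C D : ℕ} {π π' : ℕ → ℕ} (hπ : IsPairing m π)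
    (hA : A < m) (hB : B < m) (h1 : π A = D) (h2 : π B = C) (h1' : π' A = C) (h2' : π' B = D)
    (h3' : π' C = A) (h4' : π' D = B)
    (hagree : ∀ x < m, x ≠ A → x ≠ B → x ≠ C → x ≠ D → π' x = π x)
    (hcr : Crosses A D B C)
    (hno : ∀ y < m, y ≠ A → y ≠ B → y ≠ C → y ≠ D →
      ¬ (Crosses A D y (π y) ∧ Crosses B C y (π y) ∧ ¬ Crosses A C y (π y))) :
    crossingSum m π = crossingSum m π' + 8 := by
  have hne := hcr.ne
  obtain ⟨hD, -, h3⟩ := hπ A hA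
  obtain ⟨hC, -, h4⟩ := hπ B hB
  rw [h1] at hD h3
  rw [h2] at hC h4
  set F : ℕ → ℕ → ℕ := fun x y => if Crosses x (π x) y (π y) then 1 else 0 with hF
  set F' : ℕ → ℕ → ℕ := fun x y => if Crosses x (π' x) y (π' y) then 1 else 0 with hF'
  have hFc : ∀ x y, F x y = F y x := fun x y => by
    simp only [hF, crosses_comm x]
  have hFc' : ∀ x y, F' x y = F' y x := fun x y => by
    simp only [hF', crosses_comm x]
  have hmem : ∀ x, x ∈ Finset.range m \ {A, B, C, D} →
      x < m ∧ x ≠ A ∧ x ≠ B ∧ x ≠ C ∧ x ≠ D := by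
    intro x hx
    simpa using hx
  have hRR : ∀ x ∈ Finset.range m \ {A, B, C, D}, ∀ y ∈ Finset.range m \ {A, B, C, D},
      F x y = F' x y := by
    intro x hx y hy
    obtain ⟨a0, a1, a2, a3, a4⟩ := hmem x hx
    obtain ⟨b0, b1, b2, b3, b4⟩ := hmem y hy
    simp only [hF, hF', hagree x a0 a1 a2 a3 a4, hagree y b0 b1 b2 b3 b4]
  have hQR : ∀ y ∈ Finset.range m \ {A, B, C, D},
      F A y + F B y + F C y + F D y = F' A y + F' B y + F' C y + F' D y := by
    intro y hy
    obtain ⟨b0, b1, b2, b3, b4⟩ := hmem y hy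
    obtain ⟨-, c1, c2⟩ := hπ y b0
    have n1 : A ≠ π y := fun h => b4 (by rw [← c2, ← h, h1])
    have n2 : B ≠ π y := fun h => b3 (by rw [← c2, ← h, h2])
    have n3 : C ≠ π y := fun h => b2 (by rw [← c2, ← h, h4])
    have n4 : D ≠ π y := fun h => b1 (by rw [← c2, ← h, h3])
    have key := crossing_indicator_add hcr c1.symm ⟨b1.symm, n1⟩ ⟨b2.symm, n2⟩ ⟨b3.symm, n3⟩
      ⟨b4.symm, n4⟩ (hno y b0 b1 b2 b3 b4)
    simp only [hF, hF', hagree y b0 b1 b2 b3 b4, h1, h2, h3, h4, h1', h2', h3', h4',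
      crosses_swap_left B C, crosses_swap_left A D, crosses_swap_left A C, crosses_swap_left B D]
    omega
  have hQQ : ∀ G : ℕ → ℕ → ℕ, (∀ x y, G x y = G y x) →
      ∑ x ∈ Finset.range m, ∑ y ∈ Finset.range m, G x y =
        ∑ x ∈ Finset.range m \ {A, B, C, D}, ∑ y ∈ Finset.range m \ {A, B, C, D}, G x y +
        2 * ∑ y ∈ Finset.range m \ {A, B, C, D}, (G A y + G B y + G C y + G D y) +
        ((G A A + G A B + G A C + G A D) + (G B A + G B B + G B C + G B D) +
          (G C A + G C B + G C C + G C D) + (G D A + G D B + G D C + G D D)) := by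
    intro G hG
    have hGs : ∀ z, ∑ x ∈ Finset.range m \ {A, B, C, D}, G x z =
        ∑ x ∈ Finset.range m \ {A, B, C, D}, G z x := fun z =>
      Finset.sum_congr rfl fun x _ => hG x z
    simp only [sum_range_eq_sum_sdiff_add hA hB hC hD hne, Finset.sum_add_distrib, hGs A, hGs B,
      hGs C, hGs D]
    ring
  have hsum : crossingSum m π = ∑ x ∈ Finset.range m, ∑ y ∈ Finset.range m, F x y := rfl
  have hsum' : crossingSum m π' = ∑ x ∈ Finset.range m, ∑ y ∈ Finset.range m, F' x y := rfl
  rw [hsum, hsum', hQQ F hFc, hQQ F' hFc', Finset.sum_congr rfl hQR,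
    Finset.sum_congr rfl fun x hx => Finset.sum_congr rfl (hRR x hx)]
  have hcr' := hcr.not_crosses
  have hz := not_crosses_self
  have e1 : Crosses B C A D := (crosses_comm _ _ _ _).1 hcr
  have e2 : ¬ Crosses B D A C := fun h => hcr' ((crosses_comm _ _ _ _).1 h)
  simp only [hF, hF', h1, h2, h3, h4, h1', h2', h3', h4', crosses_swap_left B C,
    crosses_swap_left A D, crosses_swap_left A C, crosses_swap_left B D,
    crosses_swap_right _ _ B C, crosses_swap_right _ _ A D,
    crosses_swap_right _ _ A C, crosses_swap_right _ _ B D, hcr, hcr', hz, e1, e2, if_true,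
    if_false]

/-! ### Pairings and slices -/

namespace Slice

/-- The position below a birth at `i` of the point in position `x` above it. -/
def up (i x : ℕ) : ℕ := if x < i then x else x + 2

/-- The position below a death at `i` of the point in position `x` above it. -/
def down (i x : ℕ) : ℕ := if x < i then x else x - 2

/-- The pairing of the points in the row below a slice, given the pairing of the row above. -/
def glue : Slice → (ℕ → ℕ) → ℕ → ℕ
  | birth i, π => fun x =>
    if x = i then i + 1 else if x = i + 1 then i else up i (π (down i x))
  | death i, π => fun x =>
    down i (if π (up i x) = i then π (i + 1) else if π (up i x) = i + 1 then π i
      else π (up i x))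
  | cross i, π => fun x => Equiv.swap i (i + 1) (π (Equiv.swap i (i + 1) x))

theorem down_up (i x : ℕ) : down i (up i x) = x := by
  unfold down up
  split_ifs <;> omega

theorem up_down {i x : ℕ} (h1 : x ≠ i) (h2 : x ≠ i + 1) : up i (down i x) = x := by
  unfold down up
  split_ifs <;> omega

theorem up_ne (i x : ℕ) : up i x ≠ i ∧ up i x ≠ i + 1 := by
  unfold up
  split_ifs <;> omega

theorem up_lt_up (i x y : ℕ) : up i x < up i y ↔ x < y := by
  unfold up
  split_ifs <;> omega

theorem up_lt {i x m : ℕ} (hx : x < m) : up i x < m + 2 := by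
  unfold up
  split_ifs <;> omega

theorem down_lt {i x m : ℕ} (hi : i + 2 ≤ m) (hx : x < m) (h1 : x ≠ i) (h2 : x ≠ i + 1) :
    down i x < m - 2 := by
  unfold down
  split_ifs <;> omega

theorem down_lt_of_lt_add {i x m : ℕ} (hi : i ≤ m) (hx : x < m + 2) (h1 : x ≠ i)
    (h2 : x ≠ i + 1) : down i x < m := by
  unfold down
  split_ifs <;> omega

theorem swap_lt {i x m : ℕ} (hi : i + 2 ≤ m) (hx : x < m) : Equiv.swap i (i + 1) x < m := by
  rw [Equiv.swap_apply_def]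
  split_ifs <;> omega

theorem glue_birth_up (i : ℕ) (π : ℕ → ℕ) (x : ℕ) : (birth i).glue π (up i x) = up i (π x) := by
  have := up_ne i x
  simp only [glue, this.1, this.2, if_false, down_up]

theorem isPairing_glue {s : Slice} {m : ℕ} {π : ℕ → ℕ} (hs : s.Fits m) (hπ : IsPairing m π) :
    IsPairing (s.width m) (s.glue π) := by
  intro x hx
  cases s with
  | birth i =>
    simp only [Fits] at hs
    simp only [width] at hx ⊢
    by_cases h1 : x = i
    · subst h1
      simp [glue]
      omega
    by_cases h2 : x = i + 1
    · subst h2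
      simp [glue]
      omega
    rw [← up_down h1 h2, glue_birth_up, glue_birth_up]
    obtain ⟨h3, h4, h5⟩ := hπ _ (down_lt_of_lt_add hs hx h1 h2)
    refine ⟨up_lt h3, ?_, by rw [h5]⟩
    intro h
    rw [← down_up i (π _), h, down_up] at h4
    exact h4 rfl
  | death i =>
    simp only [Fits] at hs
    simp only [width] at hx ⊢
    have hX : up i x < m := by
      have := up_lt (i := i) hx
      omega
    have hne := up_ne i x
    obtain ⟨h1, h2, h3⟩ := hπ _ hX
    obtain ⟨a1, a2, a3⟩ := hπ i (by omega)
    obtain ⟨b1, b2, b3⟩ := hπ (i + 1) (by omega)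
    have key : ∀ z, z < m → z ≠ i → z ≠ i + 1 → z ≠ up i x → down i z < m - 2 ∧ down i z ≠ x := by
      intro z hz c1 c2 c3
      refine ⟨down_lt hs hz c1 c2, fun h => c3 ?_⟩
      rw [← h, up_down c1 c2]
    by_cases e1 : π (up i x) = i
    · have e2 : π i = up i x := by rwa [e1] at h3
      have n1 : π (i + 1) ≠ i := fun h => by
        rw [h, e2] at b3
        exact hne.2 b3
      have n3 : π (i + 1) ≠ up i x := fun h => by
        rw [h, e1] at b3
        omega
      have k := key _ b1 n1 b2 n3
      simp only [glue, e1, if_true]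
      refine ⟨k.1, k.2, ?_⟩
      rw [up_down n1 b2, b3, if_neg (by omega), if_pos rfl, e2, down_up]
    by_cases e2 : π (up i x) = i + 1
    · have e3 : π (i + 1) = up i x := by rwa [e2] at h3
      have n1 : π i ≠ i + 1 := fun h => by
        rw [h, e3] at a3
        exact hne.1 a3
      have n3 : π i ≠ up i x := fun h => by
        rw [h, e2] at a3
        omega
      have k := key _ a1 a2 n1 n3
      simp only [glue, e2, if_neg (show ¬ i + 1 = i by omega), if_true]
      refine ⟨k.1, k.2, ?_⟩
      rw [up_down a2 n1, a3, if_pos rfl, e3, down_up]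
    · have k := key _ h1 e1 e2 h2
      simp only [glue, e1, e2, if_false]
      refine ⟨k.1, k.2, ?_⟩
      rw [up_down e1 e2, h3, if_neg hne.1, if_neg hne.2, down_up]
  | cross i =>
    simp only [Fits] at hs
    simp only [width] at hx ⊢
    obtain ⟨h1, h2, h3⟩ := hπ _ (swap_lt hs hx)
    refine ⟨swap_lt hs h1, ?_, ?_⟩
    · intro h
      simp only [glue] at h
      apply h2
      conv_rhs => rw [← h]
      rw [Equiv.swap_apply_self]
    · simp only [glue, Equiv.swap_apply_self, h3]

theorem glue_congr {s : Slice} {m : ℕ} {π π' : ℕ → ℕ} (hs : s.Fits m) (hπ : ∀ x < m, π x = π' x) :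
    ∀ x < s.width m, s.glue π x = s.glue π' x := by
  intro x hx
  cases s with
  | birth i =>
    simp only [Fits] at hs
    simp only [width] at hx
    simp only [glue]
    split_ifs with h1 h2
    · rfl
    · rfl
    · rw [hπ _ (down_lt_of_lt_add hs hx h1 h2)]
  | death i =>
    simp only [Fits] at hs
    simp only [width] at hx
    have := up_lt (i := i) hx
    simp only [glue, hπ i (by omega), hπ (i + 1) (by omega), hπ (up i x) (by omega)]
  | cross i =>
    simp only [Fits] at hs
    simp only [width] at hx
    simp only [glue, hπ _ (swap_lt hs hx)]

end Slice

theorem sum_range_add_two {M : Type*} [AddCommMonoid M] {m i : ℕ} (hi : i ≤ m) (f : ℕ → M) :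
    ∑ x ∈ Finset.range (m + 2), f x =
      f i + f (i + 1) + ∑ x ∈ Finset.range m, f (Slice.up i x) := by
  obtain ⟨k, rfl⟩ := Nat.exists_eq_add_of_le hi
  rw [show i + k + 2 = i + (2 + k) by ring, Finset.sum_range_add, Finset.sum_range_add (fun x => f (i + x)),
    Finset.sum_range_add _ i k, Finset.sum_range_succ, Finset.sum_range_one]
  have h1 : ∑ x ∈ Finset.range i, f (Slice.up i x) = ∑ x ∈ Finset.range i, f x :=
    Finset.sum_congr rfl fun x hx => by simp [Slice.up, Finset.mem_range.1 hx]
  have h2 : ∑ x ∈ Finset.range k, f (Slice.up i (i + x)) =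
      ∑ x ∈ Finset.range k, f (i + (2 + x)) :=
    Finset.sum_congr rfl fun x _ => by
      congr 1
      simp only [Slice.up]
      rw [if_neg (by omega)]
      ring
  rw [h1, h2]
  simp only [add_zero]
  abel

/-- An arc between neighbours crosses nothing, and inserting two positions keeps the order of the
others. -/
theorem crossingSum_birth {m i : ℕ} (hi : i ≤ m) (π : ℕ → ℕ) :
    crossingSum (m + 2) ((Slice.birth i).glue π) = crossingSum m π := by
  have h1 : (Slice.birth i).glue π i = i + 1 := by simp [Slice.glue]
  have h2 : (Slice.birth i).glue π (i + 1) = i := by simp [Slice.glue]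
  have n1 : ∀ y z, ¬ Crosses i (i + 1) y z := fun y z => by
    unfold Crosses
    omega
  have n2 : ∀ y z, ¬ Crosses (i + 1) i y z := fun y z => by
    rw [crosses_swap_left]
    exact n1 y z
  have n3 : ∀ y z, ¬ Crosses y z i (i + 1) := fun y z => by
    rw [crosses_comm]
    exact n1 y z
  have n4 : ∀ y z, ¬ Crosses y z (i + 1) i := fun y z => by
    rw [crosses_comm]
    exact n2 y z
  have n5 : ∀ a b c d, Crosses (Slice.up i a) (Slice.up i b) (Slice.up i c) (Slice.up i d) ↔
      Crosses a b c d := fun a b c d => by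
    simp only [Crosses, Slice.up_lt_up]
  unfold crossingSum
  simp only [sum_range_add_two hi, h1, h2, n1, n2, n3, n4, Slice.glue_birth_up, n5, if_false,
    Finset.sum_const_zero, zero_add, add_zero]

/-- No other crossing is lost: a chord that crosses both old chords but not the new ones would need
an end strictly between `i` and `i + 1`. -/
theorem crossingSum_cross {m i : ℕ} {π : ℕ → ℕ} (hi : i + 2 ≤ m) (hπ : IsPairing m π)
    (hcr : Crosses i (π i) (i + 1) (π (i + 1))) :
    crossingSum m π = crossingSum m ((Slice.cross i).glue π) + 8 := by
  obtain ⟨h1, h2, h3⟩ := hπ i (by omega)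
  obtain ⟨h4, h5, h6⟩ := hπ (i + 1) (by omega)
  obtain ⟨-, n2, n3, n4, n5, n6⟩ := hcr.ne
  refine crossingSum_eq_add_eight hπ (A := i) (B := i + 1) (by omega) (by omega) rfl rfl
    ?_ ?_ ?_ ?_ ?_ hcr ?_
  · simp [Slice.glue, Equiv.swap_apply_of_ne_of_ne n2.symm n4.symm]
  · simp [Slice.glue, Equiv.swap_apply_of_ne_of_ne n3.symm n5.symm]
  · simp [Slice.glue, Equiv.swap_apply_of_ne_of_ne n2.symm n4.symm, h6]
  · simp [Slice.glue, Equiv.swap_apply_of_ne_of_ne n3.symm n5.symm, h3]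
  · intro x hx c1 c2 c3 c4
    simp only [Slice.glue, Equiv.swap_apply_of_ne_of_ne c1 c2]
    rw [Equiv.swap_apply_of_ne_of_ne]
    · intro h
      rw [← h, (hπ x hx).2.2] at c4
      exact c4 rfl
    · intro h
      rw [← h, (hπ x hx).2.2] at c3
      exact c3 rfl
  · intro y hy c1 c2 c3 c4
    have d1 : π y ≠ i := fun h => c4 (by rw [← h, (hπ y hy).2.2])
    have d2 : π y ≠ i + 1 := fun h => c3 (by rw [← h, (hπ y hy).2.2])
    generalize π y = z at *
    generalize π i = u at *
    generalize π (i + 1) = v at *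
    clear hcr h1 h2 h3 h4 h5 h6
    unfold Crosses
    omega

/-! ### Sequences of slices -/

/-- All slices of the sequence can be placed. -/
def ValidSlices (w : List Slice) : Prop :=
  ∀ (t : ℕ) (s : Slice), w[t]? = some s → s.Fits (bottomWidth (w.take t))

theorem bottomWidth_concat (w : List Slice) (s : Slice) :
    bottomWidth (w ++ [s]) = s.width (bottomWidth w) := by
  simp [bottomWidth]

theorem forall_getElem?_concat {α : Type*} (w : List α) (s : α) (P : ℕ → α → Prop) :
    (∀ t x, (w ++ [s])[t]? = some x → P t x) ↔
      (∀ t x, w[t]? = some x → P t x) ∧ P w.length s := by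
  constructor
  · intro h
    refine ⟨fun t x hx => h t x ?_, h _ _ (by simp)⟩
    have ht := (List.getElem?_eq_some_iff.1 hx).1
    rw [List.getElem?_append_left ht, hx]
  · rintro ⟨h1, h2⟩ t x hx
    rcases lt_trichotomy t w.length with ht | ht | ht
    · rw [List.getElem?_append_left ht] at hx
      exact h1 t x hx
    · subst ht
      simp only [List.getElem?_concat_length, Option.some.injEq] at hx
      exact hx ▸ h2
    · rw [List.getElem?_eq_none (by simp; omega)] at hx
      cases hx

theorem validSlices_concat (w : List Slice) (s : Slice) :
    ValidSlices (w ++ [s]) ↔ ValidSlices w ∧ s.Fits (bottomWidth w) := by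
  unfold ValidSlices
  rw [forall_getElem?_concat w s fun t x => x.Fits (bottomWidth ((w ++ [s]).take t))]
  refine and_congr (forall_congr' fun t => forall_congr' fun x =>
    forall_congr' fun hx => ?_) (by simp)
  have ht := (List.getElem?_eq_some_iff.1 hx).1
  rw [List.take_append_of_le_length ht.le]

theorem validSlices_nil : ValidSlices [] := by
  intro t s h
  simp at h

theorem ValidSlices.of_append {u v : List Slice} (h : ValidSlices (u ++ v)) : ValidSlices u := by
  induction v using List.reverseRecOn with
  | nil => simpa using h
  | append_singleton v s ih =>
    rw [← List.append_assoc, validSlices_concat] at h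
    exact ih h.1

/-- The pairing of the points in the bottom row of a sequence of slices. -/
def slicePairing (w : List Slice) : ℕ → ℕ :=
  w.foldl (fun π s => s.glue π) id

theorem slicePairing_concat (w : List Slice) (s : Slice) :
    slicePairing (w ++ [s]) = s.glue (slicePairing w) := by
  simp [slicePairing]

theorem ValidSlices.isPairing {w : List Slice} (hw : ValidSlices w) :
    IsPairing (bottomWidth w) (slicePairing w) := by
  induction w using List.reverseRecOn with
  | nil => intro x hx; simp [bottomWidth] at hx
  | append_singleton w s ih =>
    rw [validSlices_concat] at hw
    rw [bottomWidth_concat, slicePairing_concat]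
    exact Slice.isPairing_glue hw.2 (ih hw.1)

/-! ### Colourings -/

/-- The colours `c` of the row above the slice and `d` of the row below it are compatible with
the arcs inside the slice. -/
def Slice.Compatible (s : Slice) (c d : ℕ → Prop) : Prop :=
  (∀ p q, s.Through p q → (c p ↔ d q)) ∧ (∀ i, s = Slice.birth i → (d i ↔ d (i + 1))) ∧
    ∀ i, s = Slice.death i → (c i ↔ c (i + 1))

namespace Slice

theorem compatible_birth (i : ℕ) (c d : ℕ → Prop) :
    (birth i).Compatible c d ↔ (∀ p, c p ↔ d (up i p)) ∧ (d i ↔ d (i + 1)) := by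
  simp only [Compatible, Through, birth.injEq, reduceCtorEq, false_imp_iff, implies_true,
    and_true, forall_eq']
  refine and_congr_left fun _ => ⟨fun h p => h p _ ?_, fun h p q hpq => ?_⟩
  · unfold up
    split_ifs <;> omega
  · rw [h p]
    unfold up
    split_ifs <;> rcases hpq with ⟨h1, rfl⟩ | ⟨h1, rfl⟩ <;> first | rfl | omega

theorem compatible_death (i : ℕ) (c d : ℕ → Prop) :
    (death i).Compatible c d ↔ (∀ p, c (up i p) ↔ d p) ∧ (c i ↔ c (i + 1)) := by
  simp only [Compatible, Through, death.injEq, reduceCtorEq, false_imp_iff, implies_true,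
    true_and, forall_eq']
  refine and_congr_left fun _ => ⟨fun h p => h _ p ?_, fun h p q hpq => ?_⟩
  · unfold up
    split_ifs <;> omega
  · rw [← h q]
    unfold up
    split_ifs <;> rcases hpq with ⟨h1, rfl⟩ | ⟨h1, rfl⟩ <;> first | rfl | omega

theorem compatible_cross (i : ℕ) (c d : ℕ → Prop) :
    (cross i).Compatible c d ↔ ∀ p, c p ↔ d (Equiv.swap i (i + 1) p) := by
  simp only [Compatible, Through, reduceCtorEq, false_imp_iff, implies_true, and_true, forall_eq]

end Slice

/-- The predicate `S` on the points of a drawing is constant on strands. -/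
def IsColoring (w : List Slice) (S : ℕ → ℕ → Prop) : Prop :=
  ∀ (t : ℕ) (s : Slice), w[t]? = some s → s.Compatible (S t) (S (t + 1))

theorem isColoring_concat (w : List Slice) (s : Slice) (S : ℕ → ℕ → Prop) :
    IsColoring (w ++ [s]) S ↔ IsColoring w S ∧ s.Compatible (S w.length) (S (w.length + 1)) :=
  forall_getElem?_concat w s fun t x => x.Compatible (S t) (S (t + 1))

theorem IsColoring.of_append {u v : List Slice} {S : ℕ → ℕ → Prop}
    (h : IsColoring (u ++ v) S) : IsColoring u S := by
  induction v using List.reverseRecOn with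
  | nil => simpa using h
  | append_singleton v s ih =>
    rw [← List.append_assoc, isColoring_concat] at h
    exact ih h.1

theorem isColoring_append {u v : List Slice} {S : ℕ → ℕ → Prop} :
    IsColoring (u ++ v) S ↔ IsColoring u S ∧ IsColoring v fun t => S (u.length + t) := by
  induction v using List.reverseRecOn with
  | nil =>
    have : IsColoring [] fun t => S (u.length + t) := fun t s h => by simp at h
    simp [this]
  | append_singleton v s ih =>
    rw [← List.append_assoc, isColoring_concat, isColoring_concat, ih, List.length_append,
      and_assoc, add_assoc]

theorem isColoring_cons {s : Slice} {v : List Slice} {S : ℕ → ℕ → Prop} :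
    IsColoring (s :: v) S ↔ s.Compatible (S 0) (S 1) ∧ IsColoring v fun t => S (t + 1) := by
  have h := isColoring_append (u := [s]) (v := v) (S := S)
  rw [List.singleton_append, List.length_singleton] at h
  rw [h]
  refine and_congr ?_ (by simp only [add_comm])
  have h2 := isColoring_concat [] s S
  have h3 : IsColoring [] S := fun t s h => by simp at h
  simpa [h3] using h2

theorem IsColoring.congr {w : List Slice} {S T : ℕ → ℕ → Prop} (h : IsColoring w S)
    (hST : ∀ t ≤ w.length, S t = T t) : IsColoring w T := by
  intro t s hs
  have ht := (List.getElem?_eq_some_iff.1 hs).1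
  rw [← hST t ht.le, ← hST (t + 1) ht]
  exact h t s hs

/-- The pairing follows strands, along which colours are constant. At a local minimum, a strand
arriving at one of the joined positions continues from the partner of the other. -/
theorem IsColoring.slicePairing_iff {w : List Slice} {S : ℕ → ℕ → Prop} (h : IsColoring w S)
    (hw : ValidSlices w) {p : ℕ} (hp : p < bottomWidth w) :
    S w.length p ↔ S w.length (slicePairing w p) := by
  induction w using List.reverseRecOn generalizing p with
  | nil => simp [bottomWidth] at hp
  | append_singleton w s ih =>
    rw [validSlices_concat] at hw
    rw [isColoring_concat] at h
    rw [bottomWidth_concat] at hp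
    rw [slicePairing_concat, List.length_append, List.length_singleton]
    obtain ⟨h, hc⟩ := h
    obtain ⟨hw, hs⟩ := hw
    have ih' := fun {p} => ih h hw (p := p)
    have hpair := hw.isPairing
    set π := slicePairing w
    cases s with
    | birth i =>
      rw [Slice.compatible_birth] at hc
      simp only [Slice.Fits] at hs
      simp only [Slice.width] at hp
      by_cases h1 : p = i
      · simpa [Slice.glue, h1] using hc.2
      by_cases h2 : p = i + 1
      · simpa [Slice.glue, h2] using hc.2.symm
      rw [← Slice.up_down h1 h2, Slice.glue_birth_up, ← hc.1, ← hc.1]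
      exact ih' (Slice.down_lt_of_lt_add hs hp h1 h2)
    | death i =>
      rw [Slice.compatible_death] at hc
      simp only [Slice.Fits] at hs
      simp only [Slice.width] at hp
      have hX := Slice.up_lt (i := i) hp
      have hne := Slice.up_ne i p
      obtain ⟨h1, h2, h3⟩ := hpair _ (show Slice.up i p < bottomWidth w by omega)
      obtain ⟨a1, a2, a3⟩ := hpair i (by omega)
      obtain ⟨b1, b2, b3⟩ := hpair (i + 1) (by omega)
      rw [← hc.1, ih' (show Slice.up i p < bottomWidth w by omega)]
      by_cases e1 : π (Slice.up i p) = i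
      · have n1 : π (i + 1) ≠ i := fun h => by
          rw [h] at b3
          rw [e1, b3] at h3
          exact hne.2 h3.symm
        simp only [Slice.glue, e1, if_true]
        rw [← hc.1, Slice.up_down n1 b2, hc.2]
        exact ih' (by omega)
      by_cases e2 : π (Slice.up i p) = i + 1
      · have n1 : π i ≠ i + 1 := fun h => by
          rw [h] at a3
          rw [e2, a3] at h3
          exact hne.1 h3.symm
        simp only [Slice.glue, e2, if_neg (show ¬ i + 1 = i by omega), if_true]
        rw [← hc.1, Slice.up_down a2 n1, ← hc.2]
        exact ih' (by omega)
      · simp only [Slice.glue, e1, e2, if_false]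
        rw [← hc.1, Slice.up_down e1 e2]
    | cross i =>
      rw [Slice.compatible_cross] at hc
      simp only [Slice.Fits] at hs
      simp only [Slice.width] at hp
      have h1 := hc (Equiv.swap i (i + 1) p)
      rw [Equiv.swap_apply_self] at h1
      simp only [Slice.glue]
      rw [← h1, ← hc]
      exact ih' (Slice.swap_lt hs hp)

/-- Colours of the bottom row which respect the pairing extend to the drawing. -/
theorem exists_isColoring {w : List Slice} (hw : ValidSlices w) (c : ℕ → Prop)
    (hc : ∀ p < bottomWidth w, c p ↔ c (slicePairing w p)) :
    ∃ S, IsColoring w S ∧ S w.length = c := by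
  induction w using List.reverseRecOn generalizing c with
  | nil => exact ⟨fun _ => c, fun t s h => by simp at h, rfl⟩
  | append_singleton w s ih =>
    rw [validSlices_concat] at hw
    rw [bottomWidth_concat, slicePairing_concat] at hc
    obtain ⟨hw, hs⟩ := hw
    have hpair := hw.isPairing
    suffices h : ∃ c₀ : ℕ → Prop, s.Compatible c₀ c ∧
        ∀ p < bottomWidth w, c₀ p ↔ c₀ (slicePairing w p) by
      obtain ⟨c₀, h1, h2⟩ := h
      obtain ⟨S, hS, hlast⟩ := ih hw c₀ h2
      refine ⟨fun t => if t ≤ w.length then S t else c, ?_, ?_⟩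
      · rw [isColoring_concat]
        refine ⟨hS.congr fun t ht => by simp [ht], ?_⟩
        simpa [hlast] using h1
      · simp
    set π := slicePairing w
    cases s with
    | birth i =>
      simp only [Slice.Fits] at hs
      simp only [Slice.width] at hc
      refine ⟨fun p => c (Slice.up i p), ?_, fun p hp => ?_⟩
      · rw [Slice.compatible_birth]
        refine ⟨fun p => Iff.rfl, ?_⟩
        simpa [Slice.glue] using hc i (by omega)
      · change c _ ↔ c _
        rw [hc _ (Slice.up_lt hp), Slice.glue_birth_up]
    | death i =>
      simp only [Slice.Fits] at hs
      simp only [Slice.width] at hc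
      -- The two positions joined by the minimum take the colour of the far end of the strand
      -- through `i`. If `π i = i + 1` the strand closes up and either colour would do; it is left
      -- uncoloured.
      refine ⟨fun p => if p = i ∨ p = i + 1 then π i ≠ i + 1 ∧ c (Slice.down i (π i))
        else c (Slice.down i p), ?_, fun p hp => ?_⟩
      · rw [Slice.compatible_death]
        refine ⟨fun p => ?_, by simp⟩
        rw [if_neg (not_or.2 (Slice.up_ne i p)), Slice.down_up]
      · obtain ⟨a1, a2, a3⟩ := hpair i (by omega)
        obtain ⟨b1, b2, b3⟩ := hpair (i + 1) (by omega)
        obtain ⟨h1, h2, h3⟩ := hpair p hp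
        change π (π i) = i at a3
        change π (π (i + 1)) = i + 1 at b3
        change π (π p) = p at h3
        have hglue : ∀ z < bottomWidth w, z ≠ i → z ≠ i + 1 → (c (Slice.down i z) ↔
            c (Slice.down i (if π z = i then π (i + 1) else if π z = i + 1 then π i
              else π z))) := by
          intro z hz n1 n2
          have := hc _ (Slice.down_lt hs hz n1 n2)
          simpa only [Slice.glue, Slice.up_down n1 n2] using this
        by_cases e1 : p = i
        · subst e1
          by_cases e2 : π p = p + 1
          · simp [e2]
          · simp [e2, a2]
        by_cases e2 : p = i + 1
        · subst e2
          by_cases e3 : π (i + 1) = i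
          · simp [e3]
          · have e4 : π i ≠ i + 1 := fun h => e3 (by rw [← h, a3])
            have := hglue _ a1 a2 e4
            rw [if_pos a3] at this
            simp [e3, e4, b2, this]
        have g := hglue p hp e1 e2
        by_cases e3 : π p = i
        · have e4 : π i = p := by rw [e3] at h3; exact h3
          simp [e1, e2, e3, e4]
        by_cases e4 : π p = i + 1
        · have e5 : π i ≠ i + 1 := fun h => by
            rw [h, ← e4, h3] at a3
            exact e1 a3
          rw [if_neg e3, if_pos e4] at g
          simp [e1, e2, e4, e5, g]
        · rw [if_neg e3, if_neg e4] at g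
          simp [e1, e2, e3, e4, g]
    | cross i =>
      simp only [Slice.Fits] at hs
      simp only [Slice.width] at hc
      refine ⟨fun p => c (Equiv.swap i (i + 1) p), ?_, fun p hp => ?_⟩
      · rw [Slice.compatible_cross]
        exact fun p => Iff.rfl
      · change c _ ↔ c _
        rw [hc _ (Slice.swap_lt hs hp)]
        simp [Slice.glue]

/-! ### Smoothing a crossing -/

theorem Slice.compatible_death_birth {i : ℕ} {c : ℕ → Prop} (h : c i ↔ c (i + 1)) :
    (Slice.death i).Compatible c (fun p => c (Slice.up i p)) ∧
      (Slice.birth i).Compatible (fun p => c (Slice.up i p)) c := by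
  rw [Slice.compatible_death, Slice.compatible_birth]
  exact ⟨⟨fun p => Iff.rfl, h⟩, fun p => Iff.rfl, h⟩

theorem Slice.Compatible.eq_of_cross {i : ℕ} {c d : ℕ → Prop}
    (h : (Slice.cross i).Compatible c d) (hc : c i ↔ c (i + 1)) : d = c := by
  rw [Slice.compatible_cross] at h
  funext p
  have h1 := h (Equiv.swap i (i + 1) p)
  rw [Equiv.swap_apply_self] at h1
  rw [← h1]
  apply propext
  rcases eq_or_ne p i with rfl | n1
  · rw [Equiv.swap_apply_left, hc]
  rcases eq_or_ne p (i + 1) with rfl | n2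
  · rw [Equiv.swap_apply_right, hc]
  rw [Equiv.swap_apply_of_ne_of_ne n1 n2]

/-- The colourings of a drawing whose colours at a crossing agree are colourings of the drawings
obtained by smoothing the crossing. -/
theorem IsColoring.smooth {u v : List Slice} {i : ℕ} {S : ℕ → ℕ → Prop}
    (h : IsColoring (u ++ Slice.cross i :: v) S) (hS : S u.length i ↔ S u.length (i + 1))
    {w : List Slice} (hw : w = u ++ v ∨ w = u ++ Slice.death i :: Slice.birth i :: v) :
    ∃ T, IsColoring w T ∧ T w.length = S (u ++ Slice.cross i :: v).length := by
  rw [isColoring_append, isColoring_cons] at h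
  obtain ⟨hu, hx, hv⟩ := h
  have heq := hx.eq_of_cross hS
  rcases hw with rfl | rfl
  · refine ⟨fun t => if t ≤ u.length then S t else S (t + 1), ?_, ?_⟩
    · rw [isColoring_append]
      refine ⟨hu.congr fun t ht => by simp [ht], hv.congr fun t _ => ?_⟩
      rcases Nat.eq_zero_or_pos t with rfl | ht
      · simpa using heq
      · simp only [show ¬ u.length + t ≤ u.length by omega, if_false, add_assoc]
    · rcases Nat.eq_zero_or_pos v.length with hv0 | hv0
      · simpa [hv0] using heq.symm
      · simp only [List.length_append, List.length_cons,
          show ¬ u.length + v.length ≤ u.length by omega, if_false, add_assoc]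
  · have hdb := Slice.compatible_death_birth hS
    -- The smoothing has one more row, between the minimum and the maximum; it carries the old
    -- colours with the positions `i`, `i + 1` removed.
    refine ⟨fun t => if t ≤ u.length then S t else if t = u.length + 1 then
      fun p => S u.length (Slice.up i p) else S (t - 1), ?_, ?_⟩
    · rw [isColoring_append, isColoring_cons, isColoring_cons]
      refine ⟨hu.congr fun t ht => by simp [ht], ?_, ?_, hv.congr fun t _ => ?_⟩
      · simpa using hdb.1
      · have h3 := hdb.2
        have h4 : S u.length = S (u.length + 1) := heq.symm
        conv at h3 => arg 3; rw [h4]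
        simpa using h3
      · simp only [show ¬ u.length + (t + 1 + 1) ≤ u.length by omega,
          show ¬ u.length + (t + 1 + 1) = u.length + 1 by omega, if_false]
        congr 1
    · simp only [List.length_append, List.length_cons,
        show ¬ u.length + (v.length + 1 + 1) ≤ u.length by omega,
        show ¬ u.length + (v.length + 1 + 1) = u.length + 1 by omega, if_false]
      congr 1

/-! ### Parity of the number of crossings -/

/-- The number of pairs `p < q < m` with weights `c p` and `d q`, modulo two. -/
def inversionParity (m : ℕ) (c d : ℕ → ZMod 2) : ZMod 2 :=
  ∑ q ∈ Finset.range m, (∑ p ∈ Finset.range q, c p) * d q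

theorem sum_range_up {i : ℕ} {c c' : ℕ → ZMod 2} (hc : ∀ p, c p = c' (Slice.up i p))
    (hcc : c' i + c' (i + 1) = 0) (x : ℕ) :
    ∑ p ∈ Finset.range (Slice.up i x), c' p = ∑ p ∈ Finset.range x, c p := by
  by_cases hx : x < i
  · rw [Slice.up, if_pos hx]
    refine Finset.sum_congr rfl fun p hp => ?_
    rw [hc, Slice.up, if_pos ((Finset.mem_range.1 hp).trans hx)]
  · rw [Slice.up, if_neg hx, sum_range_add_two (m := x) (i := i) (by omega), hcc, zero_add]
    exact Finset.sum_congr rfl fun p _ => (hc p).symm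

/-- The two new positions have equal weights, so their pairs with any other position cancel modulo
two; the pair they form contributes nothing because no position carries both colours. -/
theorem inversionParity_birth {m i : ℕ} (hi : i ≤ m) {c d c' d' : ℕ → ZMod 2}
    (hc : ∀ p, c p = c' (Slice.up i p)) (hd : ∀ p, d p = d' (Slice.up i p))
    (hcc : c' i = c' (i + 1)) (hdd : d' i = d' (i + 1)) (hcd : c' i * d' i = 0) :
    inversionParity (m + 2) c' d' = inversionParity m c d := by
  have h2 : (2 : ZMod 2) = 0 := rfl
  unfold inversionParity
  rw [sum_range_add_two hi, Finset.sum_range_succ, ← hdd]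
  have h0 : c' i + c' (i + 1) = 0 := by
    rw [← hcc]
    linear_combination c' i * h2
  simp only [sum_range_up hc h0, ← hd]
  linear_combination ((∑ p ∈ Finset.range i, c' p) * d' i) * h2 + hcd

/-- Exchanging neighbours affects only the pair they form. It counted one of the two products before
and counts the other afterwards; modulo two the change is their sum. -/
theorem inversionParity_cross {m i : ℕ} (hi : i + 2 ≤ m) {c d c' d' : ℕ → ZMod 2}
    (hc : ∀ p, c p = c' (Equiv.swap i (i + 1) p)) (hd : ∀ p, d p = d' (Equiv.swap i (i + 1) p)) :
    inversionParity m c' d' = inversionParity m c d + (c i * d (i + 1) + c (i + 1) * d i) := by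
  have h2 : (2 : ZMod 2) = 0 := rfl
  obtain ⟨k, rfl⟩ : ∃ k, m = k + i + 2 := ⟨m - i - 2, by omega⟩
  have hup : ∀ x, Equiv.swap i (i + 1) (Slice.up i x) = Slice.up i x := fun x =>
    Equiv.swap_apply_of_ne_of_ne (Slice.up_ne i x).1 (Slice.up_ne i x).2
  have hsum : ∀ x, ∑ p ∈ Finset.range (Slice.up i x), c' p =
      ∑ p ∈ Finset.range (Slice.up i x), c p := by
    intro x
    by_cases hx : x < i
    · rw [Slice.up, if_pos hx]
      refine Finset.sum_congr rfl fun p hp => ?_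
      have := Finset.mem_range.1 hp
      rw [hc, Equiv.swap_apply_of_ne_of_ne (by omega) (by omega)]
    · rw [Slice.up, if_neg hx, sum_range_add_two (m := x) (i := i) (by omega),
        sum_range_add_two (m := x) (i := i) (by omega)]
      simp only [hc, Equiv.swap_apply_left, Equiv.swap_apply_right, hup]
      rw [add_comm (c' i)]
  have hsum0 : ∑ p ∈ Finset.range i, c' p = ∑ p ∈ Finset.range i, c p := by
    refine Finset.sum_congr rfl fun p hp => ?_
    have := Finset.mem_range.1 hp
    rw [hc, Equiv.swap_apply_of_ne_of_ne (by omega) (by omega)]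
  have hd1 : ∀ x, d' (Slice.up i x) = d (Slice.up i x) := fun x => by rw [hd, hup]
  have e1 : c i = c' (i + 1) := by rw [hc, Equiv.swap_apply_left]
  have e2 : c (i + 1) = c' i := by rw [hc, Equiv.swap_apply_right]
  have e3 : d i = d' (i + 1) := by rw [hd, Equiv.swap_apply_left]
  have e4 : d (i + 1) = d' i := by rw [hd, Equiv.swap_apply_right]
  unfold inversionParity
  rw [sum_range_add_two (m := k + i) (i := i) (by omega),
    sum_range_add_two (m := k + i) (i := i) (by omega), Finset.sum_range_succ,
    Finset.sum_range_succ]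
  simp only [hsum, hd1, hsum0, e1, e2, e3, e4]
  linear_combination (-(c' (i + 1) * d' i)) * h2

open Classical in
/-- The indicator of a predicate, modulo two. -/
noncomputable def indicatorTwo (c : ℕ → Prop) (p : ℕ) : ZMod 2 := if c p then 1 else 0

/-- The contribution of a slice to the number of crossings between two colours. -/
noncomputable def Slice.crossParity : Slice → (ℕ → Prop) → (ℕ → Prop) → ZMod 2
  | cross i, c, d => indicatorTwo c i * indicatorTwo d (i + 1) +
      indicatorTwo c (i + 1) * indicatorTwo d i
  | _, _, _ => 0

/-- A discrete form of the Jordan curve theorem: the inversions between two colours start at zero in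
the empty row and change parity only at crossings of the two colours. The bottom row thus knows the
parity of the number of these crossings. -/
theorem inversionParity_eq_sum_crossParity {w : List Slice} (hw : ValidSlices w)
    {S T : ℕ → ℕ → Prop} (hS : IsColoring w S) (hT : IsColoring w T)
    (hdisj : ∀ t p, ¬ (S t p ∧ T t p)) :
    inversionParity (bottomWidth w) (indicatorTwo (S w.length)) (indicatorTwo (T w.length)) =
      ∑ t ∈ Finset.range w.length, (w[t]?.elim 0 fun s => s.crossParity (S t) (T t)) := by
  have hcongr : ∀ {x y : ℕ} {c d : ℕ → Prop}, (c x ↔ d y) →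
      indicatorTwo c x = indicatorTwo d y := by
    intro x y c d h
    simp only [indicatorTwo]
    by_cases hx : c x
    · rw [if_pos hx, if_pos (h.1 hx)]
    · rw [if_neg hx, if_neg (mt h.2 hx)]
  have hzero : ∀ t p, indicatorTwo (S t) p * indicatorTwo (T t) p = 0 := by
    intro t p
    have := hdisj t p
    unfold indicatorTwo
    split_ifs <;> simp_all
  induction w using List.reverseRecOn with
  | nil => simp [inversionParity, bottomWidth]
  | append_singleton w s ih =>
    rw [validSlices_concat] at hw
    rw [isColoring_concat] at hS hT
    obtain ⟨hw, hs⟩ := hw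
    obtain ⟨hS, hcS⟩ := hS
    obtain ⟨hT, hcT⟩ := hT
    have ih := ih hw hS hT
    rw [bottomWidth_concat, List.length_append, List.length_singleton, Finset.sum_range_succ]
    have hsum : ∑ t ∈ Finset.range w.length,
        ((w ++ [s])[t]?.elim 0 fun s => s.crossParity (S t) (T t)) =
        ∑ t ∈ Finset.range w.length, (w[t]?.elim 0 fun s => s.crossParity (S t) (T t)) := by
      refine Finset.sum_congr rfl fun t ht => ?_
      rw [List.getElem?_append_left (Finset.mem_range.1 ht)]
    rw [hsum, ← ih, List.getElem?_concat_length, Option.elim_some]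
    cases s with
    | birth i =>
      rw [Slice.compatible_birth] at hcS hcT
      simp only [Slice.crossParity, add_zero, Slice.width]
      exact inversionParity_birth hs (fun p => hcongr (hcS.1 p)) (fun p => hcongr (hcT.1 p))
        (hcongr hcS.2) (hcongr hcT.2) (hzero _ _)
    | death i =>
      rw [Slice.compatible_death] at hcS hcT
      simp only [Slice.Fits] at hs
      simp only [Slice.crossParity, add_zero, Slice.width]
      obtain ⟨k, hk⟩ := Nat.exists_eq_add_of_le' hs
      rw [show bottomWidth w - 2 = k + i by omega, show bottomWidth w = k + i + 2 by omega]
      exact (inversionParity_birth (by omega) (fun p => (hcongr (hcS.1 p)).symm)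
        (fun p => (hcongr (hcT.1 p)).symm) (hcongr hcS.2) (hcongr hcT.2) (hzero _ _)).symm
    | cross i =>
      rw [Slice.compatible_cross] at hcS hcT
      simp only [Slice.crossParity, Slice.width]
      exact inversionParity_cross hs (fun p => hcongr (hcS p)) (fun p => hcongr (hcT p))

/-- An end `q` of one chord contributes the number of ends of the other chord to its left. The total
is odd exactly when the two chords interlace. -/
theorem inversionParity_pair {m a a' b b' : ℕ} {c d : ℕ → ZMod 2}
    (hb : b < m) (hb' : b' < m) (haa : a ≠ a') (hbb : b ≠ b') (h1 : a ≠ b) (h2 : a ≠ b')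
    (h3 : a' ≠ b) (h4 : a' ≠ b') (hc : ∀ p < m, c p = if p = a ∨ p = a' then 1 else 0)
    (hd : ∀ p < m, d p = if p = b ∨ p = b' then 1 else 0) :
    inversionParity m c d = if Crosses a a' b b' then 1 else 0 := by
  have e1 : ∀ q < m, ∑ p ∈ Finset.range q, c p =
      (if a < q then 1 else 0) + if a' < q then 1 else 0 := by
    intro q hq
    have : ∀ p ∈ Finset.range q, c p = (if p = a then 1 else 0) + if p = a' then 1 else 0 := by
      intro p hp
      rw [hc p ((Finset.mem_range.1 hp).trans hq)]
      by_cases k1 : p = a <;> by_cases k2 : p = a' <;> simp_all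
    rw [Finset.sum_congr rfl this, Finset.sum_add_distrib, Finset.sum_ite_eq', Finset.sum_ite_eq']
    simp only [Finset.mem_range]
  have e2 : ∀ q ∈ Finset.range m, (∑ p ∈ Finset.range q, c p) * d q =
      (if q = b then (if a < b then 1 else 0) + (if a' < b then 1 else 0) else 0) +
      (if q = b' then (if a < b' then 1 else 0) + (if a' < b' then 1 else 0) else 0) := by
    intro q hq
    rw [e1 q (Finset.mem_range.1 hq), hd q (Finset.mem_range.1 hq)]
    by_cases k1 : q = b
    · subst k1
      simp [hbb]
    · by_cases k2 : q = b'
      · subst k2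
        simp [hbb.symm]
      · simp [k1, k2]
  unfold inversionParity
  rw [Finset.sum_congr rfl e2, Finset.sum_add_distrib, Finset.sum_ite_eq', Finset.sum_ite_eq',
    if_pos (Finset.mem_range.2 hb), if_pos (Finset.mem_range.2 hb')]
  have key : Crosses a a' b b' ↔ ¬ (((a < b) ↔ (a' < b)) ↔ ((a < b') ↔ (a' < b'))) := by
    unfold Crosses
    omega
  simp only [key]
  by_cases k1 : a < b <;> by_cases k2 : a' < b <;> by_cases k3 : a < b' <;>
    by_cases k4 : a' < b' <;> simp [k1, k2, k3, k4] <;> rfl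

/-! ### Drawings without closed strands -/

/-- Every point lies on the same strand as some point of the bottom row. -/
def NoClosedStrand (w : List Slice) : Prop :=
  ∀ t ≤ w.length, ∀ p < bottomWidth (w.take t),
    ∃ q < bottomWidth w, ∀ S, IsColoring w S → (S t p ↔ S w.length q)

/-- The sequence of slices has no local minimum. -/
def NoDeath (w : List Slice) : Prop := ∀ i, Slice.death i ∉ w

/-- The position below a slice of the point in position `p` above it. -/
def Slice.below : Slice → ℕ → ℕ
  | birth i => up i
  | death i => down i
  | cross i => Equiv.swap i (i + 1)

/-- The position in the last row of the point in position `p` of the first row. -/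
def flow (v : List Slice) (p : ℕ) : ℕ := v.foldl (fun p s => s.below p) p

theorem flow_concat (v : List Slice) (s : Slice) (p : ℕ) :
    flow (v ++ [s]) p = s.below (flow v p) := by
  simp [flow]

theorem NoDeath.concat {v : List Slice} {s : Slice} :
    NoDeath (v ++ [s]) ↔ NoDeath v ∧ ∀ i, s ≠ Slice.death i := by
  simp only [NoDeath, List.mem_append, List.mem_singleton, not_or, forall_and, ne_eq,
    eq_comm (a := s)]

theorem Slice.below_lt {s : Slice} {m p : ℕ} (hs : s.Fits m) (hd : ∀ i, s ≠ death i)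
    (hp : p < m) : s.below p < s.width m := by
  cases s with
  | birth i => exact up_lt hp
  | death i => exact absurd rfl (hd i)
  | cross i => exact swap_lt hs hp

theorem Slice.Compatible.below_iff {s : Slice} {c d : ℕ → Prop} (h : s.Compatible c d)
    (hd : ∀ i, s ≠ death i) (p : ℕ) : c p ↔ d (s.below p) := by
  cases s with
  | birth i => exact ((compatible_birth i c d).1 h).1 p
  | death i => exact absurd rfl (hd i)
  | cross i => exact (compatible_cross i c d).1 h p

theorem Slice.below_injective {s : Slice} (hd : ∀ i, s ≠ death i) :
    Function.Injective s.below := by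
  cases s with
  | birth i =>
    intro x y h
    rw [← down_up i x, ← down_up i y]
    exact congrArg (down i) h
  | death i => exact absurd rfl (hd i)
  | cross i => exact Equiv.injective _

theorem flow_injective {v : List Slice} (hv : NoDeath v) : Function.Injective (flow v) := by
  induction v using List.reverseRecOn with
  | nil => exact fun _ _ h => h
  | append_singleton v s ih =>
    rw [NoDeath.concat] at hv
    intro x y h
    rw [flow_concat, flow_concat] at h
    exact ih hv.1 (Slice.below_injective hv.2 h)

theorem flow_lt {u v : List Slice} (huv : ValidSlices (u ++ v)) (hv : NoDeath v) {p : ℕ}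
    (hp : p < bottomWidth u) : flow v p < bottomWidth (u ++ v) := by
  induction v using List.reverseRecOn with
  | nil => simpa [flow] using hp
  | append_singleton v s ih =>
    rw [← List.append_assoc, validSlices_concat] at huv
    rw [NoDeath.concat] at hv
    rw [flow_concat, ← List.append_assoc, bottomWidth_concat]
    exact Slice.below_lt huv.2 hv.2 (ih huv.1 hv.1)

theorem IsColoring.flow_iff {v : List Slice} {S : ℕ → ℕ → Prop} (h : IsColoring v S)
    (hv : NoDeath v) (p : ℕ) : S 0 p ↔ S v.length (flow v p) := by
  induction v using List.reverseRecOn with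
  | nil => simp [flow]
  | append_singleton v s ih =>
    rw [isColoring_concat] at h
    rw [NoDeath.concat] at hv
    rw [flow_concat, List.length_append, List.length_singleton, ih h.1 hv.1]
    exact h.2.below_iff hv.2 _

theorem noClosedStrand_nil : NoClosedStrand [] := by
  intro t _ p hp
  simp [bottomWidth] at hp

/-- Only a local minimum can close a strand, and only if it joins two ends of the same one.
Otherwise a strand that reaches the minimum continues to the bottom from the partner of the other
joined position. -/
theorem NoClosedStrand.concat {w : List Slice} {s : Slice} (hw : ValidSlices (w ++ [s]))
    (h : NoClosedStrand w) (hs : ∀ i, s = Slice.death i → slicePairing w i ≠ i + 1) :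
    NoClosedStrand (w ++ [s]) := by
  intro t ht p hp
  rw [List.length_append, List.length_singleton] at ht
  rcases Nat.lt_or_ge w.length t with hlt | hle
  · obtain rfl : t = w.length + 1 := by omega
    refine ⟨p, ?_, fun S _ => ?_⟩
    · rwa [List.take_of_length_le (by simp)] at hp
    · simp
  rw [List.take_append_of_le_length hle] at hp
  obtain ⟨q, hq, hS⟩ := h t hle p hp
  rw [validSlices_concat] at hw
  rw [bottomWidth_concat, List.length_append, List.length_singleton]
  suffices h : ∃ q' < s.width (bottomWidth w), ∀ S, IsColoring (w ++ [s]) S →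
      (S w.length q ↔ S (w.length + 1) q') by
    obtain ⟨q', hq', h'⟩ := h
    exact ⟨q', hq', fun S hcol => (hS S hcol.of_append).trans (h' S hcol)⟩
  by_cases hd : ∀ i, s ≠ Slice.death i
  · refine ⟨s.below q, Slice.below_lt hw.2 hd hq, fun S hcol => ?_⟩
    rw [isColoring_concat] at hcol
    exact hcol.2.below_iff hd q
  push Not at hd
  obtain ⟨i, rfl⟩ := hd
  have hpi := hs i rfl
  have hfit : i + 2 ≤ bottomWidth w := hw.2
  have hpair := hw.1.isPairing
  obtain ⟨a1, a2, a3⟩ := hpair i (by omega)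
  obtain ⟨b1, b2, b3⟩ := hpair (i + 1) (by omega)
  have hpi' : slicePairing w (i + 1) ≠ i := fun h => by
    rw [h] at b3
    exact hpi b3
  have key : ∀ z < bottomWidth w, z ≠ i → z ≠ i + 1 →
      (∀ S, IsColoring (w ++ [Slice.death i]) S → (S w.length q ↔ S w.length z)) →
      ∃ q' < (Slice.death i).width (bottomWidth w), ∀ S, IsColoring (w ++ [Slice.death i]) S →
      (S w.length q ↔ S (w.length + 1) q') := by
    intro z hz n1 n2 hz'
    refine ⟨Slice.down i z, Slice.down_lt hfit hz n1 n2, fun S hcol => ?_⟩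
    rw [hz' S hcol]
    rw [isColoring_concat, Slice.compatible_death] at hcol
    rw [← hcol.2.1, Slice.up_down n1 n2]
  by_cases e1 : q = i
  · refine key _ b1 hpi' b2 fun S hcol => ?_
    rw [isColoring_concat, Slice.compatible_death] at hcol
    rw [e1, hcol.2.2, hcol.1.slicePairing_iff hw.1 (p := i + 1) (by omega)]
  by_cases e2 : q = i + 1
  · refine key _ a1 a2 hpi fun S hcol => ?_
    rw [isColoring_concat, Slice.compatible_death] at hcol
    rw [e2, ← hcol.2.2, hcol.1.slicePairing_iff hw.1 (p := i) (by omega)]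
  · exact key q hq e1 e2 fun S _ => Iff.rfl

theorem NoClosedStrand.append {u v : List Slice} (h : NoClosedStrand u)
    (huv : ValidSlices (u ++ v)) (hv : NoDeath v) : NoClosedStrand (u ++ v) := by
  induction v using List.reverseRecOn with
  | nil => simpa using h
  | append_singleton v s ih =>
    rw [NoDeath.concat] at hv
    rw [← List.append_assoc] at huv ⊢
    exact (ih (huv.of_append) hv.1).concat huv fun i hi => absurd hi (hv.2 i)

theorem NoDeath.noClosedStrand {w : List Slice} (hd : NoDeath w) (hw : ValidSlices w) :
    NoClosedStrand w := by
  simpa using noClosedStrand_nil.append (v := w) (by simpa using hw) hd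

/-! ### Drawing a matching -/

/-- The slice is a crossing. -/
def Slice.isCross : Slice → Bool
  | cross _ => true
  | _ => false

/-- Every matching has a drawing without local minima with as few crossings as possible. -/
theorem exists_slices (m : ℕ) (π : ℕ → ℕ) (hπ : IsPairing m π) :
    ∃ w : List Slice, ValidSlices w ∧ bottomWidth w = m ∧ NoDeath w ∧
      (∀ p < m, slicePairing w p = π p) ∧ 8 * w.countP Slice.isCross = crossingSum m π := by
  -- The drawing is built from the bottom upwards: taking off an arc between neighbours lowers `m`,
  -- taking off a crossing lowers the crossing sum.
  induction hk : m + crossingSum m π using Nat.strong_induction_on generalizing m π with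
  | _ k ih =>
  subst hk
  rcases Nat.eq_zero_or_pos m with rfl | hm
  · exact ⟨[], validSlices_nil, rfl, fun i => by simp, fun p hp => by omega,
      by simp [crossingSum]⟩
  -- A chord whose ends are as close as possible, with left end `i`.
  obtain ⟨i, hi, hmin⟩ := Finset.exists_min_image
    ((Finset.range m).filter fun p => p < π p) (fun p => π p - p)
    ⟨0, by
      obtain ⟨h1, h2, h3⟩ := hπ 0 hm
      simp only [Finset.mem_filter, Finset.mem_range]
      omega⟩
  simp only [Finset.mem_filter, Finset.mem_range] at hi hmin
  obtain ⟨a1, a2, a3⟩ := hπ i hi.1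
  by_cases hadj : π i = i + 1
  · obtain ⟨m, rfl⟩ : ∃ m', m = m' + 2 := ⟨m - 2, by omega⟩
    have hb : π (i + 1) = i := by rw [← hadj, a3]
    have hne : ∀ z < m + 2, z ≠ i → z ≠ i + 1 → π z ≠ i ∧ π z ≠ i + 1 := by
      intro z hz n1 n2
      obtain ⟨c1, c2, c3⟩ := hπ z hz
      refine ⟨fun h => n2 ?_, fun h => n1 ?_⟩
      · rw [← c3, h, hadj]
      · rw [← c3, h, hb]
    set π₀ : ℕ → ℕ := fun x => Slice.down i (π (Slice.up i x)) with hπ₀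
    have hglue : ∀ x < m + 2, (Slice.birth i).glue π₀ x = π x := by
      intro x hx
      by_cases e1 : x = i
      · simp [Slice.glue, e1, hadj]
      by_cases e2 : x = i + 1
      · simp [Slice.glue, e2, hb]
      have h1 := hne x hx e1 e2
      rw [← Slice.up_down e1 e2, Slice.glue_birth_up, hπ₀]
      dsimp only
      rw [Slice.up_down e1 e2, Slice.up_down h1.1 h1.2]
    have hpair : IsPairing m π₀ := by
      intro x hx
      have hX := Slice.up_lt (i := i) hx
      have hn := Slice.up_ne i x
      have h1 := hne _ hX hn.1 hn.2
      obtain ⟨c1, c2, c3⟩ := hπ _ hX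
      refine ⟨Slice.down_lt_of_lt_add (by omega) c1 h1.1 h1.2, fun h => c2 ?_, ?_⟩
      · rw [← Slice.up_down h1.1 h1.2]
        exact congrArg _ h
      · simp only [hπ₀]
        rw [Slice.up_down h1.1 h1.2, c3, Slice.down_up]
    have hsum : crossingSum (m + 2) π = crossingSum m π₀ :=
      (crossingSum_congr fun x hx => (hglue x hx).symm).trans (crossingSum_birth (by omega) π₀)
    obtain ⟨w, h1, h2, h3, h4, h5⟩ := ih (m + crossingSum m π₀) (by omega) m π₀ hpair rfl
    refine ⟨w ++ [Slice.birth i], ?_, ?_, ?_, ?_, ?_⟩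
    · rw [validSlices_concat]
      refine ⟨h1, ?_⟩
      simp only [Slice.Fits]
      omega
    · rw [bottomWidth_concat, h2]
      rfl
    · rw [NoDeath.concat]
      exact ⟨h3, fun j => by simp⟩
    · intro p hp
      rw [slicePairing_concat, ← hglue p hp]
      exact Slice.glue_congr (s := Slice.birth i) (m := m) (show i ≤ m by omega) h4 p hp
    · rw [List.countP_append, hsum, ← h5]
      simp [Slice.isCross]
  -- The chord at `i + 1` cannot end between `i + 1` and `π i`, as it would be shorter; hence it
  -- crosses the chord at `i`.
  · have hcr : Crosses i (π i) (i + 1) (π (i + 1)) := by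
      obtain ⟨b1, b2, b3⟩ := hπ (i + 1) (by omega)
      have h1 : π (i + 1) ≠ i := fun h => by
        rw [h] at b3
        exact hadj b3
      have h2 : π (i + 1) ≠ π i := fun h => by
        rw [h, a3] at b3
        omega
      have h3 := hmin (i + 1)
      unfold Crosses
      omega
    have hfit : (Slice.cross i).Fits m := by
      simp only [Slice.Fits]
      omega
    have hsum := crossingSum_cross hfit hπ hcr
    obtain ⟨w, h1, h2, h3, h4, h5⟩ := ih (m + crossingSum m ((Slice.cross i).glue π)) (by omega) m
      _ (Slice.isPairing_glue hfit hπ) rfl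
    refine ⟨w ++ [Slice.cross i], ?_, ?_, ?_, ?_, ?_⟩
    · rw [validSlices_concat, h2]
      exact ⟨h1, hfit⟩
    · rw [bottomWidth_concat, h2]
      rfl
    · rw [NoDeath.concat]
      exact ⟨h3, fun j => by simp⟩
    · intro p hp
      rw [slicePairing_concat, Slice.glue_congr (m := m) hfit h4 p hp]
      simp [Slice.glue]
    · rw [List.countP_append, hsum, ← h5]
      simp [Slice.isCross]
      ring

theorem ValidSlices.replace {a b v : List Slice} (hab : bottomWidth a = bottomWidth b)
    (hb : ValidSlices b) (h : ValidSlices (a ++ v)) :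
    ValidSlices (b ++ v) ∧ bottomWidth (b ++ v) = bottomWidth (a ++ v) := by
  induction v using List.reverseRecOn with
  | nil => simpa [hab] using hb
  | append_singleton v s ih =>
    rw [← List.append_assoc, validSlices_concat] at h
    have ih := ih h.1
    rw [← List.append_assoc, ← List.append_assoc, validSlices_concat, bottomWidth_concat,
      bottomWidth_concat, ih.2]
    exact ⟨⟨ih.1, h.2⟩, rfl⟩

theorem List.countP_eq_card_filter_range {α : Type*} (p : α → Bool) (w : List α) :
    w.countP p = ((Finset.range w.length).filter fun t => (w[t]?.elim false p) = true).card := by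
  induction w using List.reverseRecOn with
  | nil => simp
  | append_singleton w s ih =>
    rw [List.countP_append, ih, List.length_append, List.length_singleton, Finset.range_add_one,
      Finset.filter_insert]
    have h : ((Finset.range w.length).filter fun t => ((w ++ [s])[t]?.elim false p) = true) =
        (Finset.range w.length).filter fun t => (w[t]?.elim false p) = true := by
      refine Finset.filter_congr fun t ht => ?_
      rw [List.getElem?_append_left (Finset.mem_range.1 ht)]
    rw [h, List.getElem?_concat_length, Option.elim_some]
    cases hs : p s with
    | true => simp [hs]
    | false => simp [hs]

/-! ### Strands of medial graphs -/

namespace MedialGraph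

variable {n : ℕ}

theorem sameStrand_isColoring (G : MedialGraph n) (x : ℕ × ℕ) :
    IsColoring G.slices fun t p => G.SameStrand x (t, p) := by
  have key : ∀ {y z}, G.Adj y z → (G.SameStrand x y ↔ G.SameStrand x z) := fun h =>
    ⟨fun h' => h'.trans _ _ _ (.rel _ _ h), fun h' => h'.trans _ _ _ (.symm _ _ (.rel _ _ h))⟩
  intro t s hs
  refine ⟨fun p q hpq => key (.through hs hpq), fun i hi => ?_, fun i hi => ?_⟩
  · subst hi
    exact key (.birth hs)
  · subst hi
    exact key (.death hs)

/-- Colourings are constant on strands, and conversely the strand of `x` is itself a colouring,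
which separates `x` from everything off its strand. -/
theorem sameStrand_iff (G : MedialGraph n) (x y : ℕ × ℕ) :
    G.SameStrand x y ↔ ∀ S, IsColoring G.slices S → (S x.1 x.2 ↔ S y.1 y.2) := by
  constructor
  · intro h S hS
    induction h with
    | rel x y h =>
      cases h with
      | through hs hpq => exact (hS _ _ hs).1 _ _ hpq
      | birth hs => exact (hS _ _ hs).2.1 _ rfl
      | death hs => exact (hS _ _ hs).2.2 _ rfl
    | refl => exact Iff.rfl
    | symm _ _ _ ih => exact ih.symm
    | trans _ _ _ _ _ ih₁ ih₂ => exact ih₁.trans ih₂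
  · intro h
    exact (h _ (G.sameStrand_isColoring x)).1 (.refl _)

theorem validSlices (G : MedialGraph n) : ValidSlices G.slices := G.fits

theorem isPairing (G : MedialGraph n) : IsPairing (2 * n) (slicePairing G.slices) := by
  have h := G.validSlices.isPairing
  rwa [G.bottomWidth_eq] at h

theorem sameStrand_slicePairing (G : MedialGraph n) {p : ℕ} (hp : p < 2 * n) :
    G.SameStrand (G.slices.length, p) (G.slices.length, slicePairing G.slices p) := by
  rw [sameStrand_iff]
  intro S hS
  exact hS.slicePairing_iff G.validSlices (by rwa [G.bottomWidth_eq])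

theorem sameStrand_bottom_iff (G : MedialGraph n) {p q : ℕ} (hp : p < 2 * n) :
    G.SameStrand (G.slices.length, p) (G.slices.length, q) ↔
      q = p ∨ q = slicePairing G.slices p := by
  constructor
  · intro h
    rw [sameStrand_iff] at h
    -- Colouring just `p` and its partner respects the pairing, so it extends to the drawing and
    -- separates their strand from all other bottom points.
    obtain ⟨S, hS, hlast⟩ := exists_isColoring G.validSlices
      (fun q => q = p ∨ q = slicePairing G.slices p) fun q hq => by
        rw [G.bottomWidth_eq] at hq
        have h1 := (G.isPairing p hp).2.2
        have h2 := (G.isPairing q hq).2.2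
        constructor
        · rintro (rfl | rfl)
          · exact Or.inr rfl
          · exact Or.inl h1
        · rintro (h | h)
          · right
            rw [← h, h2]
          · left
            rw [← h2, h, h1]
    have h3 := h S hS
    rw [hlast] at h3
    exact h3.1 (Or.inl rfl)
  · rintro (rfl | rfl)
    · exact .refl _
    · exact G.sameStrand_slicePairing hp

end MedialGraph

/-- The partner function of a matching on natural numbers. -/
def Matching.toNat {n : ℕ} (τ : Matching n) (p : ℕ) : ℕ :=
  if h : p < 2 * n then τ.partner ⟨p, h⟩ else p

theorem Matching.toNat_coe {n : ℕ} (τ : Matching n) (r : Fin (2 * n)) :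
    τ.toNat r = τ.partner r := by
  simp [Matching.toNat]

theorem Matching.isPairing_toNat {n : ℕ} (τ : Matching n) : IsPairing (2 * n) τ.toNat := by
  intro x hx
  obtain ⟨r, rfl⟩ : ∃ r : Fin (2 * n), (r : ℕ) = x := ⟨⟨x, hx⟩, rfl⟩
  rw [τ.toNat_coe, τ.toNat_coe, τ.involutive]
  exact ⟨(τ.partner r).isLt, fun h => τ.fixedPointFree r (Fin.ext h), rfl⟩

namespace MedialGraph

variable {n : ℕ}

theorem hasPairing_iff (G : MedialGraph n) (τ : Matching n) :
    G.HasPairing τ ↔ ∀ p < 2 * n, slicePairing G.slices p = τ.toNat p := by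
  constructor
  · intro h p hp
    obtain ⟨h1, h2, -⟩ := G.isPairing p hp
    have h3 := (h ⟨p, hp⟩ ⟨_, h1⟩).1 (G.sameStrand_slicePairing hp)
    rw [Matching.toNat, dif_pos hp]
    rcases h3 with h3 | h3
    · exact absurd (congrArg Fin.val h3) h2
    · exact congrArg Fin.val h3
  · intro h r s
    have := G.sameStrand_bottom_iff (p := r) (q := s) r.isLt
    rw [h r r.isLt, τ.toNat_coe] at this
    rw [Fin.ext_iff, Fin.ext_iff]
    exact this

theorem exists_hasPairing (G : MedialGraph n) : ∃ τ, G.HasPairing τ := by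
  refine ⟨⟨fun r => ⟨slicePairing G.slices r, (G.isPairing r r.isLt).1⟩, fun r => ?_,
    fun r h => ?_⟩, ?_⟩
  · exact Fin.ext (G.isPairing r r.isLt).2.2
  · exact (G.isPairing r r.isLt).2.1 (congrArg Fin.val h)
  · rw [hasPairing_iff]
    intro p hp
    simp [Matching.toNat, hp]

theorem exists_sameStrand_bottom (G : MedialGraph n) (h : NoClosedStrand G.slices) {x : ℕ × ℕ}
    (hx : G.IsPoint x) : ∃ r : Fin (2 * n), G.SameStrand x (G.boundaryPoint r) := by
  obtain ⟨q, hq, hS⟩ := h x.1 hx.1 x.2 hx.2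
  rw [G.bottomWidth_eq] at hq
  exact ⟨⟨q, hq⟩, (G.sameStrand_iff _ _).2 hS⟩

theorem isPoint_of_isCrossing (G : MedialGraph n) {t i : ℕ} (h : G.IsCrossing t i) :
    G.IsPoint (t, i) ∧ G.IsPoint (t, i + 1) := by
  have h1 : i + 2 ≤ bottomWidth (G.slices.take t) := G.fits t _ h
  have h2 := (List.getElem?_eq_some_iff.1 h).1.le
  exact ⟨⟨h2, by dsimp only; omega⟩, ⟨h2, by dsimp only; omega⟩⟩

/-- The strands `S` and `T` meet at the crossing `i` of the slice number `t`. -/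
def Meet (S T : ℕ → ℕ → Prop) (t i : ℕ) : Prop :=
  (S t i ∧ T t (i + 1)) ∨ (S t (i + 1) ∧ T t i)

theorem inversionParity_strands (G : MedialGraph n) {x y : ℕ} (hx : x < 2 * n) (hy : y < 2 * n)
    (hxy : ¬ G.SameStrand (G.slices.length, x) (G.slices.length, y)) :
    (if Crosses x (slicePairing G.slices x) y (slicePairing G.slices y) then 1 else 0 : ZMod 2) =
      ∑ t ∈ Finset.range G.slices.length, (G.slices[t]?.elim 0 fun s =>
        s.crossParity (fun p => G.SameStrand (G.slices.length, x) (t, p))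
          (fun p => G.SameStrand (G.slices.length, y) (t, p))) := by
  have hdisj : ∀ t p, ¬ (G.SameStrand (G.slices.length, x) (t, p) ∧
      G.SameStrand (G.slices.length, y) (t, p)) := fun t p h =>
    hxy (h.1.trans _ _ _ (.symm _ _ h.2))
  rw [← inversionParity_eq_sum_crossParity G.validSlices (G.sameStrand_isColoring _)
    (G.sameStrand_isColoring _) hdisj, G.bottomWidth_eq]
  obtain ⟨x1, x2, x3⟩ := G.isPairing x hx
  obtain ⟨y1, y2, y3⟩ := G.isPairing y hy
  rw [G.sameStrand_bottom_iff hx, not_or] at hxy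
  symm
  refine inversionParity_pair hy y1 x2.symm y2.symm (fun h => hxy.1 h.symm) (fun h => ?_)
    (fun h => hxy.2 h.symm) (fun h => ?_) (fun p hp => ?_) (fun p hp => ?_)
  · apply hxy.2
    rw [h, y3]
  · apply hxy.1
    rw [← y3, ← h, x3]
  · unfold indicatorTwo
    simp only [G.sameStrand_bottom_iff hx]
  · unfold indicatorTwo
    simp only [G.sameStrand_bottom_iff hy]

/-- Two strands whose ends interlace meet at a crossing. -/
theorem exists_isCrossing (G : MedialGraph n) {x y : ℕ} (hx : x < 2 * n) (hy : y < 2 * n)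
    (h : Crosses x (slicePairing G.slices x) y (slicePairing G.slices y)) :
    ∃ t i, G.IsCrossing t i ∧ Meet (fun t p => G.SameStrand (G.slices.length, x) (t, p))
      (fun t p => G.SameStrand (G.slices.length, y) (t, p)) t i := by
  have hxy : ¬ G.SameStrand (G.slices.length, x) (G.slices.length, y) := by
    rw [G.sameStrand_bottom_iff hx]
    rintro (rfl | rfl)
    · exact not_crosses_self _ _ h
    · rw [(G.isPairing x hx).2.2, crosses_swap_right] at h
      exact not_crosses_self _ _ h
  have hsum := G.inversionParity_strands hx hy hxy
  rw [if_pos h] at hsum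
  obtain ⟨t, -, ht⟩ := Finset.exists_ne_zero_of_sum_ne_zero (hsum ▸ one_ne_zero)
  rcases hs : G.slices[t]? with _ | s
  · simp [hs] at ht
  rw [hs, Option.elim_some] at ht
  cases s with
  | birth i => exact absurd rfl ht
  | death i => exact absurd rfl ht
  | cross i =>
    refine ⟨t, i, hs, ?_⟩
    by_contra hcon
    rw [Meet, not_or, not_and_or, not_and_or] at hcon
    apply ht
    simp only [Slice.crossParity, indicatorTwo]
    rcases hcon with ⟨c | c, d | d⟩ <;> simp [c, d]

/-- In a lensless medial graph, the ends of two strands which meet at a crossing interlace. -/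
theorem Lensless.crosses {G : MedialGraph n} (hG : G.Lensless) {t i x y : ℕ} (hx : x < 2 * n)
    (hy : y < 2 * n) (ht : G.IsCrossing t i) (h1 : G.SameStrand (G.slices.length, x) (t, i))
    (h2 : G.SameStrand (G.slices.length, y) (t, i + 1)) :
    Crosses x (slicePairing G.slices x) y (slicePairing G.slices y) := by
  have hxy : ¬ G.SameStrand (G.slices.length, x) (G.slices.length, y) := fun h =>
    hG.no_self_crossing t i ht ((h1.symm _ _).trans _ _ _ (h.trans _ _ _ h2))
  have hsum := G.inversionParity_strands hx hy hxy
  -- The two strands meet nowhere else, so the parity sum is the single contribution of slice `t`,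
  -- which is one.
  rw [Finset.sum_eq_single_of_mem t
    (Finset.mem_range.2 (List.getElem?_eq_some_iff.1 ht).1)] at hsum
  · rw [show G.slices[t]? = _ from ht, Option.elim_some] at hsum
    have n1 : ¬ G.SameStrand (G.slices.length, x) (t, i + 1) := fun h =>
      hxy (h.trans _ _ _ (h2.symm _ _))
    simp only [Slice.crossParity, indicatorTwo, if_pos h1, if_pos h2, if_neg n1, mul_one,
      zero_mul, add_zero] at hsum
    by_contra hcon
    rw [if_neg hcon] at hsum
    exact zero_ne_one hsum
  · intro t' _ hne
    rcases hs : G.slices[t']? with _ | s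
    · rfl
    rw [Option.elim_some]
    cases s with
    | birth i => rfl
    | death i => rfl
    | cross j =>
      have key := hG.no_lens t i t' j ht hs hne.symm
      rw [not_or] at key
      have k1 : ¬ (G.SameStrand (G.slices.length, x) (t', j) ∧
          G.SameStrand (G.slices.length, y) (t', j + 1)) := fun h => key.1
        ⟨(h1.symm _ _).trans _ _ _ h.1, (h2.symm _ _).trans _ _ _ h.2⟩
      have k2 : ¬ (G.SameStrand (G.slices.length, x) (t', j + 1) ∧
          G.SameStrand (G.slices.length, y) (t', j)) := fun h => key.2
        ⟨(h1.symm _ _).trans _ _ _ h.1, (h2.symm _ _).trans _ _ _ h.2⟩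
      simp only [Slice.crossParity, indicatorTwo]
      rw [not_and_or] at k1 k2
      rcases k1 with c | c <;> rcases k2 with d | d <;> simp [c, d]

/-- A medial graph without closed strands and with as few crossings as the pairing permits is
lensless. -/
theorem lensless_of_crossingSum (G : MedialGraph n) (hG : NoClosedStrand G.slices)
    (h : 8 * G.slices.countP Slice.isCross = crossingSum (2 * n) (slicePairing G.slices)) :
    G.Lensless := by
  classical
  set π := slicePairing G.slices with hπ
  set L := G.slices.length
  have hpair := G.isPairing
  set K := (Finset.range L).filter fun t => (G.slices[t]?.elim false Slice.isCross) = true with hK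
  have hKmem : ∀ {t i}, G.IsCrossing t i → t ∈ K := by
    intro t i ht
    rw [hK, Finset.mem_filter, Finset.mem_range, show G.slices[t]? = _ from ht]
    exact ⟨(List.getElem?_eq_some_iff.1 ht).1, rfl⟩
  set R := Finset.range (2 * n) ×ˢ Finset.range (2 * n)
  set P := R.filter fun z => Crosses z.1 (π z.1) z.2 (π z.2) with hP
  have hPcard : P.card = 8 * K.card := by
    rw [hK, ← List.countP_eq_card_filter_range, h, hP, Finset.card_filter, Finset.sum_product]
    rfl
  -- The pairs of ends explained by slice `t`. Each interlacing pair is explained by some crossing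
  -- and each crossing explains at most eight pairs, so the equality of the totals leaves no room
  -- for waste.
  set E : ℕ → Finset (ℕ × ℕ) := fun t => R.filter fun z => ∃ i, G.IsCrossing t i ∧
    Meet (fun t p => G.SameStrand (L, z.1) (t, p)) (fun t p => G.SameStrand (L, z.2) (t, p)) t i
    with hE
  have hPE : ∀ z ∈ P, ∃ t ∈ K, z ∈ E t := by
    intro z hz
    rw [hP, Finset.mem_filter] at hz
    have hz' := Finset.mem_product.1 hz.1
    rw [Finset.mem_range, Finset.mem_range] at hz'
    obtain ⟨t, i, ht, hm⟩ := G.exists_isCrossing hz'.1 hz'.2 hz.2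
    exact ⟨t, hKmem ht, Finset.mem_filter.2 ⟨hz.1, i, ht, hm⟩⟩
  -- Each of the two strands at a crossing has at most two ends, and pairs are counted in both
  -- orders.
  have hEcard : ∀ t, (E t).card ≤ 8 := by
    intro t
    by_cases hex : ∃ i, G.IsCrossing t i
    · obtain ⟨i, ht⟩ := hex
      obtain ⟨p1, p2⟩ := G.isPoint_of_isCrossing ht
      obtain ⟨r, hr⟩ := G.exists_sameStrand_bottom hG p1
      obtain ⟨s, hs⟩ := G.exists_sameStrand_bottom hG p2
      have hsub : E t ⊆ (({(r : ℕ), π r} : Finset ℕ) ×ˢ ({(s : ℕ), π s} : Finset ℕ)) ∪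
          (({(s : ℕ), π s} : Finset ℕ) ×ˢ ({(r : ℕ), π r} : Finset ℕ)) := by
        intro z hz
        obtain ⟨hzR, j, hj, hm⟩ := Finset.mem_filter.1 hz
        obtain rfl : j = i := by
          have := (show G.slices[t]? = _ from hj).symm.trans ht
          simpa using this
        have hr' : ∀ q, G.SameStrand (L, q) (t, j) → q = r ∨ q = π r := fun q hq =>
          (G.sameStrand_bottom_iff r.isLt).1 ((hr.symm _ _).trans _ _ _ (hq.symm _ _))
        have hs' : ∀ q, G.SameStrand (L, q) (t, j + 1) → q = s ∨ q = π s := fun q hq =>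
          (G.sameStrand_bottom_iff s.isLt).1 ((hs.symm _ _).trans _ _ _ (hq.symm _ _))
        rw [Finset.mem_union, Finset.mem_product, Finset.mem_product]
        simp only [Finset.mem_insert, Finset.mem_singleton]
        rcases hm with ⟨m1, m2⟩ | ⟨m1, m2⟩
        · exact Or.inl ⟨hr' _ m1, hs' _ m2⟩
        · exact Or.inr ⟨hs' _ m1, hr' _ m2⟩
      refine (Finset.card_le_card hsub).trans ((Finset.card_union_le _ _).trans ?_)
      rw [Finset.card_product, Finset.card_product]
      have c1 : ({(r : ℕ), π r} : Finset ℕ).card ≤ 2 := Finset.card_le_two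
      have c2 : ({(s : ℕ), π s} : Finset ℕ).card ≤ 2 := Finset.card_le_two
      nlinarith
    · rw [Finset.card_eq_zero.2]
      · exact Nat.zero_le _
      · rw [Finset.eq_empty_iff_forall_notMem]
        intro z hz
        obtain ⟨-, j, hj, -⟩ := Finset.mem_filter.1 hz
        exact hex ⟨j, hj⟩
  -- no crossing is superfluous
  have hneed : ∀ t ∈ K, ∃ z ∈ P, ∀ t' ∈ K, t' ≠ t → z ∉ E t' := by
    intro t ht
    by_contra hcon
    push Not at hcon
    have hsub : P ⊆ (K.erase t).biUnion E := by
      intro z hz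
      obtain ⟨t', h1, h2, h3⟩ := hcon z hz
      exact Finset.mem_biUnion.2 ⟨t', Finset.mem_erase.2 ⟨h2, h1⟩, h3⟩
    have h1 := (Finset.card_le_card hsub).trans
      (Finset.card_biUnion_le_card_mul _ _ 8 fun t _ => hEcard t)
    rw [Finset.card_erase_of_mem ht, hPcard] at h1
    have := Finset.card_pos.2 ⟨t, ht⟩
    omega
  refine ⟨fun x hx => G.exists_sameStrand_bottom hG hx, ?_, ?_⟩
  -- A self-crossing only explains pairs of ends of one strand, which never interlace, so it would
  -- be superfluous.
  · intro t i ht hself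
    obtain ⟨z, hz, hno⟩ := hneed t (hKmem ht)
    obtain ⟨t', ht', hzt'⟩ := hPE z hz
    obtain rfl : t' = t := by
      by_contra hne
      exact hno t' ht' hne hzt'
    obtain ⟨hzR, j, hj, hm⟩ := Finset.mem_filter.1 hzt'
    obtain rfl : j = i := by
      have := (show G.slices[t']? = _ from hj).symm.trans ht
      simpa using this
    have hzz : G.SameStrand (L, z.1) (L, z.2) := by
      rcases hm with ⟨m1, m2⟩ | ⟨m1, m2⟩
      · exact m1.trans _ _ _ (hself.trans _ _ _ (m2.symm _ _))
      · exact m1.trans _ _ _ ((hself.symm _ _).trans _ _ _ (m2.symm _ _))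
    have hz' := Finset.mem_filter.1 hz
    have hz1 : z.1 < 2 * n := Finset.mem_range.1 (Finset.mem_product.1 hz'.1).1
    rw [G.sameStrand_bottom_iff hz1] at hzz
    have hcr := hz'.2
    rcases hzz with e | e
    · rw [e] at hcr
      exact not_crosses_self _ _ hcr
    · have e2 : z.2 = π z.1 := e
      rw [e2, show π (π z.1) = z.1 from (hpair z.1 hz1).2.2, crosses_swap_right] at hcr
      exact not_crosses_self _ _ hcr
  -- Two crossings of the same two strands explain the same pairs, so neither would be
  -- indispensable.
  · intro t i t' i' ht ht' hne hlens
    obtain ⟨z, hz, hno⟩ := hneed t (hKmem ht)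
    obtain ⟨t'', ht'', hzt''⟩ := hPE z hz
    obtain rfl : t'' = t := by
      by_contra hne
      exact hno t'' ht'' hne hzt''
    refine hno t' (hKmem ht') hne.symm ?_
    obtain ⟨hzR, j, hj, hm⟩ := Finset.mem_filter.1 hzt''
    obtain rfl : j = i := by
      have := (show G.slices[t'']? = _ from hj).symm.trans ht
      simpa using this
    refine Finset.mem_filter.2 ⟨hzR, i', ht', ?_⟩
    rcases hlens with ⟨l1, l2⟩ | ⟨l1, l2⟩ <;> rcases hm with ⟨m1, m2⟩ | ⟨m1, m2⟩
    · exact Or.inl ⟨m1.trans _ _ _ l1, m2.trans _ _ _ l2⟩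
    · exact Or.inr ⟨m1.trans _ _ _ l2, m2.trans _ _ _ l1⟩
    · exact Or.inr ⟨m1.trans _ _ _ l1, m2.trans _ _ _ l2⟩
    · exact Or.inl ⟨m1.trans _ _ _ l2, m2.trans _ _ _ l1⟩

end MedialGraph

/-! ### Covers in the uncrossing order -/

namespace Matching

variable {n : ℕ}

/-- Since `σ` agrees with `τ` off the four ends, it permutes these ends among themselves (`hQ`), and
four points have just three perfect matchings. -/
theorem smoothing_cases {τ σ : Matching n} {r s : Fin (2 * n)} (h1 : s ≠ r)
    (h2 : s ≠ τ.partner r)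
    (hσ : ∀ z, z ≠ r → z ≠ τ.partner r → z ≠ s → z ≠ τ.partner s → σ.partner z = τ.partner z) :
    (σ.partner r = τ.partner r ∧ σ.partner s = τ.partner s) ∨
      (σ.partner r = s ∧ σ.partner (τ.partner r) = τ.partner s) ∨
      (σ.partner r = τ.partner s ∧ σ.partner s = τ.partner r) := by
  have i1 := τ.involutive
  have i2 := σ.involutive
  have f1 := τ.fixedPointFree
  have f2 := σ.fixedPointFree
  unfold Function.Involutive at i1 i2
  have hQ : ∀ z, (z = r ∨ z = τ.partner r ∨ z = s ∨ z = τ.partner s) →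
      (σ.partner z = r ∨ σ.partner z = τ.partner r ∨ σ.partner z = s ∨
        σ.partner z = τ.partner s) := by
    intro z hz
    by_contra hcon
    push Not at hcon
    have h := hσ _ hcon.1 hcon.2.1 hcon.2.2.1 hcon.2.2.2
    rw [i2] at h
    have h' := congrArg τ.partner h
    rw [i1] at h'
    rcases hz with rfl | rfl | rfl | rfl
    · exact hcon.2.1 h'.symm
    · exact hcon.1 (by rw [← h', i1])
    · exact hcon.2.2.2 h'.symm
    · exact hcon.2.2.1 (by rw [← h', i1])
  have q1 := hQ r (Or.inl rfl)
  have q2 := hQ s (Or.inr (Or.inr (Or.inl rfl)))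
  have q3 := hQ (τ.partner r) (Or.inr (Or.inl rfl))
  have n1 : τ.partner s ≠ r := fun h => h2 (by rw [← h, i1])
  have n2 : τ.partner s ≠ τ.partner r := fun h => h1 (τ.involutive.injective h)
  have e1 := i2 r
  have e2 := i2 s
  have e3 := f2 r
  have e4 := f2 s
  have e5 := f2 (τ.partner r)
  have e6 := i2 (τ.partner r)
  rcases q1 with q | q | q | q
  · exact absurd q e3
  · left; grind
  · right; left; grind
  · right; right; grind

theorem eq_of_smoothing {τ σ σ' : Matching n} {r s : Fin (2 * n)} (h1 : s ≠ r)
    (h2 : s ≠ τ.partner r)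
    (hσ : ∀ z, z ≠ r → z ≠ τ.partner r → z ≠ s → z ≠ τ.partner s → σ.partner z = τ.partner z)
    (hσ' : ∀ z, z ≠ r → z ≠ τ.partner r → z ≠ s → z ≠ τ.partner s →
      σ'.partner z = τ.partner z)
    (h : σ.partner r = σ'.partner r) : σ = σ' := by
  have i1 := τ.involutive
  have i2 := σ.involutive
  have i3 := σ'.involutive
  have n1 : τ.partner s ≠ r := fun h => h2 (by rw [← h, i1])
  have n2 : τ.partner s ≠ τ.partner r := fun h => h1 (τ.involutive.injective h)
  have c1 := smoothing_cases h1 h2 hσ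
  have c2 := smoothing_cases h1 h2 hσ'
  have key : σ.partner = σ'.partner := by
    funext z
    unfold Function.Involutive at i1 i2 i3
    have a1 := i2 r
    have a2 := i2 s
    have a3 := i2 (τ.partner r)
    have a4 := i2 (τ.partner s)
    have b1 := i3 r
    have b2 := i3 s
    have b3 := i3 (τ.partner r)
    have b4 := i3 (τ.partner s)
    by_cases z1 : z = r
    · rw [z1, h]
    by_cases z2 : z = τ.partner r
    · subst z2; grind
    by_cases z3 : z = s
    · subst z3; grind
    by_cases z4 : z = τ.partner s
    · subst z4; grind
    rw [hσ z z1 z2 z3 z4, hσ' z z1 z2 z3 z4]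
  cases σ
  cases σ'
  cases key
  rfl

end Matching

namespace IsSmoothing

variable {n : ℕ} {τ τ' : Matching n} {A B C D : Fin (2 * n)}

theorem crossingSum (h : IsSmoothing τ τ' A B C D)
    (hno : ∀ y : Fin (2 * n), ¬ (Crosses A D y (τ.partner y) ∧ Crosses B C y (τ.partner y) ∧
      ¬ Crosses A C y (τ.partner y))) :
    _root_.crossingSum (2 * n) τ.toNat = _root_.crossingSum (2 * n) τ'.toNat + 8 := by
  refine crossingSum_eq_add_eight (A := A) (B := B) (C := C) (D := D) τ.isPairing_toNat A.isLt
    B.isLt ?_ ?_ ?_ ?_ ?_ ?_ ?_ h.crosses ?_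
  · rw [τ.toNat_coe, h.left₁]
  · rw [τ.toNat_coe, h.left₂]
  · rw [τ'.toNat_coe, h.right₁]
  · rw [τ'.toNat_coe, h.right₂]
  · rw [τ'.toNat_coe, ← h.right₁, τ'.involutive]
  · rw [τ'.toNat_coe, ← h.right₂, τ'.involutive]
  · intro x hx n1 n2 n3 n4
    have := h.eq_of_ne ⟨x, hx⟩ (fun e => n1 (congrArg Fin.val e)) (fun e => n2 (congrArg Fin.val e))
      (fun e => n3 (congrArg Fin.val e)) (fun e => n4 (congrArg Fin.val e))
    rw [Matching.toNat, Matching.toNat, dif_pos hx, dif_pos hx, this]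
  · intro y hy _ _ _ _
    rw [Matching.toNat, dif_pos hy]
    exact hno ⟨y, hy⟩

end IsSmoothing

theorem IsColoring.flow_append_iff {u v : List Slice} {S : ℕ → ℕ → Prop}
    (h : IsColoring (u ++ v) S) (hv : NoDeath v) (p : ℕ) :
    S u.length p ↔ S (u ++ v).length (flow v p) := by
  rw [isColoring_append] at h
  rw [List.length_append]
  exact h.2.flow_iff hv p

namespace MedialGraph

variable {n : ℕ}

theorem HasPairing.partner_eq {G : MedialGraph n} {τ : Matching n} (h : G.HasPairing τ)
    {r s : Fin (2 * n)} (hne : s ≠ r)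
    (hs : G.SameStrand (G.boundaryPoint r) (G.boundaryPoint s)) : τ.partner r = s :=
  (((h r s).1 hs).resolve_left hne).symm

theorem HasPairing.sameStrand {G : MedialGraph n} {τ : Matching n} (h : G.HasPairing τ)
    (r : Fin (2 * n)) :
    G.SameStrand (G.boundaryPoint r) (G.boundaryPoint (τ.partner r)) :=
  (h _ _).2 (Or.inr rfl)

/-- Smoothing a crossing changes the pairing only at the ends of the strands which cross. -/
theorem HasPairing.partner_eq_of_smoothing {G G' : MedialGraph n} {τ σ : Matching n}
    (hG : G.HasPairing τ) (hG' : G'.HasPairing σ) {u v : List Slice} {i : ℕ}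
    (hs : G.slices = u ++ Slice.cross i :: v)
    (hs' : G'.slices = u ++ v ∨ G'.slices = u ++ Slice.death i :: Slice.birth i :: v)
    {r s : Fin (2 * n)} (hr : G.SameStrand (G.boundaryPoint r) (u.length, i))
    (hsi : G.SameStrand (G.boundaryPoint s) (u.length, i + 1)) (z : Fin (2 * n)) (z1 : z ≠ r)
    (z2 : z ≠ τ.partner r) (z3 : z ≠ s) (z4 : z ≠ τ.partner s) :
    σ.partner z = τ.partner z := by
  have hpair := (G.hasPairing_iff τ).1 hG
  have hi := τ.involutive
  -- Colour just the chord of `z`. Neither strand at the crossing is coloured, so the colouring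
  -- survives the smoothing and still confines the strand of `z` to the same two ends.
  obtain ⟨S, hS, hlast⟩ := exists_isColoring G.validSlices
    (fun p => p = z ∨ p = τ.partner z) fun p hp => by
      rw [G.bottomWidth_eq] at hp
      rw [hpair p hp, Matching.toNat, dif_pos hp]
      obtain ⟨q, rfl⟩ : ∃ q : Fin (2 * n), (q : ℕ) = p := ⟨⟨p, hp⟩, rfl⟩
      simp only [← Fin.ext_iff, Fin.eta]
      rw [hi.eq_iff, hi.injective.eq_iff, or_comm]
  have hval : ∀ y : Fin (2 * n), S G.slices.length y ↔ y = z ∨ y = τ.partner z := fun y => by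
    rw [hlast]
    simp only [← Fin.ext_iff]
  have k1 : ¬ S u.length i := by
    rw [← (G.sameStrand_iff _ _).1 hr S hS]
    change ¬ S G.slices.length r
    rw [hval]
    rintro (h | h)
    · exact z1 h.symm
    · exact z2 (by rw [h, hi])
  have k2 : ¬ S u.length (i + 1) := by
    rw [← (G.sameStrand_iff _ _).1 hsi S hS]
    change ¬ S G.slices.length s
    rw [hval]
    rintro (h | h)
    · exact z3 h.symm
    · exact z4 (by rw [h, hi])
  have hS' := hS
  rw [hs] at hS'
  obtain ⟨T, hT, hTlast⟩ := hS'.smooth (iff_of_false k1 k2) hs'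
  rw [← hs] at hTlast
  have h1 := ((G'.sameStrand_iff _ _).1 (hG'.sameStrand z) T hT).1
  simp only [boundaryPoint, hTlast] at h1
  rw [hval, hval] at h1
  exact (h1 (Or.inl rfl)).resolve_left (σ.fixedPointFree z)

end MedialGraph

open MedialGraph in
/-- Covers in the uncrossing order uncross two chords, or do nothing. -/
theorem UncrossingCover.eq_or_isSmoothing {n : ℕ} {τ τ' : Matching n}
    (h : UncrossingCover τ' τ) : τ' = τ ∨ ∃ A B C D, IsSmoothing τ τ' A B C D := by
  obtain ⟨G, G', hL, hG, ⟨u, v, i, hs, hs'⟩, -, hG'⟩ := h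
  have hcr : G.IsCrossing u.length i := by
    unfold IsCrossing
    rw [hs]
    simp
  obtain ⟨p1, p2⟩ := G.isPoint_of_isCrossing hcr
  obtain ⟨r, hr⟩ := hL.no_closed _ p1
  obtain ⟨s, hsi⟩ := hL.no_closed _ p2
  replace hr := hr.symm _ _
  replace hsi := hsi.symm _ _
  have agree := hG.partner_eq_of_smoothing hG' hs hs' hr hsi
  -- Lenslessness turns the crossing of the drawing into interlacing of the two chords.
  have hX := hL.crosses r.isLt s.isLt hcr hr hsi
  have hpair := (G.hasPairing_iff τ).1 hG
  rw [hpair r r.isLt, hpair s s.isLt, τ.toNat_coe, τ.toNat_coe] at hX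
  have hself := hL.no_self_crossing _ _ hcr
  have h1 : s ≠ r := by
    rintro rfl
    exact hself ((hr.symm _ _).trans _ _ _ hsi)
  have h2 : s ≠ τ.partner r := by
    rintro rfl
    exact hself ((hr.symm _ _).trans _ _ _ ((hG.sameStrand r).trans _ _ _ hsi))
  rcases Matching.smoothing_cases h1 h2 agree with c | c | c
  · exact Or.inl (Matching.eq_of_smoothing h1 h2 agree (fun _ _ _ _ _ => rfl) c.1)
  -- Joining `r` to `s` is the standard smoothing with the two ends of the second chord exchanged.
  · refine Or.inr ⟨r, τ.partner s, s, τ.partner r, rfl, τ.involutive s, c.1, ?_,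
      fun x x1 x2 x3 x4 => agree x x1 x4 x3 x2, ?_⟩
    · rw [← c.2, τ'.involutive]
    · rwa [crosses_swap_right]
  · exact Or.inr ⟨r, s, τ.partner s, τ.partner r, rfl, rfl, c.1, c.2,
      fun x x1 x2 x3 x4 => agree x x1 x4 x2 x3, hX⟩

theorem UncrossingLE.bruhatLE {n : ℕ} [NeZero n] {τ τ' : Matching n} (h : UncrossingLE τ' τ) :
    AffinePerm.BruhatLE τ.fPerm.toAffinePerm τ'.fPerm.toAffinePerm := by
  induction h with
  | refl => exact .refl
  | tail _ hc ih =>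
    rcases hc.eq_or_isSmoothing with rfl | ⟨A, B, C, D, hs⟩
    · exact ih
    · exact hs.bruhatLE.trans ih

/-! ### Drawings of covers -/

namespace MedialGraph

variable {n : ℕ}

/-- At a crossing of a drawing without local minima, one of the two smoothings joins a given end
of one strand to a given end of the other. -/
theorem HasPairing.exists_uncrosses {G : MedialGraph n} {τ : Matching n} (hG : G.HasPairing τ)
    (hL : G.Lensless) (hd : NoDeath G.slices) {t i : ℕ} (hcr : G.IsCrossing t i)
    {r s z : Fin (2 * n)} (hr : G.SameStrand (G.boundaryPoint r) (t, i))
    (hs : G.SameStrand (G.boundaryPoint s) (t, i + 1)) (hz : z = s ∨ z = τ.partner s) :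
    ∃ (G' : MedialGraph n) (σ : Matching n), G.Uncrosses G' ∧ G'.HasPairing σ ∧
      σ.partner r = z ∧ (∀ x, x ≠ r → x ≠ τ.partner r → x ≠ s → x ≠ τ.partner s →
        σ.partner x = τ.partner x) ∧ NoClosedStrand G'.slices ∧
      G.slices.countP Slice.isCross = G'.slices.countP Slice.isCross + 1 := by
  obtain ⟨ht, hget⟩ := List.getElem?_eq_some_iff.1 hcr
  obtain ⟨u, v, hw, rfl⟩ : ∃ u v, G.slices = u ++ Slice.cross i :: v ∧ u.length = t :=
    ⟨G.slices.take t, G.slices.drop (t + 1), by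
      rw [← hget, List.cons_getElem_drop_succ, List.take_append_drop], by simp [ht.le]⟩
  have hself := hL.no_self_crossing _ _ hcr
  have hval := G.validSlices
  have hwidth := G.bottomWidth_eq
  rw [hw] at hval hwidth hd
  rw [List.append_cons] at hval hwidth
  have hdu : NoDeath u := fun j hj => hd j (List.mem_append_left _ hj)
  have hdv : NoDeath v := fun j hj => hd j (List.mem_append_right _ (List.mem_cons_of_mem _ hj))
  have hvalu' := hval.of_append
  obtain ⟨hvalu, hfit⟩ := (validSlices_concat _ _).1 hvalu'
  have hfit : i + 2 ≤ bottomWidth u := hfit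
  have hwu : bottomWidth (u ++ [Slice.cross i]) = bottomWidth u := by
    rw [bottomWidth_concat]; rfl
  obtain ⟨x, hx⟩ : ∃ x, slicePairing u i = x := ⟨_, rfl⟩
  obtain ⟨y, hy⟩ : ∃ y, slicePairing u (i + 1) = y := ⟨_, rfl⟩
  obtain ⟨x1, x2, x3⟩ := hvalu.isPairing i (by omega)
  obtain ⟨y1, y2, y3⟩ := hvalu.isPairing (i + 1) (by omega)
  rw [hx] at x1 x2 x3
  rw [hy] at y1 y2 y3
  have colx : ∀ {S w'}, IsColoring (u ++ w') S → (S u.length i ↔ S u.length x) := fun h => by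
    rw [h.of_append.slicePairing_iff hvalu (by omega), hx]
  have coly : ∀ {S w'}, IsColoring (u ++ w') S → (S u.length (i + 1) ↔ S u.length y) :=
    fun h => by rw [h.of_append.slicePairing_iff hvalu (by omega), hy]
  have hxi : x ≠ i + 1 := by
    rintro rfl
    refine hself ((G.sameStrand_iff _ _).2 fun S hS => ?_)
    rw [hw] at hS
    exact colx hS
  have hyi : y ≠ i := by
    rintro rfl
    rw [hx] at y3
    exact hxi y3
  have hxy : x ≠ y := by
    rintro rfl
    omega
  have hlt : ∀ {p}, p < bottomWidth u → flow v p < 2 * n := fun hp => by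
    rw [← hwidth]
    exact flow_lt hval hdv (by rwa [hwu])
  have hne : ∀ {p q : ℕ} (hp : p < bottomWidth u) (hq : q < bottomWidth u), p ≠ q →
      (⟨flow v p, hlt hp⟩ : Fin (2 * n)) ≠ ⟨flow v q, hlt hq⟩ := fun _ _ h e =>
    h (flow_injective hdv (congrArg Fin.val e))
  have hi1 : i < bottomWidth u := by omega
  have hi2 : i + 1 < bottomWidth u := by omega
  -- The four ends at the bottom. Without local minima below, positions flow straight down: `x` and
  -- `y` to `a` and `b`, the two positions just below the crossing to `c` and `d`. The crossing
  -- makes the strands `a`–`d` and `b`–`c`.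
  set a : Fin (2 * n) := ⟨flow v x, hlt x1⟩ with ha
  set b : Fin (2 * n) := ⟨flow v y, hlt y1⟩ with hb
  set c : Fin (2 * n) := ⟨flow v i, hlt hi1⟩ with hc
  set d : Fin (2 * n) := ⟨flow v (i + 1), hlt hi2⟩ with hdd
  have hcol : ∀ {S : ℕ → ℕ → Prop}, IsColoring (u ++ Slice.cross i :: v) S →
      (S u.length i ↔ S (u ++ Slice.cross i :: v).length a) ∧
      (S u.length i ↔ S (u ++ Slice.cross i :: v).length d) ∧
      (S u.length (i + 1) ↔ S (u ++ Slice.cross i :: v).length b) ∧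
      (S u.length (i + 1) ↔ S (u ++ Slice.cross i :: v).length c) := by
    intro S hS
    have hx' := colx hS
    have hy' := coly hS
    rw [List.append_cons] at hS ⊢
    have hf := fun p => hS.flow_append_iff hdv p
    have hc := ((isColoring_concat _ _ _).1 hS.of_append).2
    rw [Slice.compatible_cross] at hc
    rw [List.length_append, List.length_singleton] at hf
    have c1 := hc i
    have c2 := hc (i + 1)
    have c3 := hc x
    have c4 := hc y
    rw [Equiv.swap_apply_left] at c1
    rw [Equiv.swap_apply_right] at c2
    rw [Equiv.swap_apply_of_ne_of_ne x2 hxi] at c3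
    rw [Equiv.swap_apply_of_ne_of_ne hyi y2] at c4
    exact ⟨hx'.trans (c3.trans (hf x)), c1.trans (hf _), hy'.trans (c4.trans (hf y)),
      c2.trans (hf _)⟩
  have hτa : τ.partner a = d := hG.partner_eq (hne hi2 x1 hxi.symm) <|
    (G.sameStrand_iff _ _).2 fun S hS => by
      simp only [boundaryPoint]
      rw [hw] at hS ⊢
      rw [← (hcol hS).1, (hcol hS).2.1]
  have hτb : τ.partner b = c := hG.partner_eq (hne hi1 y1 hyi.symm) <|
    (G.sameStrand_iff _ _).2 fun S hS => by
      simp only [boundaryPoint]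
      rw [hw] at hS ⊢
      rw [← (hcol hS).2.2.1, (hcol hS).2.2.2]
  have hra : r = a ∨ r = d := by
    have : G.SameStrand (G.boundaryPoint a) (G.boundaryPoint r) := by
      refine .trans _ _ _ ((G.sameStrand_iff _ _).2 fun S hS => ?_) (hr.symm _ _)
      simp only [boundaryPoint]
      rw [hw] at hS ⊢
      exact (hcol hS).1.symm
    rw [hG, hτa] at this
    exact this
  have hsb : s = b ∨ s = c := by
    have : G.SameStrand (G.boundaryPoint b) (G.boundaryPoint s) := by
      refine .trans _ _ _ ((G.sameStrand_iff _ _).2 fun S hS => ?_) (hs.symm _ _)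
      simp only [boundaryPoint]
      rw [hw] at hS ⊢
      exact (hcol hS).2.2.1.symm
    rw [hG, hτb] at this
    exact this
  have hzb : z = b ∨ z = c := by
    rcases hsb with rfl | rfl
    · rwa [hτb] at hz
    · rw [← hτb, τ.involutive] at hz
      rw [← hτb]
      exact hz.symm
  -- Deleting the crossing joins `a` to `c` and `d` to `b`; replacing it by a minimum and a maximum
  -- joins `a` to `b` and `c` to `d`. Together these cover all choices of `r` and `z`.
  by_cases hside : (r = a ∧ z = c) ∨ (r = d ∧ z = b)
  · obtain ⟨val', wid'⟩ := ValidSlices.replace hwu hvalu hval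
    let G' : MedialGraph n := ⟨u ++ v, val', wid'.trans hwidth⟩
    obtain ⟨σ, hσ⟩ := G'.exists_hasPairing
    have hcol' : ∀ {S : ℕ → ℕ → Prop}, IsColoring (u ++ v) S →
        (S (u ++ v).length a ↔ S (u ++ v).length c) ∧
        (S (u ++ v).length d ↔ S (u ++ v).length b) := by
      intro S hS
      have hf := fun p => (hS.flow_append_iff hdv p).symm
      exact ⟨(hf x).trans ((colx hS).symm.trans (hf i).symm),
        (hf _).trans ((coly hS).trans (hf y).symm)⟩
    refine ⟨G', σ, ⟨u, v, i, hw, Or.inl rfl⟩, hσ, ?_,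
      hG.partner_eq_of_smoothing hσ hw (Or.inl rfl) hr hs, ?_, ?_⟩
    · rcases hside with ⟨rfl, rfl⟩ | ⟨rfl, rfl⟩
      · exact hσ.partner_eq (hne hi1 x1 x2.symm)
          ((G'.sameStrand_iff _ _).2 fun S hS => (hcol' hS).1)
      · exact hσ.partner_eq (hne y1 hi2 y2)
          ((G'.sameStrand_iff _ _).2 fun S hS => (hcol' hS).2)
    · refine NoDeath.noClosedStrand (fun j hj => ?_) val'
      exact (List.mem_append.1 hj).elim (hdu j) (hdv j)
    · rw [hw]
      simp [G', List.countP_cons, Slice.isCross, add_assoc]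
  · have hside' : (r = a ∧ z = b) ∨ (r = d ∧ z = c) := by tauto
    have hv1 : ValidSlices (u ++ [Slice.death i]) := (validSlices_concat _ _).2 ⟨hvalu, hfit⟩
    have hw1 : bottomWidth (u ++ [Slice.death i]) = bottomWidth u - 2 := by
      rw [bottomWidth_concat]; rfl
    have hv2 : ValidSlices (u ++ [Slice.death i] ++ [Slice.birth i]) :=
      (validSlices_concat _ _).2 ⟨hv1, by
        change i ≤ _
        omega⟩
    have hw2 : bottomWidth (u ++ [Slice.death i] ++ [Slice.birth i]) = bottomWidth u := by
      rw [bottomWidth_concat, hw1]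
      change _ - 2 + 2 = _
      omega
    obtain ⟨val', wid'⟩ := ValidSlices.replace (hwu.trans hw2.symm) hv2 hval
    let G' : MedialGraph n := ⟨u ++ [Slice.death i] ++ [Slice.birth i] ++ v, val',
      wid'.trans hwidth⟩
    have hG' : G'.slices = u ++ Slice.death i :: Slice.birth i :: v := by
      simp [G']
    obtain ⟨σ, hσ⟩ := G'.exists_hasPairing
    have hcol' : ∀ {S : ℕ → ℕ → Prop}, IsColoring G'.slices S →
        (S G'.slices.length a ↔ S G'.slices.length b) ∧
        (S G'.slices.length d ↔ S G'.slices.length c) := by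
      intro S hS
      have hf := fun p => (hS.flow_append_iff hdv p).symm
      obtain ⟨hS1, hbirth⟩ := (isColoring_concat _ _ _).1 hS.of_append
      have hdeath := ((isColoring_concat _ _ _).1 hS1).2
      rw [Slice.compatible_birth] at hbirth
      rw [Slice.compatible_death] at hdeath
      simp only [List.length_append, List.length_singleton] at hf hbirth
      have hthrough : ∀ {p}, p ≠ i → p ≠ i + 1 → (S (u.length + 1 + 1) p ↔ S u.length p) := by
        intro p n1 n2
        rw [← Slice.up_down n1 n2, ← hbirth.1, hdeath.1]
      have hcx := colx hS1
      have hcy := coly hS1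
      simp only [G', List.length_append, List.length_singleton]
      constructor
      · exact (hf x).trans ((hthrough x2 hxi).trans (hcx.symm.trans (hdeath.2.trans (hcy.trans
          ((hthrough hyi y2).symm.trans (hf y).symm)))))
      · exact (hf _).trans (hbirth.2.symm.trans (hf _).symm)
    refine ⟨G', σ, ⟨u, v, i, hw, Or.inr hG'⟩, hσ, ?_,
      hG.partner_eq_of_smoothing hσ hw (Or.inr hG') hr hs, ?_, ?_⟩
    · rcases hside' with ⟨rfl, rfl⟩ | ⟨rfl, rfl⟩
      · exact hσ.partner_eq (hne y1 x1 hxy.symm)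
          ((G'.sameStrand_iff _ _).2 fun S hS => (hcol' hS).1)
      · exact hσ.partner_eq (hne hi1 hi2 (by omega))
          ((G'.sameStrand_iff _ _).2 fun S hS => (hcol' hS).2)
    -- The only local minimum is the new one. It joins ends of different strands of `u`, as the
    -- original crossing was not a self-crossing.
    · refine NoClosedStrand.append ?_ val' hdv
      refine NoClosedStrand.concat hv2 ?_ fun j hj => by simp at hj
      refine NoClosedStrand.concat hv1 (hdu.noClosedStrand hvalu) fun j hj => ?_
      obtain rfl : i = j := by simpa using hj
      rwa [hx]
    · rw [hw, hG']
      simp [List.countP_cons, Slice.isCross, add_assoc]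

end MedialGraph

open MedialGraph in
/-- Uncrossing two chords is a cover if no chord crosses both without crossing the new ones. -/
theorem IsSmoothing.uncrossingCover {n : ℕ} {τ τ' : Matching n} {A B C D : Fin (2 * n)}
    (h : IsSmoothing τ τ' A B C D)
    (hno : ∀ y : Fin (2 * n), ¬ (Crosses A D y (τ.partner y) ∧ Crosses B C y (τ.partner y) ∧
      ¬ Crosses A C y (τ.partner y))) : UncrossingCover τ' τ := by
  obtain ⟨w, hval, hwidth, hd, hpair, hcount⟩ := exists_slices (2 * n) τ.toNat τ.isPairing_toNat
  let G : MedialGraph n := ⟨w, hval, hwidth⟩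
  have hG : G.HasPairing τ := (G.hasPairing_iff τ).2 hpair
  have hL : G.Lensless := by
    refine G.lensless_of_crossingSum (hd.noClosedStrand hval) ?_
    rw [crossingSum_congr hpair]
    exact hcount
  have hAB : A ≠ B ∧ D ≠ B := by
    have := h.crosses.ne
    exact ⟨fun e => this.1 (congrArg _ e), fun e => this.2.2.2.2.1 (congrArg _ e).symm⟩
  -- The smoothing removes one crossing from the minimal drawing, and by `hno` the crossing sum
  -- drops by exactly eight. The new drawing is thus minimal for `τ'`, hence lensless.
  suffices key : ∃ (G' : MedialGraph n) (σ : Matching n), G.Uncrosses G' ∧ G'.HasPairing σ ∧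
      σ = τ' ∧ NoClosedStrand G'.slices ∧
      G.slices.countP Slice.isCross = G'.slices.countP Slice.isCross + 1 by
    obtain ⟨G', σ, h1, h2, rfl, h3, h4⟩ := key
    refine ⟨G, G', hL, hG, h1, G'.lensless_of_crossingSum h3 ?_, h2⟩
    rw [crossingSum_congr ((G'.hasPairing_iff σ).1 h2)]
    have h5 := h.crossingSum hno
    have h6 : 8 * G.slices.countP Slice.isCross = _ := hcount
    omega
  obtain ⟨t, i, hcr, hm⟩ := G.exists_isCrossing A.isLt B.isLt (by
    rw [hpair A A.isLt, hpair B B.isLt, τ.toNat_coe, τ.toNat_coe, h.left₁, h.left₂]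
    exact h.crosses)
  rcases hm with ⟨m1, m2⟩ | ⟨m1, m2⟩
  · obtain ⟨G', σ, h1, h2, h3, h4, h5⟩ := hG.exists_uncrosses hL hd hcr m1 m2
      (z := C) (Or.inr h.left₂.symm)
    refine ⟨G', σ, h1, h2, Matching.eq_of_smoothing hAB.1.symm (by rw [h.left₁]; exact hAB.2.symm)
      h4 (fun z z1 z2 z3 z4 => h.eq_of_ne z z1 z3 ?_ ?_) (h3.trans h.right₁.symm), h5⟩
    · rwa [h.left₂] at z4
    · rwa [h.left₁] at z2
  -- Here the chord `BC` enters on the left. Prescribing the join of `B` to `D` selects the same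
  -- smoothing.
  · obtain ⟨G', σ, h1, h2, h3, h4, h5⟩ := hG.exists_uncrosses hL hd hcr m2 m1
      (z := D) (Or.inr h.left₁.symm)
    refine ⟨G', σ, h1, h2, Matching.eq_of_smoothing hAB.1 (fun e => hAB.2 ?_)
      h4 (fun z z1 z2 z3 z4 => h.eq_of_ne z z3 z1 ?_ ?_) (h3.trans h.right₂.symm), h5⟩
    · rw [← h.left₁, e, τ.involutive]
    · rwa [h.left₂] at z2
    · rwa [h.left₁] at z4

theorem Matching.uncrossingLE_of_necklaceLE {n : ℕ} [NeZero n] {τ τ' : Matching n}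
    (h : NecklaceLE (grassmannNecklace τ.fPerm) (grassmannNecklace τ'.fPerm)) :
    UncrossingLE τ' τ := by
  rw [Matching.necklaceLE_iff] at h
  -- Each smoothing keeps the arc inequality with `τ'` and removes one crossing, so the process
  -- ends, and it can only end at `τ'`.
  induction hk : crossingSum (2 * n) τ.toNat using Nat.strong_induction_on generalizing τ with
  | _ k ih =>
  subst hk
  by_cases hne : τ = τ'
  · subst hne
    exact .refl
  obtain ⟨τ'', A, B, C, D, hs, hno, hle⟩ := Matching.exists_isSmoothing h hne
  have hsum := hs.crossingSum hno
  exact (ih _ (by omega) hle rfl).tail (hs.uncrossingCover hno)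

theorem corollary3p10 (n : ℕ) [NeZero n] (τ τ' : Matching n) :
    List.TFAE [
      UncrossingLE τ' τ,
      AffinePerm.BruhatLE τ.fPerm.toAffinePerm τ'.fPerm.toAffinePerm,
      NecklaceLE (grassmannNecklace τ.fPerm) (grassmannNecklace τ'.fPerm)] := by
  tfae_have 1 → 2 := UncrossingLE.bruhatLE
  tfae_have 2 → 3 := Matching.necklaceLE_of_bruhatLE
  tfae_have 3 → 1 := Matching.uncrossingLE_of_necklaceLE
  tfae_finish
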